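/- Let $G$ be a group, $R$ an associative unital ring, $N \subset G$ a normal subgroup of finite index, and $W = G/N$. Definitions. A $G$-set $S$ is \emph{admissible} if all stabilizers of its elements have finite index in $G$ and for every subgroup $H \subset G$ of finite index the fixed point set $S^H$ is finite. Let $\widehat{\Gamma}_{G+}$ be the category of admissible pointed $G$-sets (the distinguished element is $G$-fixed; maps are equivariant and pointed), and $\Gamma_{W+}$ the category of finite pointed $W$-sets. Let $\phi^N : \widehat{\Gamma}_{G+} \to \Gamma_{W+}$ be the functor $S \mapsto S^N$, and $\lambda^N : \Gamma_{W+} \to \widehat{\Gamma}_{G+}$ its left adjoint, which sends a $W$-set to the same set with $G$ acting through $G \to W$. For an (essentially) small category $\mathcal{C}$, $\mathcal{D}(\mathcal{C},R)$ is the unbounded derived category of the category of functors from $\mathcal{C}$ to $R$-modules. For a functor $\gamma : \mathcal{C} \to \mathcal{C}'$, the derived left Kan extension $L\gamma_! : \mathcal{D}(\mathcal{C},R) \to \mathcal{D}(\mathcal{C}',R)$ is the left adjoint of the pullback functor $\gamma^*$. For $\tau : \mathcal{C} \to \mathrm{pt}$, where $\mathrm{pt}$ is the point category, put $C_\bullet(\mathcal{C},E)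 = L\tau_! E \in \mathcal{D}(R)$, and for a bisimplicial object $Y : (\Delta^o)^2 \to \widehat{\Gamma}_{G+}$ and $E \in \mathcal{D}(\widehat{\Gamma}_{G+},R)$ put $C_\bullet(Y,E) = C_\bullet((\Delta^o)^2, Y^*E)$. Let $\Delta_+$ be the category of non-empty finite ordinals and monotone maps that preserve the terminal element, let $\kappa : \Delta \to \Delta_+$ be the functor that adds a new terminal element to an ordinal, and let $[0]_+ \in \Delta_+$ be the one-element ordinal. A simplicial set is \emph{contractible} if it is isomorphic to $\kappa^*\widetilde{X}$ for a functor $\widetilde{X} : \Delta_+^o \to \mathrm{Sets}$ with $\widetilde{X}([0]_+)$ a one-element set. A bisimplicial set is \emph{contractible} if it is isomorphic to $(\kappa \times \mathrm{id})^*\widetilde{X}$ for a functor $\widetilde{X} : \Delta_+^o \times \Delta^o \to \mathrm{Sets}$ whose restriction to $[0]_+ \times \Delta^o$ is a contractible simplicial set. A bisimplicial admissible pointed $G$-set $X : (\Delta^o)^2 \to \widehat{\Gamma}_{G+}$ is \emph{$N$-adapted} if (i) $X^N$ is isomorphic to the constant bisimplicial pointed set $[1]_+$ (two elements, one of them distinguished)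 with the trivial action, and (ii) for every subgroup $H \subset G$ of finite index not containing $N$, the bisimplicial set $X^H$ (without its distinguished point) is contractible. Let $X$ be $N$-adapted. Let $p, m_X : (\Delta^o)^2 \times \widehat{\Gamma}_{G+} \to \widehat{\Gamma}_{G+}$ be the projection and the functor $(n,S) \mapsto S \wedge X(n)$, and put $\mathrm{Av}_X = Lp_! \circ m_X^*$ and $\Phi^N = \lambda^{N*} \circ \mathrm{Av}_X : \mathcal{D}(\widehat{\Gamma}_{G+},R) \to \mathcal{D}(\Gamma_{W+},R)$. The embedding $[1]_+ \cong X^N \to X$ gives maps $S \to S \wedge X$ and hence a map $\mathrm{Id} \to \mathrm{Av}_X$; the embeddings $S^N \to S$ give a map $\phi^{N*}\Phi^N \to \mathrm{Av}_X$. Proposition. The left adjoints $L\phi^N_!$, $Lp_!$ and $C_\bullet((\Delta^o)^2,-)$ exist, and: (a) the map $\phi^{N*}\Phi^N \to \mathrm{Av}_X$ is an isomorphism, and the map $L\phi^N_! \to \Phi^N$ adjoint to the composition $\mathrm{Id} \to \mathrm{Av}_X \cong \phi^{N*}\Phi^N$ is an isomorphism of functors $\mathcal{D}(\widehat{\Gamma}_{G+},R)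 \to \mathcal{D}(\Gamma_{W+},R)$; (b) for every $S \in \Gamma_{W+}$, the base change map $C_\bullet(\lambda^N(S) \wedge X, E) \to \Phi^N(E)(S)$ is an isomorphism, naturally in $E \in \mathcal{D}(\widehat{\Gamma}_{G+},R)$. -/

import Mathlib

open CategoryTheory

universe v₁ v₂ v₃ u₁ u₂ u₃ u

noncomputable section

/-! ### Derived categories of functor categories, pullbacks and derived left Kan extensions -/

/-- The standard localization of complexes of functors `C ⥤ ModuleCat R` at quasi-isomorphisms. -/
instance funHasDerivedCategory (R : Type u) [Ring R] (C : Type u₁) [Category.{v₁} C] :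
    HasDerivedCategory.{max u u₁ v₁ (u + 1)} (C ⥤ ModuleCat.{u} R) :=
  HasDerivedCategory.standard _

/-- The (unbounded) derived category `𝒟(C, R)` of the abelian category of functors from `C`
to `R`-modules. -/
abbrev DFun (R : Type u) [Ring R] (C : Type u₁) [Category.{v₁} C] :=
  DerivedCategory (C ⥤ ModuleCat.{u} R)

section Pullback

variable (R : Type u) [Ring R] {C : Type u₁} [Category.{v₁} C] {C' : Type u₂} [Category.{v₂} C']
  {C'' : Type u₃} [Category.{v₃} C'']

/-- Precomposition with `γ`, as an (exact) functor of abelian categories. -/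
abbrev precomp (γ : C ⥤ C') : (C' ⥤ ModuleCat.{u} R) ⥤ (C ⥤ ModuleCat.{u} R) :=
  (Functor.whiskeringLeft C C' (ModuleCat.{u} R)).obj γ

/-- The pullback functor `γ^* : 𝒟(C', R) ⥤ 𝒟(C, R)`. -/
def pull (γ : C ⥤ C') : DFun R C' ⥤ DFun R C :=
  (precomp R γ).mapDerivedCategory

/-- Pullback on the level of complexes, followed by localization. -/
abbrev pullQ (γ : C ⥤ C') : CochainComplex (C' ⥤ ModuleCat.{u} R) ℤ ⥤ DFun R C :=
  (precomp R γ).mapHomologicalComplex (ComplexShape.up ℤ) ⋙ DerivedCategory.Q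

/-- Quasi-isomorphisms of complexes of functors. -/
abbrev qis (C : Type u₁) [Category.{v₁} C] :=
  HomologicalComplex.quasiIso (C ⥤ ModuleCat.{u} R) (ComplexShape.up ℤ)

instance pullLifting (γ : C ⥤ C') :
    Localization.Lifting DerivedCategory.Q (qis R C') (pullQ R γ) (pull R γ) :=
  ⟨(precomp R γ).mapDerivedCategoryFactors⟩

/-- A natural transformation `α : γ ⟶ γ'` induces `γ^* ⟶ γ'^*`. -/
def pullMap {γ γ' : C ⥤ C'} (α : γ ⟶ γ') : pull R γ ⟶ pull R γ' :=
  Localization.liftNatTrans DerivedCategory.Q (qis R C') (pullQ R γ) (pullQ R γ') _ _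
    (Functor.whiskerRight
      (NatTrans.mapHomologicalComplex
        ((Functor.whiskeringLeft C C' (ModuleCat.{u} R)).map α) (ComplexShape.up ℤ))
      DerivedCategory.Q)

instance pullLiftingComp (γ : C ⥤ C') (δ : C' ⥤ C'') :
    Localization.Lifting DerivedCategory.Q (qis R C'')
      ((precomp R δ).mapHomologicalComplex (ComplexShape.up ℤ) ⋙ pullQ R γ)
      (pull R δ ⋙ pull R γ) :=
  ⟨Functor.isoWhiskerRight (precomp R δ).mapDerivedCategoryFactors (pull R γ) ≪≫
    Functor.isoWhiskerLeft ((precomp R δ).mapHomologicalComplex (ComplexShape.up ℤ))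
      (precomp R γ).mapDerivedCategoryFactors⟩

/-- `(γ ⋙ δ)^* ≅ γ^* ∘ δ^*`, induced by the identity on the level of complexes. -/
def pullComp (γ : C ⥤ C') (δ : C' ⥤ C'') : pull R (γ ⋙ δ) ≅ pull R δ ⋙ pull R γ :=
  Localization.liftNatIso DerivedCategory.Q (qis R C'') (pullQ R (γ ⋙ δ))
    ((precomp R δ).mapHomologicalComplex (ComplexShape.up ℤ) ⋙ pullQ R γ) _ _ (Iso.refl _)

/-- `id^* ≅ id`, induced by the identity on the level of complexes. -/
def pullId (C : Type u₁) [Category.{v₁} C] : pull R (𝟭 C) ≅ 𝟭 (DFun R C) :=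
  Localization.liftNatIso DerivedCategory.Q (qis R C) (pullQ R (𝟭 C)) DerivedCategory.Q _ _
    (Iso.refl _)

/-- A derived left Kan extension `L γ_!` along `γ`: a functor between derived categories
that is left adjoint to the pullback functor `γ^*`, with a choice of adjunction. -/
structure DerivedLan (γ : C ⥤ C') where
  /-- the functor `L γ_! : 𝒟(C, R) ⥤ 𝒟(C', R)` -/
  functor : DFun R C ⥤ DFun R C'
  /-- the adjunction between `L γ_!` and `γ^*` -/
  adj : functor ⊣ pull R γ

/-- The point category. -/
abbrev Pt := Discrete PUnit.{1}

/-- The tautological projection `C ⥤ pt`. -/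
abbrev toPt (C : Type u₁) [Category.{v₁} C] : C ⥤ Pt := Functor.star C

/-- The functor `pt ⥤ C` with value `c`. -/
abbrev atPt (c : C) : Pt ⥤ C := Functor.fromPUnit c

end Pullback

/-! ### Contractible bisimplicial sets -/

/-- Maps of non-empty finite ordinals that send the terminal element to the terminal element. -/
def preservesLast : MorphismProperty SimplexCategory :=
  fun _ _ f => f.toOrderHom (Fin.last _) = Fin.last _

instance : preservesLast.IsMultiplicative where
  id_mem _ := rfl
  comp_mem f g hf hg := by
    change g.toOrderHom (f.toOrderHom (Fin.last _)) = Fin.last _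
    rw [show f.toOrderHom (Fin.last _) = Fin.last _ from hf]
    exact hg

/-- The category `Δ_+` of non-empty finite ordinals and maps that preserve the terminal element. -/
abbrev DeltaPlus := WideSubcategory preservesLast

/-- The ordinal `[0]_+` with a single element. -/
def DeltaPlus.zero : DeltaPlus := ⟨SimplexCategory.mk 0⟩

/-- The monotone map obtained by adding a new terminal element to both ordinals. -/
def addLast {m n : ℕ} (f : Fin (m + 1) →o Fin (n + 1)) : Fin (m + 2) →o Fin (n + 2) where
  toFun := Fin.lastCases (motive := fun _ => Fin (n + 2)) (Fin.last _) fun i => (f i).castSucc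
  monotone' := by
    intro a b h
    induction b using Fin.lastCases with
    | last => simpa using Fin.le_last _
    | cast j =>
      induction a using Fin.lastCases with
      | last => exact absurd h (not_le.2 (Fin.castSucc_lt_last j))
      | cast i => simpa using f.monotone (by simpa using h)

@[simp]
lemma addLast_last {m n : ℕ} (f : Fin (m + 1) →o Fin (n + 1)) :
    addLast f (Fin.last _) = Fin.last _ :=
  Fin.lastCases_last (motive := fun _ => Fin (n + 2))

@[simp]
lemma addLast_castSucc {m n : ℕ} (f : Fin (m + 1) →o Fin (n + 1)) (i : Fin (m + 1)) :
    addLast f i.castSucc = (f i).castSucc :=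
  Fin.lastCases_castSucc (motive := fun _ => Fin (n + 2)) i

/-- The functor `κ : Δ ⥤ Δ_+` that adds a new terminal element. -/
def kappa : SimplexCategory ⥤ DeltaPlus where
  obj a := ⟨SimplexCategory.mk (a.len + 1)⟩
  map f := ⟨SimplexCategory.Hom.mk (addLast f.toOrderHom), addLast_last f.toOrderHom⟩
  map_id a := by
    refine WideSubcategory.hom_ext _ (SimplexCategory.Hom.ext _ _ (OrderHom.ext _ _ ?_))
    funext i
    induction i using Fin.lastCases with
    | last => exact addLast_last _
    | cast i => exact addLast_castSucc _ i
  map_comp f g := by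
    refine WideSubcategory.hom_ext _ (SimplexCategory.Hom.ext _ _ (OrderHom.ext _ _ ?_))
    funext i
    induction i using Fin.lastCases with
    | last =>
      exact (addLast_last _).trans
        ((congrArg (addLast g.toOrderHom) (addLast_last f.toOrderHom)).trans (addLast_last _)).symm
    | cast i =>
      exact (addLast_castSucc _ i).trans
        ((congrArg (addLast g.toOrderHom) (addLast_castSucc f.toOrderHom i)).trans
          (addLast_castSucc _ _)).symm

/-- A simplicial set is contractible if it extends along `κ` to a functor `Δ_+ᵒᵖ ⥤ Sets` whose
value at `[0]_+` is a one-element set. -/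
def SContractible (X : SimplexCategoryᵒᵖ ⥤ Type u) : Prop :=
  ∃ X' : DeltaPlusᵒᵖ ⥤ Type u, Nonempty (X ≅ kappa.op ⋙ X') ∧
    Nonempty (Unique (X'.obj (Opposite.op DeltaPlus.zero)))

/-- The category `(Δᵒᵖ)²`. -/
abbrev BiDelta := SimplexCategoryᵒᵖ × SimplexCategoryᵒᵖ

/-- A bisimplicial set is contractible if it extends along `κ × id` to a functor
`Δ_+ᵒᵖ × Δᵒᵖ ⥤ Sets` whose restriction to `[0]_+ × Δᵒᵖ` is a contractible simplicial set. -/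
def BiContractible (X : BiDelta ⥤ Type u) : Prop :=
  ∃ X' : DeltaPlusᵒᵖ × SimplexCategoryᵒᵖ ⥤ Type u,
    Nonempty (X ≅ (kappa.op.prod (𝟭 SimplexCategoryᵒᵖ)) ⋙ X') ∧
    SContractible (Prod.sectR (Opposite.op DeltaPlus.zero) SimplexCategoryᵒᵖ ⋙ X')

/-! ### Pointed `G`-sets -/

/-- A pointed `G`-set: a set with a `G`-action and a distinguished `G`-fixed element. -/
structure PtGSet (G : Type u) [Group G] where
  /-- the underlying set -/
  carrier : Type u
  /-- the action of `G` -/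
  [action : MulAction G carrier]
  /-- the distinguished element -/
  pt : carrier
  smul_pt : ∀ g : G, g • pt = pt

attribute [instance] PtGSet.action

namespace PtGSet

variable {G : Type u} [Group G]

/-- Equivariant maps that preserve the distinguished elements. -/
@[ext]
structure Hom (S T : PtGSet G) where
  /-- the underlying map -/
  toFun : S.carrier → T.carrier
  map_smul : ∀ (g : G) (s : S.carrier), toFun (g • s) = g • toFun s
  map_pt : toFun S.pt = T.pt

instance : Category (PtGSet G) where
  Hom := Hom
  id S := ⟨id, fun _ _ => rfl, rfl⟩
  comp f g := ⟨g.toFun ∘ f.toFun, fun a s => by simp [f.map_smul, g.map_smul],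
    by simp [f.map_pt, g.map_pt]⟩

@[ext]
lemma hom_ext {S T : PtGSet G} {f g : S ⟶ T} (h : ∀ s, f.toFun s = g.toFun s) : f = g :=
  Hom.ext (funext h)

@[simp] lemma id_toFun (S : PtGSet G) (s : S.carrier) : Hom.toFun (𝟙 S) s = s := rfl

@[simp] lemma comp_toFun {S T U : PtGSet G} (f : S ⟶ T) (g : T ⟶ U) (s : S.carrier) :
    Hom.toFun (f ≫ g) s = g.toFun (f.toFun s) := rfl

/-- A pointed `G`-set is admissible if all stabilizers have finite index and the fixed points
of every subgroup of finite index form a finite set. -/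
def IsAdmissible : ObjectProperty (PtGSet G) := fun S =>
  (∀ s : S.carrier, (MulAction.stabilizer G s).FiniteIndex) ∧
    ∀ H : Subgroup G, H.FiniteIndex → (MulAction.fixedPoints H S.carrier).Finite

/-- Finite pointed `G`-sets. -/
def IsFin : ObjectProperty (PtGSet G) := fun S => Finite S.carrier

/-- The relation on `S × T` that identifies all pairs with a distinguished component. -/
def smashSetoid (S T : PtGSet G) : Setoid (S.carrier × T.carrier) where
  r p q := p = q ∨ ((p.1 = S.pt ∨ p.2 = T.pt) ∧ (q.1 = S.pt ∨ q.2 = T.pt))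
  iseqv :=
    { refl := fun _ => Or.inl rfl
      symm := by
        rintro p q (h | h)
        · exact Or.inl h.symm
        · exact Or.inr h.symm
      trans := by
        rintro p q r (rfl | h) (rfl | h')
        · exact Or.inl rfl
        · exact Or.inr h'
        · exact Or.inr h
        · exact Or.inr ⟨h.1, h'.2⟩ }

/-- The smash product `S ∧ T` with the diagonal action. -/
def smash (S T : PtGSet G) : PtGSet G where
  carrier := Quotient (smashSetoid S T)
  action :=
    { smul := fun g => Quotient.map (fun p => g • p) (by
        rintro p q (rfl | ⟨h, h'⟩)
        · exact Or.inl rfl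
        · refine Or.inr ⟨?_, ?_⟩
          · rcases h with h | h
            · exact Or.inl (by simp [h, S.smul_pt])
            · exact Or.inr (by simp [h, T.smul_pt])
          · rcases h' with h | h
            · exact Or.inl (by simp [h, S.smul_pt])
            · exact Or.inr (by simp [h, T.smul_pt]))
      one_smul := by
        rintro ⟨p⟩
        exact congrArg (Quotient.mk _) (one_smul G p)
      mul_smul := by
        rintro g h ⟨p⟩
        exact congrArg (Quotient.mk _) (mul_smul g h p) }
  pt := Quotient.mk _ (S.pt, T.pt)
  smul_pt g := congrArg (Quotient.mk _) (by ext <;> simp [S.smul_pt, T.smul_pt])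

/-- The class in `S ∧ T` of a pair. -/
def smashMk (S T : PtGSet G) (s : S.carrier) (t : T.carrier) : (smash S T).carrier :=
  Quotient.mk (smashSetoid S T) (s, t)

lemma smul_smashMk (S T : PtGSet G) (g : G) (s : S.carrier) (t : T.carrier) :
    g • smashMk S T s t = smashMk S T (g • s) (g • t) := rfl

lemma smashMk_eq_pt (S T : PtGSet G) (s : S.carrier) (t : T.carrier) (h : s = S.pt ∨ t = T.pt) :
    smashMk S T s t = (smash S T).pt :=
  Quotient.sound (s := smashSetoid S T) (Or.inr ⟨h, Or.inl rfl⟩)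

/-- Functoriality of the smash product. -/
def smashMap {S S' T T' : PtGSet G} (f : S ⟶ S') (g : T ⟶ T') : smash S T ⟶ smash S' T' where
  toFun := Quotient.map (sa := smashSetoid S T) (sb := smashSetoid S' T')
    (fun p => (f.toFun p.1, g.toFun p.2)) (by
      rintro p q (rfl | ⟨h, h'⟩)
      · exact Or.inl rfl
      · refine Or.inr ⟨?_, ?_⟩
        · rcases h with h | h
          · exact Or.inl (by simp [h, f.map_pt])
          · exact Or.inr (by simp [h, g.map_pt])
        · rcases h' with h | h
          · exact Or.inl (by simp [h, f.map_pt])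
          · exact Or.inr (by simp [h, g.map_pt]))
  map_smul := by
    rintro a ⟨p⟩
    exact congrArg (Quotient.mk (smashSetoid S' T'))
      (Prod.ext (f.map_smul a p.1) (g.map_smul a p.2))
  map_pt := congrArg (Quotient.mk (smashSetoid S' T')) (Prod.ext f.map_pt g.map_pt)

lemma IsAdmissible.smash {S T : PtGSet G} (hS : IsAdmissible S) (hT : IsAdmissible T) :
    IsAdmissible (PtGSet.smash S T) := by
  refine ⟨?_, fun H hH => ?_⟩
  · rintro ⟨s, t⟩
    have := hS.1 s
    have := hT.1 t
    refine Subgroup.finiteIndex_of_le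
      (H := MulAction.stabilizer G s ⊓ MulAction.stabilizer G t) ?_
    rintro g ⟨h₁, h₂⟩
    exact congrArg (Quotient.mk (smashSetoid S T)) (Prod.ext h₁ h₂)
  · refine Set.Finite.subset
      ((((hS.2 H hH).prod (hT.2 H hH)).image fun p => smashMk S T p.1 p.2).union
        (Set.finite_singleton (PtGSet.smash S T).pt)) ?_
    rintro ⟨s, t⟩ hp
    by_cases hb : s = S.pt ∨ t = T.pt
    · exact Or.inr (smashMk_eq_pt S T s t hb)
    · refine Or.inl ⟨(s, t), ⟨fun h => ?_, fun h => ?_⟩, rfl⟩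
      · rcases Quotient.exact (hp h) with h' | h'
        · exact congrArg Prod.fst h'
        · exact absurd h'.2 hb
      · rcases Quotient.exact (hp h) with h' | h'
        · exact congrArg Prod.snd h'
        · exact absurd h'.2 hb

/-- The `H`-fixed points of a pointed `G`-set, for a normal subgroup `H`, as a pointed
`G ⧸ H`-set. -/
def fixed (N : Subgroup G) [N.Normal] (S : PtGSet G) : PtGSet (G ⧸ N) where
  carrier := MulAction.fixedPoints N S.carrier
  pt := ⟨S.pt, fun h => S.smul_pt h⟩
  smul_pt w := by
    induction w using QuotientGroup.induction_on with
    | H g => exact Subtype.ext (S.smul_pt g)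

/-- A pointed `G ⧸ N`-set considered as a pointed `G`-set via the quotient map. -/
def inflate (N : Subgroup G) [N.Normal] (S : PtGSet (G ⧸ N)) : PtGSet G where
  carrier := S.carrier
  action := MulAction.compHom S.carrier (QuotientGroup.mk' N)
  pt := S.pt
  smul_pt g := S.smul_pt (QuotientGroup.mk' N g)

/-- The two-element pointed set `[1]_+` with the trivial action; `none` is distinguished. -/
def sphere (G : Type u) [Group G] : PtGSet G where
  carrier := Option PUnit.{u + 1}
  action :=
    { smul := fun _ s => s
      one_smul := fun _ => rfl
      mul_smul := fun _ _ _ => rfl }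
  pt := none
  smul_pt _ := rfl

end PtGSet

/-- The category of admissible pointed `G`-sets. -/
abbrev AdmPt (G : Type u) [Group G] := (PtGSet.IsAdmissible (G := G)).FullSubcategory

/-- The category of finite pointed `W`-sets. -/
abbrev FinPt (W : Type u) [Group W] := (PtGSet.IsFin (G := W)).FullSubcategory

section Functors

variable {G : Type u} [Group G]

/-- The smash product functor on admissible pointed `G`-sets. -/
def smashFunctor (G : Type u) [Group G] : AdmPt G × AdmPt G ⥤ AdmPt G where
  obj p := ⟨PtGSet.smash p.1.obj p.2.obj, p.1.property.smash p.2.property⟩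
  map f := ObjectProperty.homMk (PtGSet.smashMap f.1.hom f.2.hom)
  map_id p := by
    ext ⟨s⟩
    rfl
  map_comp f g := by
    ext ⟨s⟩
    rfl

/-- The set of `H`-fixed points, forgetting the distinguished element. -/
def fixedSet (H : Subgroup G) : AdmPt G ⥤ Type u where
  obj S := MulAction.fixedPoints H S.obj.carrier
  map f := TypeCat.ofHom fun s => ⟨f.hom.toFun s.1, fun h => by
    have := f.hom.map_smul h s.1
    rw [show (h : G) • s.1 = s.1 from s.2 h] at this
    exact this.symm⟩

variable (N : Subgroup G) [N.Normal] [N.FiniteIndex]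

/-- The fixed points functor `φ^N` from admissible pointed `G`-sets to finite pointed
`G ⧸ N`-sets. -/
def phi : AdmPt G ⥤ FinPt (G ⧸ N) where
  obj S := ⟨PtGSet.fixed N S.obj, (S.property.2 N inferInstance).to_subtype⟩
  map {S T} f := ObjectProperty.homMk
    { toFun := fun s => ⟨f.hom.toFun s.1, fun h => by
        have := f.hom.map_smul h s.1
        rw [show (h : G) • s.1 = s.1 from s.2 h] at this
        exact this.symm⟩
      map_smul := fun w s => by
        induction w using QuotientGroup.induction_on with
        | H g => exact Subtype.ext (f.hom.map_smul g s.1)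
      map_pt := Subtype.ext f.hom.map_pt }

/-- The functor `λ^N` from finite pointed `G ⧸ N`-sets to admissible pointed `G`-sets, left
adjoint to `φ^N`: the same set, with `G` acting through the quotient map. -/
def lam : FinPt (G ⧸ N) ⥤ AdmPt G where
  obj S := ⟨PtGSet.inflate N S.obj, by
    refine ⟨fun s => Subgroup.finiteIndex_of_le (H := N) fun n hn => ?_, fun H _ => ?_⟩
    · change (QuotientGroup.mk' N n) • (show S.obj.carrier from s) = s
      rw [show QuotientGroup.mk' N n = 1 from (QuotientGroup.eq_one_iff n).2 hn, one_smul]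
    · have : Finite S.obj.carrier := S.property
      exact Set.toFinite (α := S.obj.carrier) _⟩
  map f := ObjectProperty.homMk
    { toFun := f.hom.toFun
      map_smul := fun g s => f.hom.map_smul (QuotientGroup.mk' N g) s
      map_pt := f.hom.map_pt }

/-- The embedding `S^N ⟶ S` of the fixed points (the counit of the adjunction). -/
def fixedIncl : phi N ⋙ lam N ⟶ 𝟭 (AdmPt G) where
  app S := ObjectProperty.homMk
    { toFun := fun s => s.1
      map_smul := fun _ _ => rfl
      map_pt := rfl }

/-- The finite pointed `G`-set `[1]_+` with two elements. -/
def finSphere (W : Type u) [Group W] : FinPt W :=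
  ⟨PtGSet.sphere W, inferInstanceAs (Finite (Option PUnit.{u + 1}))⟩

/-- A bisimplicial admissible pointed `G`-set `X` is `N`-adapted if `X^N` is isomorphic to the
constant bisimplicial pointed set `[1]_+` with the trivial action, and `X^H` is contractible
for any subgroup `H` of finite index not containing `N`. -/
structure IsAdapted (X : BiDelta ⥤ AdmPt G) : Prop where
  fixed_iso : Nonempty (X ⋙ phi N ≅ (Functor.const BiDelta).obj (finSphere (G ⧸ N)))
  contractible : ∀ H : Subgroup G, H.FiniteIndex → ¬ N ≤ H → BiContractible (X ⋙ fixedSet H)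

/-- The bisimplicial admissible pointed `G`-set `S ∧ X`. -/
abbrev smashWith (S : AdmPt G) (X : BiDelta ⥤ AdmPt G) : BiDelta ⥤ AdmPt G :=
  Functor.prod' ((Functor.const BiDelta).obj S) X ⋙ smashFunctor G

/-- The functor `m_X : (Δᵒᵖ)² × (admissible pointed G-sets) ⥤ (admissible pointed G-sets)`
that sends `([n], S)` to `S ∧ X [n]`. -/
abbrev mulFunctor (X : BiDelta ⥤ AdmPt G) : BiDelta × AdmPt G ⥤ AdmPt G :=
  Functor.prod' (CategoryTheory.Prod.snd BiDelta (AdmPt G)) (CategoryTheory.Prod.fst BiDelta (AdmPt G) ⋙ X) ⋙ smashFunctor G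

/-- The projection `p : (Δᵒᵖ)² × (admissible pointed G-sets) ⥤ (admissible pointed G-sets)`. -/
abbrev projFunctor (G : Type u) [Group G] : BiDelta × AdmPt G ⥤ AdmPt G :=
  CategoryTheory.Prod.snd BiDelta (AdmPt G)

namespace IsAdapted

variable {N} {X : BiDelta ⥤ AdmPt G} (hX : IsAdapted N X)

/-- The embedding `[1]_+ ≅ X^N ⟶ X` (the isomorphism is unique). -/
def incl : (Functor.const BiDelta).obj (finSphere (G ⧸ N)) ⋙ lam N ⟶ X :=
  Functor.whiskerRight hX.fixed_iso.some.inv (lam N) ≫ Functor.whiskerLeft X (fixedIncl N)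

/-- The non-distinguished element of `X^N` in each bisimplicial degree. -/
def elt (m : BiDelta) : (X.obj m).obj.carrier :=
  (hX.incl.app m).hom.toFun (some PUnit.unit)

lemma smul_elt (m : BiDelta) (g : G) : g • hX.elt m = hX.elt m :=
  ((hX.incl.app m).hom.map_smul g (some PUnit.unit)).symm

lemma map_elt {m n : BiDelta} (f : m ⟶ n) : (X.map f).hom.toFun (hX.elt m) = hX.elt n :=
  (congrArg (fun h => h.hom.toFun (some PUnit.unit)) (hX.incl.naturality f)).symm

/-- The natural map `S ≅ S ∧ [1]_+ ⟶ S ∧ X [n]` induced by `[1]_+ ≅ X^N ⟶ X`. -/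
def toSmash : projFunctor G ⟶ mulFunctor X where
  app q := ObjectProperty.homMk
    { toFun := fun s => PtGSet.smashMk q.2.obj (X.obj q.1).obj s (hX.elt q.1)
      map_smul := fun g s =>
        congrArg (PtGSet.smashMk q.2.obj (X.obj q.1).obj (g • s)) (hX.smul_elt q.1 g).symm
      map_pt := PtGSet.smashMk_eq_pt _ _ _ _ (Or.inl rfl) }
  naturality q q' f := by
    ext s
    exact congrArg (PtGSet.smashMk q'.2.obj (X.obj q'.1).obj (f.2.hom.toFun s))
      (hX.map_elt f.1).symm

end IsAdapted

end Functors

/-! ### The averaging functor and the comparison maps -/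

section Averaging

variable {R : Type u} [Ring R] {G : Type u} [Group G] (N : Subgroup G) [N.Normal] [N.FiniteIndex]
  (X : BiDelta ⥤ AdmPt G)

/-- The homology complex `C_•(Y, E) = C_•((Δᵒᵖ)², Y^* E)` of a bisimplicial admissible pointed
`G`-set `Y`, as a functor of `E`; here `T` is the derived colimit over `(Δᵒᵖ)²`, that is, the
derived left Kan extension along the projection to the point category. -/
def homologyComplex (T : DerivedLan R (toPt BiDelta)) (Y : BiDelta ⥤ AdmPt G) :
    DFun R (AdmPt G) ⥤ DFun R Pt :=
  pull R Y ⋙ T.functor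

variable (P : DerivedLan R (projFunctor G))

/-- The averaging functor `Av_X = L p_! ∘ m_X^*`. -/
def averaging : DFun R (AdmPt G) ⥤ DFun R (AdmPt G) :=
  pull R (mulFunctor X) ⋙ P.functor

/-- The functor `Φ^N = λ^{N*} ∘ Av_X`. -/
def bigPhi : DFun R (AdmPt G) ⥤ DFun R (FinPt (G ⧸ N)) :=
  averaging X P ⋙ pull R (lam N)

/-- The tautological map from the value of `E` at `S ∧ X [n]`, natural in `n` and `S`,
to the homotopy colimit over `n`. -/
def toAveraging : pull R (mulFunctor X) ⟶ averaging X P ⋙ pull R (projFunctor G) :=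
  Functor.whiskerLeft (pull R (mulFunctor X)) P.adj.unit

/-- The initial section `S ↦ ([0], [0], S)` of the projection `p`; here `[0]` is the one-element
ordinal. -/
abbrev sect (G : Type u) [Group G] : AdmPt G ⥤ BiDelta × AdmPt G :=
  Prod.sectR (Opposite.op (SimplexCategory.mk 0), Opposite.op (SimplexCategory.mk 0)) (AdmPt G)

/-- The functor `sect` is a section of `p`. -/
def sectProj (G : Type u) [Group G] : sect G ⋙ projFunctor G ≅ 𝟭 (AdmPt G) :=
  NatIso.ofComponents fun _ => Iso.refl _

/-- The restriction of `p` to `(Δᵒᵖ)² × {S}` is constant with value `S`. -/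
def sliceProj (S : AdmPt G) :
    Prod.sectL BiDelta S ⋙ projFunctor G ≅ toPt BiDelta ⋙ atPt S :=
  NatIso.ofComponents fun _ => Iso.refl _

/-- The restriction of `m_X` to `(Δᵒᵖ)² × {S}` is `S ∧ X`. -/
def sliceMul (S : AdmPt G) : smashWith S X ≅ Prod.sectL BiDelta S ⋙ mulFunctor X :=
  NatIso.ofComponents fun _ => Iso.refl _

/-- The object `λ^N(S)` is the image under `λ^N` of the object `S`. -/
def atPtLam (S : FinPt (G ⧸ N)) : atPt ((lam N).obj S) ≅ atPt S ⋙ lam N :=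
  NatIso.ofComponents fun _ => Iso.refl _

variable {N X}

/-- The natural map `Id ⟶ Av_X` induced by `S ⟶ S ∧ X`: the map `p^* ⟶ m_X^* ⟶ p^* Av_X`,
restricted to the section `S ↦ ([0], [0], S)` of `p`. -/
def idToAveraging (hX : IsAdapted N X) : 𝟭 (DFun R (AdmPt G)) ⟶ averaging X P :=
  (pullId R (AdmPt G)).inv ≫ pullMap R (sectProj G).inv ≫
    (pullComp R (sect G) (projFunctor G)).hom ≫
    Functor.whiskerRight (pullMap R hX.toSmash ≫ toAveraging X P) (pull R (sect G)) ≫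
    Functor.whiskerLeft (averaging X P)
      ((pullComp R (sect G) (projFunctor G)).inv ≫ pullMap R (sectProj G).hom ≫
        (pullId R (AdmPt G)).hom)

variable (N X)

/-- The map `φ^{N*} Φ^N ⟶ Av_X` induced by the embeddings `S^N ⟶ S`. -/
def pullPhiToAveraging : bigPhi N X P ⋙ pull R (phi N) ⟶ averaging X P :=
  Functor.whiskerLeft (averaging X P)
    ((pullComp R (phi N) (lam N)).inv ≫ pullMap R (fixedIncl N) ≫ (pullId R (AdmPt G)).hom)

variable {N X}

/-- The map `L φ^N_! ⟶ Φ^N` that corresponds by adjunction to the composition of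
`Id ⟶ Av_X` with the inverse of the isomorphism `φ^{N*} Φ^N ⟶ Av_X`. -/
def comparison (hX : IsAdapted N X) (hc : IsIso (pullPhiToAveraging N X P))
    (F : DerivedLan R (phi N)) : F.functor ⟶ bigPhi N X P :=
  Functor.whiskerRight (idToAveraging P hX ≫ inv (pullPhiToAveraging N X P)) F.functor ≫
    Functor.whiskerLeft (bigPhi N X P) F.adj.counit

variable (X)

/-- The base change map `C_•(S ∧ X, E) ⟶ Av_X(E)(S)`, natural in `E`: it corresponds by
adjunction to the restriction to `(Δᵒᵖ)² × {S}` of the map `m_X^* E ⟶ p^* Av_X(E)`. -/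
def averagingValue (T : DerivedLan R (toPt BiDelta)) (S : AdmPt G) :
    homologyComplex T (smashWith S X) ⟶ averaging X P ⋙ pull R (atPt S) :=
  Functor.whiskerRight
    (pullMap R (sliceMul X S).hom ≫
      (pullComp R (Prod.sectL BiDelta S) (mulFunctor X)).hom ≫
      Functor.whiskerRight (toAveraging X P) (pull R (Prod.sectL BiDelta S)) ≫
      Functor.whiskerLeft (averaging X P)
        ((pullComp R (Prod.sectL BiDelta S) (projFunctor G)).inv ≫
          pullMap R (sliceProj S).hom ≫ (pullComp R (toPt BiDelta) (atPt S)).hom)) T.functor ≫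
    Functor.whiskerLeft (averaging X P ⋙ pull R (atPt S)) T.adj.counit

variable (N)

/-- The map `C_•(λ^N(S) ∧ X, E) ⟶ Φ^N(E)(S)`, natural in `E`, given by base change. -/
def bigPhiValue (T : DerivedLan R (toPt BiDelta)) (S : FinPt (G ⧸ N)) :
    homologyComplex T (smashWith ((lam N).obj S) X) ⟶ bigPhi N X P ⋙ pull R (atPt S) :=
  averagingValue X P T ((lam N).obj S) ≫
    Functor.whiskerLeft (averaging X P)
      (pullMap R (atPtLam N S).hom ≫ (pullComp R (atPt S) (lam N)).hom)

end Averaging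

end

/-! Write `h_T` for the free module functor on `Hom(T, -)`. The proof checks everything on shifts of
the functors `h_T` and then extends to all of the derived category.

Existence of derived Kan extensions: functors to modules have a separating family of projectives, so
the small object argument gives K-projective resolutions of unbounded complexes, and the underived
left Kan extension applied to such a resolution represents the required functor
(`nonempty_derivedLan`).

Extension from generators: every functor in sight is a composition of pullbacks and derived left Kan
extensions. For such a `Φ` and any bounded below `J`, the functor `Hom(Φ(-), J)` is representable,
because a bounded below complex of injectives is K-injective and so right adjoints of exact functors
can be derived on it. A map `Φ ⟶ Ψ` induces a map between the representing objects, shifted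
projective generators detect whether this is invertible, and bounded below objects detect
isomorphisms in the target. Hence a map that is invertible on shifted generators is invertible
(`HasBoundedBelowCoreflections.isIso`). Applied to the projection `I × C ⥤ C`, this gives base
change and part (b).

The geometric input is `isHomologyEquiv_fixedIncl`: over the bisimplicial object `S ∧ X`,
restriction `Hom(T, -) ⟶ Hom(T^N, -)` is a homology equivalence. Split `T` as a wedge of `T^N` and a
part `B` whose non-distinguished points are not fixed by `N`. A smash product collapses points, so
`Hom(B, S ∧ X)` is not visibly a product of fixed point sets. To repair this, attach a contractible
whisker to `X` and move the distinguished point to its far end. In a fixed whisker degree, a map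
from `B` to the smash product is then a map `g` from `B` to `S ∧ whisker` together with a point of
`X^H`, `H` a stabilizer, for each orbit that `g` sends to the end carrying `X`. These `X^H` are
contractible through extensions along `κ`, so any functor of the whole family, infinite or not, may
be evaluated at points instead; what remains is `Hom(B, S ∧ whisker)`, which collapses with the
whisker. Maps from `T^N` see only `N`-fixed points, and these are constant in the bisimplicial
direction because `X^N` is.

Consequently `Av_X(h_T) ≅ Av_X(h_{T^N})`. If `N` acts trivially on `A`, then `Hom(A, S) = Hom(A, S ∧
X(n))`, so `p^* h_A ≅ m_X^* h_A` and `h_A ≅ Av_X(h_A)`; moreover `h_A` is unchanged by restriction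
to fixed points. This proves that `φ^{N*} Φ^N ⟶ Av_X` is invertible. Finally `L φ^N_!` sends `h_T ⟶
h_{T^N}` to an isomorphism, both sides being `h_{φ^N T}`, so it inverts `Id ⟶ Av_X`; since `φ^{N*}`
is fully faithful, the comparison map is invertible. -/

noncomputable section

/-! ### K-projective resolutions -/

section KProjectiveResolutions

open Limits MorphismProperty

universe w v

variable {A : Type u₁} [Category.{v} A] [Abelian A]

namespace CochainComplex

/-- The inclusion of the `n`-sphere on `G` into the `n`-disk on `G`. -/
def sphereToDisk (G : A) (n : ℤ) :
    (HomologicalComplex.single A (ComplexShape.up ℤ) n).obj G ⟶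
      HomologicalComplex.double (𝟙 G) (show (ComplexShape.up ℤ).Rel (n - 1) n by simp) :=
  HomologicalComplex.mkHomFromSingle
    (HomologicalComplex.doubleXIso₁ (𝟙 G) (show (ComplexShape.up ℤ).Rel (n - 1) n by simp)
      (by lia)).inv
    (fun k _ => by rw [HomologicalComplex.double_d_eq_zero₀ _ _ _ _ (by lia), comp_zero])

instance (G : A) (n : ℤ) : Mono (sphereToDisk G n) := by
  have (i : ℤ) : Mono ((sphereToDisk G n).f i) := by
    by_cases h : i = n
    · subst h
      rw [sphereToDisk, HomologicalComplex.mkHomFromSingle_f]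
      infer_instance
    · exact ⟨fun _ _ _ => (HomologicalComplex.isZero_single_obj_X _ _ _ _ h).eq_of_tgt _ _⟩
  exact HomologicalComplex.mono_of_mono_f _ this

lemma sphereToDisk_f (G : A) (n : ℤ) :
    (sphereToDisk G n).f n = (HomologicalComplex.singleObjXSelf (.up ℤ) n G).hom ≫
    (HomologicalComplex.doubleXIso₁ (𝟙 G) (show (ComplexShape.up ℤ).Rel (n - 1) n by simp)
      (by lia)).inv := HomologicalComplex.mkHomFromSingle_f _ _

/-- The lifting property with respect to `sphereToDisk G n` in terms of generalized elements. -/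
lemma hasLiftingProperty_sphereToDisk_iff (G : A) (n : ℤ) {K L : CochainComplex A ℤ}
    (p : K ⟶ L) :
    HasLiftingProperty (sphereToDisk G n) p ↔
      ∀ (x : G ⟶ K.X n) (y : G ⟶ L.X (n - 1)), x ≫ K.d n (n + 1) = 0 →
        x ≫ p.f n = y ≫ L.d (n - 1) n →
        ∃ z : G ⟶ K.X (n - 1), z ≫ K.d (n - 1) n = x ∧ z ≫ p.f (n - 1) = y := by
  have hrel : (ComplexShape.up ℤ).Rel (n - 1) n := by simp
  have hne : n - 1 ≠ n := by lia
  have hd := HomologicalComplex.double_d (𝟙 G) hrel hne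
  have hd' : (HomologicalComplex.doubleXIso₀ (𝟙 G) hrel).inv ≫
      (HomologicalComplex.double (𝟙 G) hrel).d (n - 1) n =
      (HomologicalComplex.doubleXIso₁ (𝟙 G) hrel hne).inv := by
    rw [hd]; simp
  constructor
  · intro h x y hx hxy
    have sq : CommSq (HomologicalComplex.mkHomFromSingle x (fun k hk => by
          obtain rfl : n + 1 = k := hk
          exact hx))
        (sphereToDisk G n) p (HomologicalComplex.mkHomFromDouble hrel hne y
          (y ≫ L.d (n - 1) n) (by simp) (by simp)) := ⟨by
      apply HomologicalComplex.from_single_hom_ext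
      simp [sphereToDisk_f, hxy]⟩
    have h₁ := HomologicalComplex.congr_hom sq.fac_left n
    have h₂ := HomologicalComplex.congr_hom sq.fac_right (n - 1)
    simp only [HomologicalComplex.comp_f, sphereToDisk_f, HomologicalComplex.mkHomFromSingle_f,
      HomologicalComplex.mkHomFromDouble_f₀, Category.assoc, Iso.cancel_iso_hom_left] at h₁ h₂
    refine ⟨(HomologicalComplex.doubleXIso₀ (𝟙 G) hrel).inv ≫ sq.lift.f (n - 1), ?_, ?_⟩
    · rw [Category.assoc, HomologicalComplex.Hom.comm, reassoc_of% hd', h₁]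
    · rw [Category.assoc, h₂, Iso.inv_hom_id_assoc]
  · intro h
    refine ⟨fun {f g} sq => ?_⟩
    have e₁ : (HomologicalComplex.singleObjXSelf (.up ℤ) n G).inv ≫ f.f n ≫ p.f n =
        (HomologicalComplex.doubleXIso₁ (𝟙 G) hrel hne).inv ≫ g.f n := by
      have := HomologicalComplex.congr_hom sq.w n
      simp only [HomologicalComplex.comp_f, sphereToDisk_f, Category.assoc] at this
      rw [this, Iso.inv_hom_id_assoc]
    obtain ⟨z, hz₁, hz₂⟩ := h ((HomologicalComplex.singleObjXSelf (.up ℤ) n G).inv ≫ f.f n)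
      ((HomologicalComplex.doubleXIso₀ (𝟙 G) hrel).inv ≫ g.f (n - 1))
      (by rw [Category.assoc, HomologicalComplex.Hom.comm, HomologicalComplex.single_obj_d]; simp)
      (by rw [Category.assoc, Category.assoc, HomologicalComplex.Hom.comm,
            reassoc_of% hd', e₁])
    refine ⟨⟨HomologicalComplex.mkHomFromDouble hrel hne z (z ≫ K.d (n - 1) n) (by simp)
      (by simp), ?_, ?_⟩⟩
    · apply HomologicalComplex.from_single_hom_ext
      simp [sphereToDisk_f, hz₁]
    · apply HomologicalComplex.from_double_hom_ext
      · simp [hz₂]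
      · simp only [HomologicalComplex.comp_f, HomologicalComplex.mkHomFromDouble_f₁,
          Category.assoc]
        rw [reassoc_of% hz₁]
        simp [e₁]

variable {ι : Type w} (G : ι → A)

/-- The family of inclusions of spheres into disks on objects of the family `G`. -/
abbrev spheresToDisks : MorphismProperty (CochainComplex A ℤ) :=
  MorphismProperty.ofHoms (fun i : ι × ℤ => sphereToDisk (G i.1) i.2)

lemma rlp_spheresToDisks_iff {K L : CochainComplex A ℤ} (p : K ⟶ L) :
    (spheresToDisks G).rlp p ↔ ∀ i n, HasLiftingProperty (sphereToDisk (G i) n) p :=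
  ⟨fun h i n => h _ (MorphismProperty.ofHoms.mk (i := (⟨i, n⟩ : ι × ℤ))), fun h _ _ _ hf => by
    obtain ⟨⟨i, n⟩⟩ := hf
    exact h i n⟩

/-- Relative cell complexes are transfinite compositions of monomorphisms, and in a Grothendieck
abelian category `Hom` out of an object commutes with such colimits once their length exceeds the
size of its subobject lattice. The cardinal is chosen to work for all spheres at once. -/
instance hasSmallObjectArgument_spheresToDisks [IsGrothendieckAbelian.{w} A] :
    HasSmallObjectArgument.{w} (spheresToDisks G) := by
  obtain ⟨κ, hκ', hκ⟩ := HasCardinalLT.exists_regular_cardinal_forall.{w} (fun i : ι × ℤ =>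
    Subobject ((HomologicalComplex.single A (ComplexShape.up ℤ) i.2).obj (G i.1)))
  have : Fact κ.IsRegular := ⟨hκ'⟩
  have : Nonempty κ.ord.ToType := by simpa using hκ'.ne_zero
  have := WellFoundedLT.toOrderBot κ.ord.ToType
  exact ⟨κ, inferInstance, inferInstance,
    { preservesColimit {A' B X Y} i hi f hf := by
        let hf' : (monomorphisms (CochainComplex A ℤ)).TransfiniteCompositionOfShape
            κ.ord.ToType f :=
          { toTransfiniteCompositionOfShape := hf.toTransfiniteCompositionOfShape
            map_mem j hj := by
              have := (hf.attachCells j hj).pushouts_coproducts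
              simp only [ofHoms_homFamily] at this
              refine (?_ : _ ≤ monomorphisms _) _ this
              simp only [pushouts_le_iff, coproducts_le_iff]
              rintro _ _ _ ⟨⟩
              exact monomorphisms.infer_property _ }
        have (j j' : κ.ord.ToType) (φ : j ⟶ j') : Mono (hf'.F.map φ) := hf'.mem_map φ
        obtain ⟨k⟩ := hi
        exact IsGrothendieckAbelian.preservesColimit_coyoneda_obj_of_mono (Y := hf'.F) (κ := κ)
          (hκ k) }⟩

omit [Abelian A] in
lemma epi_of_separating {G : ι → A} (hG : ObjectProperty.IsSeparating (.ofObj G)) {X Y : A}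
    (f : X ⟶ Y) (hf : ∀ i (y : G i ⟶ Y), ∃ x, x ≫ f = y) : Epi f where
  left_cancellation a b h := hG _ _ (by
    rintro _ ⟨i⟩ y
    obtain ⟨x, rfl⟩ := hf i y
    simp [h])

lemma mono_of_separating {G : ι → A} (hG : ObjectProperty.IsSeparating (.ofObj G)) {X Y : A}
    (f : X ⟶ Y) (hf : ∀ i (x : G i ⟶ X), x ≫ f = 0 → x = 0) : Mono f :=
  Preadditive.mono_of_kernel_zero (hG _ _ (by
    rintro _ ⟨i⟩ y
    rw [comp_zero]
    exact hf i _ (by simp)))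

/-- Lifting a disk with zero boundary gives surjectivity on cycles; lifting a disk with prescribed
boundary gives injectivity on homology. Projectivity of the generators turns elements of homology
into cycles and bounding elements. -/
lemma quasiIso_of_rlp_spheresToDisks {G : ι → A} [∀ i, Projective (G i)]
    (hG : ObjectProperty.IsSeparating (.ofObj G)) {K L : CochainComplex A ℤ} (p : K ⟶ L)
    (hp : (spheresToDisks G).rlp p) : QuasiIso p := by
  rw [rlp_spheresToDisks_iff] at hp
  have hp' := fun i n => (hasLiftingProperty_sphereToDisk_iff (G i) n p).1 (hp i n)
  refine ⟨fun n => ?_⟩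
  rw [quasiIsoAt_iff_isIso_homologyMap]
  have hepi : Epi (HomologicalComplex.cyclesMap p n) := epi_of_separating hG _ (fun i y => by
    -- The disk whose boundary sphere lies in degree `m` has its new element in degree `m - 1`.
    obtain ⟨m, rfl⟩ : ∃ m, n = m - 1 := ⟨n + 1, by lia⟩
    obtain ⟨z, hz₁, hz₂⟩ := hp' i m 0 (y ≫ L.iCycles (m - 1)) (by simp) (by simp)
    refine ⟨K.liftCycles z m (by simp) hz₁, ?_⟩
    rw [← cancel_mono (L.iCycles (m - 1))]
    simp [hz₂])
  have : Epi (HomologicalComplex.homologyMap p n) := by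
    have := HomologicalComplex.homologyπ_naturality p n
    have h2 : Epi (K.homologyπ n ≫ HomologicalComplex.homologyMap p n) := by
      rw [this]; infer_instance
    exact epi_of_epi (K.homologyπ n) _
  have : Mono (HomologicalComplex.homologyMap p n) := mono_of_separating hG _ (fun i x hx => by
    obtain ⟨c, rfl⟩ : ∃ c, c ≫ K.homologyπ n = x :=
      ⟨Projective.factorThru x (K.homologyπ n), by simp⟩
    have hex : (ShortComplex.mk (L.toCycles (n - 1) n) (L.homologyπ n) (by simp)).Exact :=
      ShortComplex.exact_of_g_is_cokernel _ (L.homologyIsCokernel (n - 1) n (by simp))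
    rw [Category.assoc, HomologicalComplex.homologyπ_naturality] at hx
    let y : G i ⟶ L.X (n - 1) := hex.liftFromProjective (c ≫ HomologicalComplex.cyclesMap p n)
      (by simpa using hx)
    have hy : y ≫ L.toCycles (n - 1) n = c ≫ HomologicalComplex.cyclesMap p n :=
      hex.liftFromProjective_comp _ _
    obtain ⟨z, hz₁, -⟩ := hp' i n (c ≫ K.iCycles n) y (by simp) (by
      have := hy =≫ L.iCycles n
      simp only [Category.assoc, HomologicalComplex.toCycles_i,
        HomologicalComplex.cyclesMap_i] at this
      simp [this])
    have : c = z ≫ K.toCycles (n - 1) n := by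
      rw [← cancel_mono (K.iCycles n)]
      simp [hz₁]
    simp [this])
  exact isIso_of_mono_of_epi _

lemma exists_lift_of_acyclic {K : CochainComplex A ℤ} (hK : K.Acyclic) {P : A} [Projective P]
    (m n k : ℤ) (hmn : m + 1 = n) (hnk : n + 1 = k) (x : P ⟶ K.X n) (hx : x ≫ K.d n k = 0) :
    ∃ z : P ⟶ K.X m, z ≫ K.d m n = x := by
  have hex : (K.sc' m n k).Exact := by
    have := hK n
    rwa [HomologicalComplex.exactAt_iff' _ m n k (by simp; lia) (by simp [hnk])] at this
  exact ⟨hex.liftFromProjective x hx, hex.liftFromProjective_comp x hx⟩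

/-- Lift `y` through the epimorphism, correct its boundary using acyclicity of `K`, then correct its
image by a boundary using acyclicity of `L`; the last correction is itself lifted to `K`, so it does
not disturb the first one. -/
lemma hasLiftingProperty_sphereToDisk_of_acyclic (P : A) [Projective P] (n : ℤ)
    {K L : CochainComplex A ℤ} (p : K ⟶ L) [∀ n, Epi (p.f n)] (hK : K.Acyclic)
    (hL : L.Acyclic) : HasLiftingProperty (sphereToDisk P n) p := by
  rw [hasLiftingProperty_sphereToDisk_iff]
  intro x y hx hxy
  let y' := Projective.factorThru y (p.f (n - 1))
  have hy' : y' ≫ p.f (n - 1) = y := Projective.factorThru_comp _ _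
  obtain ⟨z, hz⟩ := exists_lift_of_acyclic hK (n - 1) n (n + 1) (by lia) rfl (x - y' ≫ K.d (n - 1) n)
    (by simp [hx])
  obtain ⟨w, hw⟩ := exists_lift_of_acyclic hL (n - 1 - 1) (n - 1) n (by lia) (by lia)
    (z ≫ p.f (n - 1)) (by
      have : z ≫ p.f (n - 1) ≫ L.d (n - 1) n = 0 := by
        rw [p.comm, reassoc_of% hz, Preadditive.sub_comp, Category.assoc, ← p.comm, hxy,
          reassoc_of% hy', sub_self]
      simpa using this)
  let w' := Projective.factorThru w (p.f (n - 1 - 1))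
  have hw' : w' ≫ p.f (n - 1 - 1) = w := Projective.factorThru_comp _ _
  refine ⟨y' + z - w' ≫ K.d (n - 1 - 1) (n - 1), by simp [hz], ?_⟩
  rw [Preadditive.sub_comp, Preadditive.add_comp, Category.assoc, ← p.comm, reassoc_of% hw', hw,
    hy']
  simp

/-- A map from `K` to an acyclic `L` lifts through the degreewise split epimorphism from the cocone
of the identity of `L`. That cocone is contractible, so the map is null-homotopic. -/
lemma isKProjective_of_llp_rlp {G : ι → A} [∀ i, Projective (G i)] {K : CochainComplex A ℤ}
    {O : CochainComplex A ℤ} (hO : IsZero O)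
    (f : O ⟶ K) (hf : (spheresToDisks G).rlp.llp f) : K.IsKProjective where
  nonempty_homotopy_zero {L} g hL := by
    have hzero : IsZero ((HomotopyCategory.quotient A (.up ℤ)).obj (mappingCocone (𝟙 L))) :=
      (((HomotopyCategory.quotient A (.up ℤ)).commShiftIso (-1 : ℤ)).app
        (mappingCone (𝟙 L))).isZero_iff.2 (Functor.map_isZero
          (CategoryTheory.shiftFunctor (HomotopyCategory A (.up ℤ)) (-1 : ℤ))
          ((HomotopyCategory.isZero_quotient_obj_iff _).2 ⟨mappingCone.homotopyToZeroOfId L⟩))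
    have hacyclic : (mappingCocone (𝟙 L)).Acyclic := by
      rw [← HomotopyCategory.quotient_obj_mem_subcategoryAcyclic_iff_acyclic]
      exact (HomotopyCategory.subcategoryAcyclic A).prop_of_isZero hzero
    have (n : ℤ) : Epi ((mappingCocone.fst (𝟙 L)).f n) :=
      (SplitEpi.mk _ (mappingCocone.inl_v_fst_f (𝟙 L) n)).epi
    have : HasLiftingProperty f (mappingCocone.fst (𝟙 L)) := hf _ (by
      rw [rlp_spheresToDisks_iff]
      exact fun i n => hasLiftingProperty_sphereToDisk_of_acyclic _ _ _ hacyclic hL)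
    have sq : CommSq (0 : O ⟶ _) f (mappingCocone.fst (𝟙 L)) g := ⟨hO.eq_of_src _ _⟩
    refine ⟨HomotopyCategory.homotopyOfEq _ _ ?_⟩
    rw [← sq.fac_right, Functor.map_comp, hzero.eq_of_tgt ((HomotopyCategory.quotient _ _).map _) 0,
      zero_comp, Functor.map_zero]

/-- In a Grothendieck abelian category with a separating family of projective objects, any
cochain complex has a K-projective resolution. -/
theorem exists_isKProjective_quasiIso [IsGrothendieckAbelian.{w} A] {G : ι → A}
    [∀ i, Projective (G i)] (hG : ObjectProperty.IsSeparating (.ofObj G))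
    (L : CochainComplex A ℤ) :
    ∃ (K : CochainComplex A ℤ) (p : K ⟶ L), K.IsKProjective ∧ QuasiIso p := by
  let d := MorphismProperty.factorizationData (spheresToDisks G).rlp.llp (spheresToDisks G).rlp
    (0 : (HomologicalComplex.zero : CochainComplex A ℤ) ⟶ L)
  exact ⟨d.Z, d.p, isKProjective_of_llp_rlp HomologicalComplex.isZero_zero d.i d.hi,
    quasiIso_of_rlp_spheresToDisks hG d.p d.hp⟩

end CochainComplex

end KProjectiveResolutions

/-! ### Adjunctions and functors induced by exact functors on derived categories -/

section MapComplexAdjunction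

variable {A : Type u₁} [Category.{v₁} A] [Preadditive A] {B : Type u₂} [Category.{v₂} B]
  [Preadditive B] {L : A ⥤ B} {F : B ⥤ A} [L.Additive] [F.Additive]

/-- The adjunction on categories of complexes induced by an adjunction of additive functors. -/
def CategoryTheory.Adjunction.mapComplex (adj : L ⊣ F) :
    L.mapHomologicalComplex (ComplexShape.up ℤ) ⊣ F.mapHomologicalComplex (ComplexShape.up ℤ) :=
  Adjunction.mkOfUnitCounit
    { unit :=
        { app := fun K =>
            { f := fun i => adj.unit.app (K.X i)
              comm' := fun i j _ => (adj.unit.naturality (K.d i j)).symm }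
          naturality := fun _ _ f => by
            ext i
            exact adj.unit.naturality (f.f i) }
      counit :=
        { app := fun K =>
            { f := fun i => adj.counit.app (K.X i)
              comm' := fun i j _ => (adj.counit.naturality (K.d i j)).symm }
          naturality := fun _ _ f => by
            ext i
            exact adj.counit.naturality (f.f i) }
      left_triangle := by
        ext K i
        simp only [NatTrans.comp_app, HomologicalComplex.comp_f]
        exact (congrArg _ (Category.id_comp _)).trans (adj.left_triangle_components (K.X i))
      right_triangle := by
        ext K i
        simp only [NatTrans.comp_app, HomologicalComplex.comp_f]
        exact (congrArg _ (Category.id_comp _)).trans (adj.right_triangle_components (K.X i)) }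

lemma CategoryTheory.Adjunction.mapComplex_homotopy_zero_iff (adj : L ⊣ F)
    {K : CochainComplex A ℤ} {M : CochainComplex B ℤ}
    (f : (L.mapHomologicalComplex _).obj K ⟶ M) :
    Nonempty (Homotopy f 0) ↔ Nonempty (Homotopy (adj.mapComplex.homEquiv _ _ f) 0) := by
  constructor
  · rintro ⟨h⟩
    rw [Adjunction.homEquiv_unit]
    exact ⟨((F.mapHomotopy h).compLeft (adj.mapComplex.unit.app K)).trans
      (.ofEq (by simp))⟩
  · rintro ⟨h⟩
    obtain ⟨g, rfl⟩ := (adj.mapComplex.homEquiv _ _).symm.surjective f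
    rw [Equiv.apply_symm_apply] at h
    rw [Adjunction.homEquiv_counit]
    exact ⟨((L.mapHomotopy h).compRight (adj.mapComplex.counit.app M)).trans
      (.ofEq (by simp))⟩

end MapComplexAdjunction

/-- The pair of `Y` and `v : Φ.obj Y ⟶ J` is terminal among all such pairs. -/
def IsCoreflection {𝒟 : Type u₁} [Category.{v₁} 𝒟] {ℰ : Type u₂} [Category.{v₂} ℰ] (Φ : 𝒟 ⥤ ℰ)
    {J : ℰ} {Y : 𝒟} (v : Φ.obj Y ⟶ J) : Prop :=
  ∀ X : 𝒟, Function.Bijective (fun g : X ⟶ Y => Φ.map g ≫ v)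

/-! ### Derived morphisms from K-projective and to K-injective complexes -/

section DerivedHom

variable {A : Type u₁} [Category.{v₁} A] [Abelian A] [HasDerivedCategory.{v₃} A]

open DerivedCategory

lemma Q_map_surjective_of_isKProjective {K L : CochainComplex A ℤ} [K.IsKProjective]
    (f : Q.obj K ⟶ Q.obj L) : ∃ g : K ⟶ L, Q.map g = f := by
  obtain ⟨g, hg⟩ := (CochainComplex.IsKProjective.Qh_map_bijective K
    ((HomotopyCategory.quotient A (.up ℤ)).obj L)).surjective
      ((quotientCompQhIso A).hom.app K ≫ f ≫ (quotientCompQhIso A).inv.app L)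
  obtain ⟨g, rfl⟩ := (HomotopyCategory.quotient A (.up ℤ)).map_surjective g
  refine ⟨g, ?_⟩
  rw [← cancel_epi ((quotientCompQhIso A).hom.app K), ← quotientCompQhIso_hom_naturality, hg]
  simp

lemma Q_map_surjective_of_isKInjective {K L : CochainComplex A ℤ} [L.IsKInjective]
    (f : Q.obj K ⟶ Q.obj L) : ∃ g : K ⟶ L, Q.map g = f := by
  obtain ⟨g, hg⟩ := (CochainComplex.IsKInjective.Qh_map_bijective
    ((HomotopyCategory.quotient A (.up ℤ)).obj K) L).surjective
      ((quotientCompQhIso A).hom.app K ≫ f ≫ (quotientCompQhIso A).inv.app L)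
  obtain ⟨g, rfl⟩ := (HomotopyCategory.quotient A (.up ℤ)).map_surjective g
  refine ⟨g, ?_⟩
  rw [← cancel_epi ((quotientCompQhIso A).hom.app K), ← quotientCompQhIso_hom_naturality, hg]
  simp

lemma Q_map_eq_zero_iff_Qh {K L : CochainComplex A ℤ} (g : K ⟶ L) :
    Q.map g = 0 ↔ Qh.map ((HomotopyCategory.quotient A (.up ℤ)).map g) = 0 := by
  have := quotientCompQhIso_hom_naturality g
  constructor
  · intro h
    rw [h, Limits.comp_zero] at this
    rw [← cancel_mono ((quotientCompQhIso A).hom.app L), this, Limits.zero_comp]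
  · intro h
    rw [h, Limits.zero_comp] at this
    rw [← cancel_epi ((quotientCompQhIso A).hom.app K), ← this, Limits.comp_zero]

lemma Q_map_eq_zero_of_homotopy {K L : CochainComplex A ℤ} {g : K ⟶ L} (h : Nonempty (Homotopy g 0)) :
    Q.map g = 0 := by
  rw [Q_map_eq_of_homotopy _ h.some, Functor.map_zero]

lemma homotopy_of_Q_map_eq_zero_of_isKProjective {K L : CochainComplex A ℤ} [K.IsKProjective]
    (g : K ⟶ L) (hg : Q.map g = 0) : Nonempty (Homotopy g 0) := by
  rw [Q_map_eq_zero_iff_Qh] at hg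
  refine ⟨HomotopyCategory.homotopyOfEq _ _ ?_⟩
  rw [Functor.map_zero]
  apply (CochainComplex.IsKProjective.Qh_map_bijective K
    ((HomotopyCategory.quotient A (.up ℤ)).obj L)).injective
  rw [hg, Functor.map_zero]

lemma homotopy_of_Q_map_eq_zero_of_isKInjective {K L : CochainComplex A ℤ} [L.IsKInjective]
    (g : K ⟶ L) (hg : Q.map g = 0) : Nonempty (Homotopy g 0) := by
  rw [Q_map_eq_zero_iff_Qh] at hg
  refine ⟨HomotopyCategory.homotopyOfEq _ _ ?_⟩
  rw [Functor.map_zero]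
  apply (CochainComplex.IsKInjective.Qh_map_bijective
    ((HomotopyCategory.quotient A (.up ℤ)).obj K) L).injective
  rw [hg, Functor.map_zero]

end DerivedHom

/-! ### Exact functors and their derived adjoints -/

section ExactFunctor

variable {A : Type u₁} [Category.{v₁} A] [Abelian A] {B : Type u₂} [Category.{v₂} B] [Abelian B]
  (F : B ⥤ A) [F.Additive] [Limits.PreservesFiniteLimits F] [Limits.PreservesFiniteColimits F]

lemma acyclic_mapHomologicalComplex {M : CochainComplex B ℤ} (hM : M.Acyclic) :
    ((F.mapHomologicalComplex (.up ℤ)).obj M).Acyclic := fun n => (hM n).map F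

variable {F}

/-- By adjunction, maps to an acyclic `M` become maps from `K` to the image of `M` under the exact
right adjoint, which is again acyclic. -/
lemma isKProjective_leftAdjoint {L : A ⥤ B} [L.Additive] (adj : L ⊣ F) (K : CochainComplex A ℤ)
    [K.IsKProjective] : CochainComplex.IsKProjective
      ((L.mapHomologicalComplex (.up ℤ)).obj K) where
  nonempty_homotopy_zero f hM := by
    rw [adj.mapComplex_homotopy_zero_iff]
    exact CochainComplex.IsKProjective.nonempty_homotopy_zero _ (acyclic_mapHomologicalComplex F hM)

lemma isKInjective_rightAdjoint {L : A ⥤ B} [L.Additive] (adj : F ⊣ L) (K : CochainComplex A ℤ)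
    [K.IsKInjective] : CochainComplex.IsKInjective
      ((L.mapHomologicalComplex (.up ℤ)).obj K) where
  nonempty_homotopy_zero {M} f hM := by
    obtain ⟨g, rfl⟩ := (adj.mapComplex.homEquiv M K).surjective f
    rw [← adj.mapComplex_homotopy_zero_iff]
    exact CochainComplex.IsKInjective.nonempty_homotopy_zero _ (acyclic_mapHomologicalComplex F hM)

end ExactFunctor

section ExactFunctor

variable {A : Type u₁} [Category.{v₁} A] [Abelian A] [HasDerivedCategory.{v₃} A]
  {B : Type u₂} [Category.{v₂} B] [Abelian B] [HasDerivedCategory.{u₃} B]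
  (F : B ⥤ A) [F.Additive] [Limits.PreservesFiniteLimits F] [Limits.PreservesFiniteColimits F]

open DerivedCategory

variable {F}

/-- A pair of K-projective complexes that correspond to each other under an adjunction on the level
of complexes corresponds to each other on the level of derived categories. -/
lemma bijective_derived_of_isKProjective {K : CochainComplex A ℤ} {M : CochainComplex B ℤ}
    [K.IsKProjective] [M.IsKProjective] (u : K ⟶ (F.mapHomologicalComplex (.up ℤ)).obj M)
    (hu : ∀ (Z : CochainComplex B ℤ) (f : K ⟶ (F.mapHomologicalComplex (.up ℤ)).obj Z),
      ∃ g : M ⟶ Z, u ≫ (F.mapHomologicalComplex (.up ℤ)).map g = f)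
    (hu' : ∀ (Z : CochainComplex B ℤ) (g : M ⟶ Z),
      Nonempty (Homotopy (u ≫ (F.mapHomologicalComplex (.up ℤ)).map g) 0) →
        Nonempty (Homotopy g 0)) (Z : DerivedCategory B) :
    Function.Bijective (fun g : Q.obj M ⟶ Z =>
      (Q.map u ≫ F.mapDerivedCategoryFactors.inv.app M) ≫ F.mapDerivedCategory.map g) := by
  have key (Z : CochainComplex B ℤ) (g : M ⟶ Z) :
      (Q.map u ≫ F.mapDerivedCategoryFactors.inv.app M) ≫ F.mapDerivedCategory.map (Q.map g) =
      Q.map (u ≫ (F.mapHomologicalComplex (.up ℤ)).map g) ≫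
        F.mapDerivedCategoryFactors.inv.app Z := by
    have := F.mapDerivedCategoryFactors.inv.naturality g
    simp only [Functor.comp_map] at this
    rw [Category.assoc, ← this, Functor.map_comp, Category.assoc]
  obtain ⟨Z', ⟨e⟩⟩ : ∃ Z', Nonempty (Q.obj Z' ≅ Z) := ⟨_, ⟨Q.objObjPreimageIso Z⟩⟩
  suffices Function.Bijective (fun g : Q.obj M ⟶ Q.obj Z' =>
      (Q.map u ≫ F.mapDerivedCategoryFactors.inv.app M) ≫ F.mapDerivedCategory.map g) by
    have h₁ : Function.Bijective (fun g : Q.obj M ⟶ Z => g ≫ e.inv) :=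
      e.symm.homToEquiv.bijective
    have h₂ : Function.Bijective (fun g : Q.obj K ⟶ F.mapDerivedCategory.obj (Q.obj Z') =>
      g ≫ F.mapDerivedCategory.map e.hom) := (F.mapDerivedCategory.mapIso e).homToEquiv.bijective
    convert h₂.comp (this.comp h₁) using 1
    ext g
    simp [← Functor.map_comp]
  constructor
  · intro g₁ g₂ h
    rw [← sub_eq_zero]
    obtain ⟨g, hg⟩ := Q_map_surjective_of_isKProjective (g₁ - g₂)
    have h' : (Q.map u ≫ F.mapDerivedCategoryFactors.inv.app M) ≫
        F.mapDerivedCategory.map (Q.map g) = 0 := by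
      rw [hg, Functor.map_sub, Preadditive.comp_sub, sub_eq_zero]
      exact h
    rw [key] at h'
    rw [← hg]
    apply Q_map_eq_zero_of_homotopy
    apply hu'
    apply homotopy_of_Q_map_eq_zero_of_isKProjective
    rw [← cancel_mono (F.mapDerivedCategoryFactors.inv.app Z'), h', Limits.zero_comp]
  · intro f
    obtain ⟨f', hf'⟩ := Q_map_surjective_of_isKProjective
      (f ≫ F.mapDerivedCategoryFactors.hom.app Z')
    obtain ⟨g, rfl⟩ := hu _ f'
    refine ⟨Q.map g, ?_⟩
    dsimp only
    rw [key, hf', Category.assoc, Iso.hom_inv_id_app]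
    exact Category.comp_id f

variable (F)

/-- For a K-projective resolution `K` of `X`, the left adjoint applied termwise to `K` gives an
initial object of the comma category under `X`; this is the total left derived functor, obtained
object by object. -/
lemma isRightAdjoint_mapDerivedCategory [F.IsRightAdjoint]
    (hA : ∀ L : CochainComplex A ℤ,
      ∃ (K : CochainComplex A ℤ) (p : K ⟶ L), K.IsKProjective ∧ QuasiIso p) :
    F.mapDerivedCategory.IsRightAdjoint := by
  let adj := Adjunction.ofIsRightAdjoint F
  have := adj.left_adjoint_additive
  have (X : DerivedCategory A) : Limits.HasInitial (StructuredArrow X F.mapDerivedCategory) := by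
    obtain ⟨K, p, hK, hp⟩ := hA (Q.objPreimage X)
    have := isKProjective_leftAdjoint adj K
    let e : X ≅ Q.obj K := (Q.objObjPreimageIso X).symm ≪≫ (asIso (Q.map p)).symm
    let u : K ⟶ (F.mapHomologicalComplex (.up ℤ)).obj
        ((F.leftAdjoint.mapHomologicalComplex (.up ℤ)).obj K) := adj.mapComplex.unit.app K
    have hb := bijective_derived_of_isKProjective u (fun Z f =>
        ⟨(adj.mapComplex.homEquiv _ _).symm f, by
          have := (adj.mapComplex.homEquiv _ _).apply_symm_apply f
          rwa [Adjunction.homEquiv_unit] at this⟩)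
      (fun Z g h => by
        rw [adj.mapComplex_homotopy_zero_iff, Adjunction.homEquiv_unit]
        exact h)
    let T : StructuredArrow X F.mapDerivedCategory := StructuredArrow.mk
      (e.hom ≫ Q.map u ≫ F.mapDerivedCategoryFactors.inv.app _)
    have (Y : StructuredArrow X F.mapDerivedCategory) : Nonempty (T ⟶ Y) := by
      obtain ⟨g, hg⟩ := (hb Y.right).surjective (e.inv ≫ Y.hom)
      exact ⟨StructuredArrow.homMk g (by
        dsimp at hg
        rw [Category.assoc] at hg
        dsimp [T]
        rw [Category.assoc, Category.assoc, hg, Iso.hom_inv_id_assoc])⟩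
    have (Y : StructuredArrow X F.mapDerivedCategory) : Subsingleton (T ⟶ Y) := ⟨by
      intro f g
      ext
      apply (hb Y.right).injective
      have hf := StructuredArrow.w f
      rw [← StructuredArrow.w g] at hf
      dsimp [T] at hf ⊢
      simpa only [Category.assoc, Iso.cancel_iso_hom_left] using hf⟩
    exact (Limits.IsInitial.ofUniqueHom (X := T) (fun _ => Classical.arbitrary _)
      (fun _ _ => Subsingleton.elim _ _)).hasInitial
  exact isRightAdjointOfStructuredArrowInitials _

/-- The bounded below objects of the derived category. -/
def IsBoundedBelow : ObjectProperty (DerivedCategory A) := fun X => ∃ n, X.IsGE n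

lemma IsBoundedBelow.mapDerivedCategory {X : DerivedCategory B} (hX : IsBoundedBelow X) :
    IsBoundedBelow (F.mapDerivedCategory.obj X) := by
  obtain ⟨n, hX⟩ := hX
  obtain ⟨K, hK, ⟨e⟩⟩ := exists_iso_Q_obj_of_isGE X n
  refine ⟨n, ⟨(F.mapHomologicalComplex _).obj K,
    F.mapDerivedCategory.mapIso e ≪≫ F.mapDerivedCategoryFactors.app K, ?_⟩⟩
  rw [CochainComplex.isStrictlyGE_iff]
  intro i hi
  exact F.map_isZero (K.isZero_of_isStrictlyGE n i hi)

/-- The right derived functor of a right adjoint of an exact functor represents morphisms to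
bounded below objects. -/
lemma exists_isCoreflection_mapDerivedCategory [EnoughInjectives A]
    [F.IsLeftAdjoint] {J : DerivedCategory A} (hJ : IsBoundedBelow J) :
    ∃ (Y : DerivedCategory B) (v : F.mapDerivedCategory.obj Y ⟶ J), IsBoundedBelow Y ∧
      IsCoreflection F.mapDerivedCategory v := by
  let adj := Adjunction.ofIsLeftAdjoint F
  have := adj.right_adjoint_additive
  obtain ⟨n, hJ⟩ := hJ
  obtain ⟨K, hK, ⟨e⟩⟩ := exists_iso_Q_obj_of_isGE J n
  -- A bounded below complex of injectives is K-injective, so only ordinary injective resolutions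
  -- are used here.
  obtain ⟨I, i, _, _, hI⟩ := CochainComplex.Plus.modelCategoryQuillen.exists_quasiIso_injective K n
  have : I.IsKInjective := CochainComplex.isKInjective_of_injective I n
  have := isKInjective_rightAdjoint adj I
  let M : CochainComplex B ℤ := (F.rightAdjoint.mapHomologicalComplex (.up ℤ)).obj I
  have hM : M.IsStrictlyGE n := by
    rw [CochainComplex.isStrictlyGE_iff]
    intro i hi
    exact F.rightAdjoint.map_isZero (I.isZero_of_isStrictlyGE n i hi)
  let e' : Q.obj I ≅ J := (asIso (Q.map i)).symm ≪≫ e.symm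
  let v : F.mapDerivedCategory.obj (Q.obj M) ⟶ Q.obj I :=
    F.mapDerivedCategoryFactors.hom.app M ≫ Q.map (adj.mapComplex.counit.app I)
  have key (Z : CochainComplex B ℤ) (g : Z ⟶ M) :
      F.mapDerivedCategory.map (Q.map g) ≫ v = F.mapDerivedCategoryFactors.hom.app Z ≫
        Q.map ((adj.mapComplex.homEquiv _ _).symm g) := by
    have := F.mapDerivedCategoryFactors.hom.naturality g
    simp only [Functor.comp_map] at this
    rw [reassoc_of% this, Adjunction.homEquiv_counit, Functor.map_comp]
  have hb' (Z : CochainComplex B ℤ) : Function.Bijective (fun g : Q.obj Z ⟶ Q.obj M =>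
      F.mapDerivedCategory.map g ≫ v) := by
    constructor
    · intro g₁ g₂ h
      rw [← sub_eq_zero]
      obtain ⟨g, hg⟩ := Q_map_surjective_of_isKInjective (g₁ - g₂)
      have h' : F.mapDerivedCategory.map (Q.map g) ≫ v = 0 := by
        rw [hg, Functor.map_sub, Preadditive.sub_comp, sub_eq_zero]
        exact h
      rw [key] at h'
      rw [← hg]
      apply Q_map_eq_zero_of_homotopy
      have h₂ : Nonempty (Homotopy ((adj.mapComplex.homEquiv _ _).symm g) 0) :=
        homotopy_of_Q_map_eq_zero_of_isKInjective _ (by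
          rw [← cancel_epi (F.mapDerivedCategoryFactors.hom.app Z), h', Limits.comp_zero])
      rwa [adj.mapComplex_homotopy_zero_iff, Equiv.apply_symm_apply] at h₂
    · intro f
      obtain ⟨f', hf'⟩ := Q_map_surjective_of_isKInjective
        (F.mapDerivedCategoryFactors.inv.app Z ≫ f)
      refine ⟨Q.map (adj.mapComplex.homEquiv _ _ f'), ?_⟩
      dsimp only
      rw [key, Equiv.symm_apply_apply, hf', Iso.hom_inv_id_app_assoc]
  have hb (Z : DerivedCategory B) : Function.Bijective (fun g : Z ⟶ Q.obj M =>
      F.mapDerivedCategory.map g ≫ v ≫ e'.hom) := by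
    let e₁ := Q.objObjPreimageIso Z
    have h₁ : Function.Bijective (fun g : Z ⟶ Q.obj M => e₁.hom ≫ g) :=
      e₁.symm.homFromEquiv.bijective
    have h₂ : Function.Bijective
        (fun g : F.mapDerivedCategory.obj (Q.obj (Q.objPreimage Z)) ⟶ Q.obj I =>
      F.mapDerivedCategory.map e₁.inv ≫ g) :=
        (F.mapDerivedCategory.mapIso e₁).homFromEquiv.bijective
    have h₃ : Function.Bijective (fun g : F.mapDerivedCategory.obj Z ⟶ Q.obj I =>
      g ≫ e'.hom) := e'.homToEquiv.bijective
    convert h₃.comp (h₂.comp ((hb' _).comp h₁)) using 1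
    ext g
    dsimp only [Function.comp]
    rw [← Category.assoc (F.mapDerivedCategory.map e₁.inv), ← Functor.map_comp,
      Iso.inv_hom_id_assoc, ← Category.assoc]
  exact ⟨Q.obj M, v ≫ e'.hom, ⟨n, inferInstance⟩, hb⟩

end ExactFunctor

/-! ### Detection of isomorphisms in derived categories -/

section Triangulated

open Limits Pretriangulated

variable {𝒯 : Type u₁} [Category.{v₁} 𝒯] [HasZeroObject 𝒯] [HasShift 𝒯 ℤ] [Preadditive 𝒯]
  [∀ n : ℤ, (shiftFunctor 𝒯 n).Additive] [Pretriangulated 𝒯]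

/-- A morphism is an isomorphism if it induces bijections on morphisms from objects in a class that
is closed under desuspension and detects zero objects. -/
lemma isIso_of_bijective_comp (S : ObjectProperty 𝒯)
    (hS : ∀ P, S P → ∃ P', S P' ∧ Nonempty (P ≅ P'⟦(1 : ℤ)⟧))
    (hzero : ∀ W, (∀ P, S P → ∀ f : P ⟶ W, f = 0) → IsZero W)
    {X Y : 𝒯} (f : X ⟶ Y) (hf : ∀ P, S P → Function.Bijective (fun g : P ⟶ X => g ≫ f)) :
    IsIso f := by
  obtain ⟨W, p, q, hT⟩ := distinguished_cocone_triangle f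
  have h₁₂ : f ≫ p = 0 := comp_distTriang_mor_zero₁₂ _ hT
  have h₃₁ : q ≫ f⟦(1 : ℤ)⟧' = 0 := comp_distTriang_mor_zero₃₁ _ hT
  suffices IsZero W from (Triangle.isZero₃_iff_isIso₁ _ hT).1 this
  refine hzero _ fun P hP g => ?_
  -- The boundary of a map from `P` to the cone desuspends to a map `P' ⟶ X` killed by `f`, hence
  -- zero. So the map comes from `Y`, therefore from `X`, and vanishes in the cone.
  obtain ⟨P', hP', ⟨e⟩⟩ := hS P hP
  obtain ⟨k, hk⟩ := (shiftFunctor 𝒯 (1 : ℤ)).map_surjective (e.inv ≫ g ≫ q)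
  have hk' : k ≫ f = 0 := (shiftFunctor 𝒯 (1 : ℤ)).map_injective (by
    rw [Functor.map_comp, hk, Functor.map_zero, Category.assoc, Category.assoc, h₃₁, comp_zero,
      comp_zero])
  obtain rfl : k = 0 := (hf P' hP').injective (by simpa using hk')
  have hgq : g ≫ q = 0 := by
    rw [← cancel_epi e.inv, ← hk]
    simp
  obtain ⟨l, rfl⟩ : ∃ l : P ⟶ Y, g = l ≫ p := Triangle.coyoneda_exact₃ _ hT g hgq
  obtain ⟨m, rfl⟩ : ∃ m : P ⟶ X, m ≫ f = l := (hf P hP).surjective l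
  rw [Category.assoc, h₁₂, comp_zero]

/-- A morphism is an isomorphism if it induces bijections on morphisms to objects in a class that
is closed under desuspension and detects zero objects. -/
lemma isIso_of_bijective_precomp (S : ObjectProperty 𝒯)
    (hS : ∀ P, S P → ∃ P', S P' ∧ Nonempty (P ≅ P'⟦(1 : ℤ)⟧))
    (hzero : ∀ W, (∀ P, S P → ∀ f : W ⟶ P, f = 0) → IsZero W)
    {X Y : 𝒯} (f : X ⟶ Y) (hf : ∀ P, S P → Function.Bijective (fun g : Y ⟶ P => f ≫ g)) :
    IsIso f := by
  obtain ⟨W, p, q, hT⟩ := distinguished_cocone_triangle f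
  have h₁₂ : f ≫ p = 0 := comp_distTriang_mor_zero₁₂ _ hT
  have h₃₁ : q ≫ f⟦(1 : ℤ)⟧' = 0 := comp_distTriang_mor_zero₃₁ _ hT
  suffices IsZero W from (Triangle.isZero₃_iff_isIso₁ _ hT).1 this
  refine hzero _ fun P hP g => ?_
  have hpg : p ≫ g = 0 := (hf P hP).injective (by
    rw [comp_zero]
    exact (Category.assoc f p g).symm.trans ((congrArg (fun t => t ≫ g) h₁₂).trans zero_comp))
  obtain ⟨l, rfl⟩ : ∃ l : X⟦(1 : ℤ)⟧ ⟶ P, g = q ≫ l := Triangle.yoneda_exact₃ _ hT g hpg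
  obtain ⟨P', hP', ⟨e⟩⟩ := hS P hP
  obtain ⟨k, hk⟩ := (shiftFunctor 𝒯 (1 : ℤ)).map_surjective (l ≫ e.hom)
  obtain ⟨m, rfl⟩ : ∃ m : Y ⟶ P', f ≫ m = k := (hf P' hP').surjective k
  rw [← cancel_mono e.hom, Category.assoc, ← hk, zero_comp, Functor.map_comp, reassoc_of% h₃₁, zero_comp]

end Triangulated

section Detection

open DerivedCategory Limits

variable {A : Type u₁} [Category.{v₁} A] [Abelian A] [HasDerivedCategory.{v₃} A]

lemma DerivedCategory.isZero_of_isZero_homology {X : DerivedCategory A}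
    (hX : ∀ n, IsZero ((homologyFunctor A n).obj X)) : IsZero X := by
  have h₀ : IsZero (Q.obj (HomologicalComplex.zero : CochainComplex A ℤ)) :=
    Functor.map_isZero _ HomologicalComplex.isZero_zero
  have : IsIso (0 : X ⟶ Q.obj (HomologicalComplex.zero : CochainComplex A ℤ)) := by
    rw [isIso_iff]
    exact fun n => ⟨0, (hX n).eq_of_src _ _, (Functor.map_isZero _ h₀).eq_of_src _ _⟩
  exact h₀.of_iso (asIso (0 : X ⟶ Q.obj (HomologicalComplex.zero : CochainComplex A ℤ)))

/-- The test objects are the truncations of `W` in degrees at least `n`: the canonical map to the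
truncation is an isomorphism on homology in degree `n`, so if it is zero, that homology vanishes. -/
lemma isZero_of_hom_to_isBoundedBelow_eq_zero {W : DerivedCategory A}
    (hW : ∀ J, IsBoundedBelow J → ∀ f : W ⟶ J, f = 0) : IsZero W := by
  refine isZero_of_isZero_homology fun n => ?_
  let K := Q.objPreimage W
  let e : Q.obj K ≅ W := Q.objObjPreimageIso W
  have h₀ : Q.map (K.πTruncGE n) = 0 := by
    rw [← cancel_epi e.inv, hW _ ⟨n, (isGE_Q_obj_iff _ _).2 inferInstance⟩ (e.inv ≫ _), comp_zero]
  have h₁ := homologyFunctorFactors_hom_naturality (K.πTruncGE n) n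
  have := (quasiIsoAt_iff_isIso_homologyMap (K.πTruncGE n) n).1 inferInstance
  rw [h₀, Functor.map_zero, zero_comp] at h₁
  have h₂ : IsZero (K.homology n) := by
    have h₃ : HomologicalComplex.homologyMap (K.πTruncGE n) n = 0 :=
      (IsIso.eq_inv_comp _).2 h₁.symm |>.trans comp_zero
    rw [IsZero.iff_id_eq_zero, ← cancel_mono (HomologicalComplex.homologyMap (K.πTruncGE n) n), h₃,
      comp_zero, comp_zero]
  exact h₂.of_iso ((homologyFunctor A n).mapIso e.symm ≪≫ (homologyFunctorFactors A n).app K)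

lemma IsBoundedBelow.shift {J : DerivedCategory A} (hJ : IsBoundedBelow J) (a : ℤ) :
    IsBoundedBelow (J⟦a⟧) := by
  obtain ⟨n, hn⟩ := hJ
  exact ⟨n - a, TStructure.t.isGE_shift J n a (n - a) (by lia)⟩

/-- Bounded below objects detect isomorphisms in the derived category. -/
lemma isIso_of_bijective_precomp_isBoundedBelow {X Y : DerivedCategory A} (f : X ⟶ Y)
    (hf : ∀ J, IsBoundedBelow J → Function.Bijective (fun g : Y ⟶ J => f ≫ g)) : IsIso f :=
  isIso_of_bijective_precomp IsBoundedBelow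
    (fun J hJ => ⟨J⟦(-1 : ℤ)⟧, hJ.shift _,
      ⟨((shiftFunctorCompIsoId (DerivedCategory A) (-1 : ℤ) 1 (by simp)).app J).symm⟩⟩)
    (fun _ hW => isZero_of_hom_to_isBoundedBelow_eq_zero hW) f hf

/-- The object of the derived category given by the complex with `P` in degree `n`. -/
abbrev singleQ (n : ℤ) : A ⥤ DerivedCategory A :=
  HomologicalComplex.single A (.up ℤ) n ⋙ Q

instance isKProjective_single (P : A) [Projective P] (n : ℤ) :
    CochainComplex.IsKProjective ((HomologicalComplex.single A (.up ℤ) n).obj P) :=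
  have (k : ℤ) : Projective (((HomologicalComplex.single A (.up ℤ) n).obj P).X k) := by
    by_cases h : k = n
    · subst h
      exact Projective.of_iso (HomologicalComplex.singleObjXSelf (.up ℤ) k P).symm inferInstance
    · exact (HomologicalComplex.isZero_single_obj_X (.up ℤ) n P k h).projective
  CochainComplex.isKProjective_of_projective _ n

/-- A cycle parametrized by a generator is a chain map from a complex concentrated in one degree.
That complex is K-projective, so vanishing in the derived category gives a null-homotopy, which
exhibits the cycle as a boundary. -/
lemma isZero_of_hom_from_singleQ_eq_zero {ι : Type*} {G : ι → A} [∀ i, Projective (G i)]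
    (hG : ObjectProperty.IsSeparating (.ofObj G)) {W : DerivedCategory A}
    (hW : ∀ i n (f : (singleQ n).obj (G i) ⟶ W), f = 0) : IsZero W := by
  refine isZero_of_isZero_homology fun n => ?_
  let K := Q.objPreimage W
  let e : Q.obj K ≅ W := Q.objObjPreimageIso W
  suffices K.ExactAt n from this.isZero_homology.of_iso
    ((homologyFunctor A n).mapIso e.symm ≪≫ (homologyFunctorFactors A n).app K)
  have hr : (ComplexShape.up ℤ).Rel (n - 1) n := by simp
  rw [HomologicalComplex.exactAt_iff' _ (n - 1) n (n + 1) (by simp) (by simp),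
    ShortComplex.exact_iff_epi_toCycles]
  refine CochainComplex.epi_of_separating hG _ fun i y => ?_
  let x := y ≫ (K.sc' (n - 1) n (n + 1)).iCycles
  have hx : x ≫ K.d n (n + 1) = 0 := by
    exact (Category.assoc _ _ _).trans
      ((y ≫= (K.sc' (n - 1) n (n + 1)).iCycles_g).trans comp_zero)
  let f : (HomologicalComplex.single A (.up ℤ) n).obj (G i) ⟶ K :=
    HomologicalComplex.mkHomFromSingle x (fun k hk => by
      obtain rfl : n + 1 = k := hk
      exact hx)
  have hf : Q.map f = 0 := by
    rw [← cancel_mono e.hom, zero_comp]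
    exact hW i n (Q.map f ≫ e.hom)
  obtain ⟨h⟩ := homotopy_of_Q_map_eq_zero_of_isKProjective f hf
  have hc := h.comm n
  rw [dNext_eq h.hom (show (ComplexShape.up ℤ).Rel n (n + 1) by simp), prevD_eq h.hom hr] at hc
  refine ⟨(HomologicalComplex.singleObjXSelf (.up ℤ) n (G i)).inv ≫ h.hom n (n - 1), ?_⟩
  rw [← cancel_mono (K.sc' (n - 1) n (n + 1)).iCycles, Category.assoc,
    ShortComplex.toCycles_i]
  have hf' := HomologicalComplex.mkHomFromSingle_f (K := K) (j := n) x (fun k hk => by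
      obtain rfl : n + 1 = k := hk
      exact hx)
  change f.f n = _ at hf'
  rw [hf'] at hc
  refine (cancel_epi (HomologicalComplex.singleObjXSelf (.up ℤ) n (G i)).hom).1 (Eq.trans ?_ hc.symm)
  change _ ≫ (_ ≫ _) ≫ K.d (n - 1) n = _
  simp

/-- Shifts of the members of a separating family of projective objects detect isomorphisms in the
derived category. -/
lemma isIso_of_bijective_singleQ {ι : Type*} {G : ι → A} [∀ i, Projective (G i)]
    (hG : ObjectProperty.IsSeparating (.ofObj G)) {X Y : DerivedCategory A} (f : X ⟶ Y)
    (hf : ∀ i n, Function.Bijective (fun g : (singleQ n).obj (G i) ⟶ X => g ≫ f)) : IsIso f := by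
  refine isIso_of_bijective_comp (fun P => ∃ i n, P = (singleQ n).obj (G i)) ?_ ?_ f ?_
  · rintro _ ⟨i, n, rfl⟩
    exact ⟨_, ⟨i, n + 1, rfl⟩, ⟨(singleFunctorIsoCompQ A n).symm.app (G i) ≪≫
      (((singleFunctors A).shiftIso 1 n (n + 1) (by lia)).app (G i)).symm ≪≫
        (shiftFunctor _ (1 : ℤ)).mapIso ((singleFunctorIsoCompQ A (n + 1)).app (G i))⟩⟩
  · exact fun W hW => isZero_of_hom_from_singleQ_eq_zero hG fun i n => hW _ ⟨i, n, rfl⟩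
  · rintro _ ⟨i, n, rfl⟩
    exact hf i n

end Detection

/-! ### Comparing functors by means of coreflections of bounded below objects -/

section Coreflections

open DerivedCategory Limits

/-- A functor to a derived category such that morphisms from its values to any given bounded below
object are representable. -/
def HasBoundedBelowCoreflections {𝒟 : Type u₁} [Category.{v₁} 𝒟] {A : Type u₂} [Category.{v₂} A]
    [Abelian A] [HasDerivedCategory.{v₃} A] (Φ : 𝒟 ⥤ DerivedCategory A) : Prop :=
  ∀ J : DerivedCategory A, IsBoundedBelow J → ∃ (Y : 𝒟) (v : Φ.obj Y ⟶ J), IsCoreflection Φ v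

lemma IsCoreflection.id {𝒟 : Type u₁} [Category.{v₁} 𝒟] (J : 𝒟) :
    IsCoreflection (𝟭 𝒟) (𝟙 J) := fun X => by
  have : (fun g : X ⟶ J => (𝟭 𝒟).map g ≫ 𝟙 J) = _root_.id := funext fun g => Category.comp_id g
  exact this ▸ Function.bijective_id

lemma IsCoreflection.comp {𝒞 : Type*} [Category* 𝒞] {𝒟 : Type u₁} [Category.{v₁} 𝒟] {ℰ : Type u₂}
    [Category.{v₂} ℰ]
    {Φ : 𝒞 ⥤ 𝒟} {Ψ : 𝒟 ⥤ ℰ} {J : ℰ} {Y : 𝒟} {Z : 𝒞} {v : Ψ.obj Y ⟶ J} {w : Φ.obj Z ⟶ Y}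
    (hv : IsCoreflection Ψ v) (hw : IsCoreflection Φ w) :
    IsCoreflection (Φ ⋙ Ψ) (J := J) (Y := Z) (Ψ.map w ≫ v) := fun X => by
  have : (fun g : X ⟶ Z => (Φ ⋙ Ψ).map g ≫ Ψ.map w ≫ v) =
      (fun g => Ψ.map g ≫ v) ∘ (fun g => Φ.map g ≫ w) := funext fun g => by simp
  exact this ▸ (hv (Φ.obj X)).comp (hw X)

lemma IsCoreflection.counit {𝒟 : Type u₁} [Category.{v₁} 𝒟] {ℰ : Type u₂}
    [Category.{v₂} ℰ] {Φ : 𝒟 ⥤ ℰ} {Ψ : ℰ ⥤ 𝒟} (adj : Φ ⊣ Ψ) (J : ℰ) :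
    IsCoreflection Φ (adj.counit.app J) := fun X => by
  have : (fun g : X ⟶ Ψ.obj J => Φ.map g ≫ adj.counit.app J) = (adj.homEquiv X J).symm :=
    funext fun g => (Adjunction.homEquiv_counit _ _ _ _).symm
  exact this ▸ (adj.homEquiv X J).symm.bijective

variable {𝒟 : Type u₃} [Category.{v₃} 𝒟]
  {A : Type u₁} [Category.{v₁} A] [Abelian A] [HasDerivedCategory A]
  {B : Type u₂} [Category.{v₂} B] [Abelian B] [HasDerivedCategory B]

lemma HasBoundedBelowCoreflections.id :
    HasBoundedBelowCoreflections (𝟭 (DerivedCategory A)) :=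
  fun J _ => ⟨J, 𝟙 J, .id J⟩

/-- The coreflection of a bounded below object along an exact left adjoint is bounded below again,
so the hypothesis on `Φ` applies to it. -/
lemma HasBoundedBelowCoreflections.comp_mapDerivedCategory {Φ : 𝒟 ⥤ DerivedCategory B}
    (hΦ : HasBoundedBelowCoreflections Φ) (F : B ⥤ A) [F.Additive]
    [PreservesFiniteLimits F] [PreservesFiniteColimits F] [F.IsLeftAdjoint] [EnoughInjectives A] :
    HasBoundedBelowCoreflections (Φ ⋙ F.mapDerivedCategory) := fun J hJ => by
  obtain ⟨Y, v, hY, hv⟩ := exists_isCoreflection_mapDerivedCategory F hJ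
  obtain ⟨Z, w, hw⟩ := hΦ Y hY
  exact ⟨Z, _, hv.comp hw⟩

/-- Here the coreflection is the counit of the adjunction; it stays bounded below because the right
adjoint is induced by an exact functor. -/
lemma HasBoundedBelowCoreflections.comp_leftAdjoint {Φ : 𝒟 ⥤ DerivedCategory B}
    (hΦ : HasBoundedBelowCoreflections Φ) (F : A ⥤ B) [F.Additive]
    [PreservesFiniteLimits F] [PreservesFiniteColimits F]
    {Ψ : DerivedCategory B ⥤ DerivedCategory A} (adj : Ψ ⊣ F.mapDerivedCategory) :
    HasBoundedBelowCoreflections (Φ ⋙ Ψ) := fun J hJ => by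
  obtain ⟨Z, w, hw⟩ := hΦ _ (IsBoundedBelow.mapDerivedCategory F hJ)
  exact ⟨Z, _, (IsCoreflection.counit adj J).comp hw⟩

/-- A natural transformation between functors with bounded below coreflections is an isomorphism
if it is so on all shifts of a separating family of projective objects. -/
lemma HasBoundedBelowCoreflections.isIso {Φ Ψ : DerivedCategory B ⥤ DerivedCategory A}
    (hΦ : HasBoundedBelowCoreflections Φ) (hΨ : HasBoundedBelowCoreflections Ψ) (θ : Φ ⟶ Ψ)
    {ι : Type*} {G : ι → B} [∀ i, Projective (G i)]
    (hG : ObjectProperty.IsSeparating (.ofObj G))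
    (hθ : ∀ i n, IsIso (θ.app ((singleQ n).obj (G i)))) : IsIso θ := by
  suffices ∀ X, IsIso (θ.app X) from NatIso.isIso_of_isIso_app θ
  intro X
  refine isIso_of_bijective_precomp_isBoundedBelow _ fun J hJ => ?_
  obtain ⟨Y, v, hv⟩ := hΦ J hJ
  obtain ⟨Z, w, hw⟩ := hΨ J hJ
  -- `f` is the transpose of `θ` on representing objects. It suffices to invert `f`, and this can be
  -- tested on shifted generators, where `θ` is invertible by hypothesis.
  obtain ⟨f, hf⟩ := (hv Z).surjective (θ.app Z ≫ w)
  have key (T) (g : T ⟶ Z) : Φ.map (g ≫ f) ≫ v = θ.app T ≫ Ψ.map g ≫ w := by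
    dsimp only at hf
    rw [Functor.map_comp, Category.assoc, hf, NatTrans.naturality_assoc]
  have hf : IsIso f := isIso_of_bijective_singleQ hG f fun i n => by
    have h₂ : Function.Bijective (fun g : Ψ.obj ((singleQ n).obj (G i)) ⟶ J =>
      θ.app ((singleQ n).obj (G i)) ≫ g) :=
        (asIso (θ.app ((singleQ n).obj (G i)))).symm.homFromEquiv.bijective
    refine (hv ((singleQ n).obj (G i))).of_comp_iff' _ |>.1 ?_
    convert h₂.comp (hw _) using 1
    funext g
    exact key _ g
  refine ((hw X).of_comp_iff _).1 ?_
  convert (hv X).comp (asIso f).homToEquiv.bijective using 1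
  funext g
  exact (key _ g).symm

end Coreflections

/-! ### Morphisms from shifted projective objects -/

section SingleQ

open DerivedCategory Limits

variable {A : Type u₁} [Category.{v₁} A] [Abelian A]

/-- A null-homotopy for a morphism from a complex concentrated in one degree. -/
def homotopyZeroOfSingle {P : A} {n : ℤ} {K : CochainComplex A ℤ}
    (g : (HomologicalComplex.single A (.up ℤ) n).obj P ⟶ K) (z : P ⟶ K.X (n - 1))
    (hz : g.f n = (HomologicalComplex.singleObjXSelf (.up ℤ) n P).hom ≫ z ≫ K.d (n - 1) n) :
    Homotopy g 0 where
  hom i j := if h : i = n then if h' : j = n - 1 then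
    (HomologicalComplex.singleObjXIsoOfEq (.up ℤ) n P i h).hom ≫ z ≫ (K.XIsoOfEq h').inv else 0
    else 0
  zero i j hij := by
    by_cases h : i = n
    · subst h
      rw [dif_pos rfl, dif_neg (by rintro rfl; exact hij (by simp))]
    · rw [dif_neg h]
  comm i := by
    by_cases h : i = n
    · subst h
      rw [dNext_eq _ (show (ComplexShape.up ℤ).Rel i (i + 1) by simp),
        prevD_eq _ (show (ComplexShape.up ℤ).Rel (i - 1) i by simp)]
      simp [hz, HomologicalComplex.singleObjXSelf]
    · exact (HomologicalComplex.isZero_single_obj_X (.up ℤ) n P i h).eq_of_src _ _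

lemma exists_of_homotopy_single {P : A} {n : ℤ} {K : CochainComplex A ℤ}
    {g : (HomologicalComplex.single A (.up ℤ) n).obj P ⟶ K} (h : Homotopy g 0) :
    ∃ z : P ⟶ K.X (n - 1),
      g.f n = (HomologicalComplex.singleObjXSelf (.up ℤ) n P).hom ≫ z ≫ K.d (n - 1) n := by
  have hc := h.comm n
  rw [dNext_eq h.hom (show (ComplexShape.up ℤ).Rel n (n + 1) by simp),
    prevD_eq h.hom (show (ComplexShape.up ℤ).Rel (n - 1) n by simp)] at hc
  refine ⟨(HomologicalComplex.singleObjXSelf (.up ℤ) n P).inv ≫ h.hom n (n - 1), ?_⟩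
  rw [hc]
  simp

variable [HasDerivedCategory.{v₃} A]
  {B : Type u₂} [Category.{v₂} B] [Abelian B] [HasDerivedCategory.{u₃} B]
  (F : B ⥤ A) [F.Additive] [PreservesFiniteLimits F] [PreservesFiniteColimits F]

/-- Exact functors commute with the embeddings of an abelian category into its derived category. -/
def singleQIso (n : ℤ) : singleQ n ⋙ F.mapDerivedCategory ≅ F ⋙ singleQ n :=
  Functor.isoWhiskerLeft (HomologicalComplex.single B (.up ℤ) n) F.mapDerivedCategoryFactors ≪≫
    Functor.isoWhiskerRight (HomologicalComplex.singleMapHomologicalComplex F (.up ℤ) n) Q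

lemma singleQIso_inv_app (n : ℤ) (P : B) : (singleQIso F n).inv.app P =
    Q.map ((HomologicalComplex.singleMapHomologicalComplex F (.up ℤ) n).inv.app P) ≫
      F.mapDerivedCategoryFactors.inv.app ((HomologicalComplex.single B (.up ℤ) n).obj P) := by
  simp [singleQIso]

/-- For complexes concentrated in one degree, chain maps and null-homotopies are both given by
single maps out of `P` or `P'`, so the underived universal property passes to the derived category.
This computes a derived left adjoint on one projective without constructing the adjoint. -/
lemma bijective_of_universal {P : A} {P' : B} [Projective P] [Projective P'] (u : P ⟶ F.obj P')
    (hu : ∀ M : B, Function.Bijective (fun g : P' ⟶ M => u ≫ F.map g)) (n : ℤ)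
    (Z : DerivedCategory B) :
    Function.Bijective (fun g : (singleQ n).obj P' ⟶ Z =>
      ((singleQ n).map u ≫ (singleQIso F n).inv.app P') ≫ F.mapDerivedCategory.map g) := by
  let s := HomologicalComplex.singleObjXSelf (.up ℤ) n P
  let s' := HomologicalComplex.singleObjXSelf (.up ℤ) n P'
  let i := (HomologicalComplex.singleMapHomologicalComplex F (.up ℤ) n).inv.app P'
  let w : (HomologicalComplex.single A (.up ℤ) n).obj P ⟶ (F.mapHomologicalComplex (.up ℤ)).obj
    ((HomologicalComplex.single B (.up ℤ) n).obj P') :=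
      (HomologicalComplex.single A (.up ℤ) n).map u ≫ i
  have hi : i.f n = (HomologicalComplex.singleObjXSelf (.up ℤ) n (F.obj P')).hom ≫ F.map s'.inv :=
    HomologicalComplex.singleMapHomologicalComplex_inv_app_self _ _ _ _
  have hw : w.f n = s.hom ≫ u ≫ F.map s'.inv := by
    have : w.f n = ((HomologicalComplex.single A (.up ℤ) n).map u).f n ≫ i.f n := rfl
    rw [this, hi, HomologicalComplex.single_map_f_self]
    refine (Category.assoc _ _ _).trans (congrArg (s.hom ≫ ·) ?_)
    exact (Category.assoc _ _ _).trans (congrArg (u ≫ ·) (Iso.inv_hom_id_assoc _ _))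
  have key := bijective_derived_of_isKProjective (F := F) w (fun K f => by
      let fn : ((HomologicalComplex.single A (.up ℤ) n).obj P).X n ⟶ F.obj (K.X n) := f.f n
      obtain ⟨g, hg⟩ : ∃ g : P' ⟶ K.X n, u ≫ F.map g = s.inv ≫ fn := (hu (K.X n)).surjective _
      refine ⟨HomologicalComplex.mkHomFromSingle g ?_, ?_⟩
      · rintro k hk
        apply (hu _).injective
        have : fn ≫ F.map (K.d n k) = _ := f.comm n k
        dsimp only
        rw [F.map_comp, ← Category.assoc, hg, Functor.map_zero, comp_zero, Category.assoc, this]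
        exact (congrArg (s.inv ≫ ·) (by simp; rfl)).trans comp_zero
      · apply HomologicalComplex.from_single_hom_ext
        rw [HomologicalComplex.comp_f, hw]
        change (s.hom ≫ u ≫ F.map s'.inv) ≫ F.map (HomologicalComplex.Hom.f _ n) = fn
        rw [HomologicalComplex.mkHomFromSingle_f, Category.assoc, Category.assoc, ← F.map_comp,
          Iso.inv_hom_id_assoc, hg, Iso.hom_inv_id_assoc])
    (fun K g ⟨h⟩ => by
      obtain ⟨z₀, hz⟩ := exists_of_homotopy_single h
      let z : P ⟶ F.obj (K.X (n - 1)) := z₀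
      obtain ⟨z', hz'⟩ : ∃ z' : P' ⟶ K.X (n - 1), u ≫ F.map z' = z := (hu _).surjective z
      refine ⟨homotopyZeroOfSingle g z' ?_⟩
      have hz₁ : (s.hom ≫ u ≫ F.map s'.inv) ≫ F.map (g.f n) = s.hom ≫ z ≫ F.map (K.d (n - 1) n) := by
        rw [← hw]
        exact hz
      rw [Category.assoc, Category.assoc, Iso.cancel_iso_hom_left, ← hz', Category.assoc,
        ← F.map_comp, ← F.map_comp] at hz₁
      rw [← Iso.inv_comp_eq]
      exact (hu _).injective hz₁) Z
  have e : (singleQ n).map u ≫ (singleQIso F n).inv.app P' =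
      Q.map w ≫ F.mapDerivedCategoryFactors.inv.app
        ((HomologicalComplex.single B (.up ℤ) n).obj P') := by
    rw [singleQIso_inv_app, Q.map_comp, Category.assoc]
    rfl
  rw [e]
  exact key

end SingleQ

/-! ### Freely generated functors -/

section Free

open Limits

variable {C : Type u₁} [Category.{v₁} C]

/-- The functor `V` is freely generated by the elements `x a` of `V (c a)`. -/
def IsFreelyGenerated (V : C ⥤ Type u) {ι : Type u} (c : ι → C) (x : ∀ a, V.obj (c a)) : Prop :=
  ∀ (d : C) (y : V.obj d), ∃! p : Σ a, (c a ⟶ d), V.map p.2 (x p.1) = y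

variable {V : C ⥤ Type u} {ι : Type u} {c : ι → C} {x : ∀ a, V.obj (c a)}

/-- The natural transformation with given values on free generators. -/
def IsFreelyGenerated.desc (h : IsFreelyGenerated V c x) (W : C ⥤ Type u₂)
    (y : ∀ a, W.obj (c a)) (d : C) (v : V.obj d) : W.obj d :=
  W.map (h d v).choose.2 (y (h d v).choose.1)

lemma IsFreelyGenerated.desc_map (h : IsFreelyGenerated V c x) (W : C ⥤ Type u₂)
    (y : ∀ a, W.obj (c a)) {d : C} (a : ι) (f : c a ⟶ d) :
    h.desc W y d (V.map f (x a)) = W.map f (y a) := by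
  have := (h d (V.map f (x a))).choose_spec.2 ⟨a, f⟩ rfl
  unfold IsFreelyGenerated.desc
  rw [← this]

lemma IsFreelyGenerated.exists_eq (h : IsFreelyGenerated V c x) {d : C} (v : V.obj d) :
    ∃ (a : ι) (f : c a ⟶ d), V.map f (x a) = v := by
  obtain ⟨⟨a, f⟩, hp, -⟩ := h d v
  exact ⟨a, f, hp⟩

lemma IsFreelyGenerated.desc_naturality (h : IsFreelyGenerated V c x) (W : C ⥤ Type u₂)
    (y : ∀ a, W.obj (c a)) {d d' : C} (f : d ⟶ d') (v : V.obj d) :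
    h.desc W y d' (V.map f v) = W.map f (h.desc W y d v) := by
  obtain ⟨a, g, rfl⟩ := h.exists_eq v
  rw [desc_map, ← Functor.map_comp_apply, desc_map, Functor.map_comp_apply]

variable (R : Type u) [Ring R]

/-- The functor of free modules on a functor to sets. -/
abbrev freeFun : (C ⥤ Type u) ⥤ (C ⥤ ModuleCat.{u} R) :=
  (Functor.whiskeringRight C (Type u) (ModuleCat.{u} R)).obj (ModuleCat.free R)

variable {R}

lemma freeFun_hom_ext {V : C ⥤ Type u} {M : C ⥤ ModuleCat.{u} R} {f g : (freeFun R).obj V ⟶ M}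
    (h : ∀ d v, f.app d (ModuleCat.freeMk v) = g.app d (ModuleCat.freeMk v)) : f = g := by
  ext d : 2
  exact ModuleCat.free_hom_ext (h d)

/-- Morphisms from the functor of free modules. -/
def freeFunDesc {V : C ⥤ Type u} {M : C ⥤ ModuleCat.{u} R} (f : ∀ d, V.obj d → M.obj d)
    (hf : ∀ {d d' : C} (g : d ⟶ d') (v : V.obj d), f d' (V.map g v) = M.map g (f d v)) :
    (freeFun R).obj V ⟶ M where
  app d := ModuleCat.freeDesc (TypeCat.ofHom (f d))
  naturality d d' g := by
    apply ModuleCat.free_hom_ext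
    intro v
    dsimp
    rw [ModuleCat.free_map_apply, ModuleCat.freeDesc_apply, ModuleCat.freeDesc_apply]
    exact hf g v

lemma freeFunDesc_app {V : C ⥤ Type u} {M : C ⥤ ModuleCat.{u} R} (f : ∀ d, V.obj d → M.obj d)
    (hf : ∀ {d d' : C} (g : d ⟶ d') (v : V.obj d), f d' (V.map g v) = M.map g (f d v))
    (d : C) (v : V.obj d) : (freeFunDesc f hf).app d (ModuleCat.freeMk v) = f d v :=
  ModuleCat.freeDesc_apply _ _

lemma freeFun_naturality {V : C ⥤ Type u} {M : C ⥤ ModuleCat.{u} R} (f : (freeFun R).obj V ⟶ M)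
    {d d' : C} (g : d ⟶ d') (v : V.obj d) :
    f.app d' (ModuleCat.freeMk (V.map g v)) = M.map g (f.app d (ModuleCat.freeMk v)) := by
  have := ConcreteCategory.congr_hom (f.naturality g) (ModuleCat.freeMk v)
  simpa using this

/-- A morphism from the free modules on a freely generated functor is given by the images of the
generators. -/
lemma IsFreelyGenerated.bijective (h : IsFreelyGenerated V c x) (M : C ⥤ ModuleCat.{u} R) :
    Function.Bijective (fun (f : (freeFun R).obj V ⟶ M) (a : ι) =>
      f.app (c a) (ModuleCat.freeMk (x a))) := by
  constructor
  · intro f g hfg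
    refine freeFun_hom_ext fun d v => ?_
    obtain ⟨a, p, rfl⟩ := h.exists_eq v
    rw [freeFun_naturality, freeFun_naturality]
    exact congrArg (M.map p) (congr_fun hfg a)
  · intro y
    refine ⟨freeFunDesc (h.desc (M ⋙ forget _) y)
      (fun g v => h.desc_naturality (M ⋙ forget _) y g v), funext fun a => ?_⟩
    dsimp only
    rw [freeFunDesc_app]
    have := h.desc_map (M ⋙ forget _) y a (𝟙 (c a))
    rwa [Functor.map_id_apply, Functor.map_id_apply] at this

lemma IsFreelyGenerated.projective (h : IsFreelyGenerated V c x) :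
    Projective ((freeFun R).obj V) where
  factors {M M'} f e _ := by
    have he (d : C) : Function.Surjective (e.app d) :=
      (ModuleCat.epi_iff_surjective _).1 inferInstance
    choose y hy using fun a => he (c a) (f.app (c a) (ModuleCat.freeMk (x a)))
    obtain ⟨g, hg⟩ := (h.bijective M).surjective y
    refine ⟨g, (h.bijective M').injective (funext fun a => ?_)⟩
    have := congr_fun hg a
    dsimp only at this ⊢
    rw [NatTrans.comp_app, ModuleCat.comp_apply, this, hy]

/-- The functor corepresented by an object of a locally small category. -/
def corep [LocallySmall.{u} C] (c : C) : C ⥤ Type u where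
  obj d := Shrink.{u} (c ⟶ d)
  map f := TypeCat.ofHom fun p => equivShrink _ ((equivShrink _).symm p ≫ f)
  map_id _ := by
    ext p
    simp
  map_comp _ _ := by
    ext p
    simp

/-- The universal element of the functor corepresented by `c`. -/
def corepId [LocallySmall.{u} C] (c : C) : (corep.{v₁, u₁, u} c).obj c :=
  equivShrink (c ⟶ c) (𝟙 c)

lemma corep_map_corepId [LocallySmall.{u} C] {c d : C} (f : c ⟶ d) :
    (corep.{v₁, u₁, u} c).map f (corepId c) = equivShrink (c ⟶ d) f := by
  change equivShrink (c ⟶ d) ((equivShrink (c ⟶ c)).symm (equivShrink (c ⟶ c) (𝟙 c)) ≫ f) = _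
  rw [Equiv.symm_apply_apply, Category.id_comp]

lemma isFreelyGenerated_corep [LocallySmall.{u} C] (c : C) :
    IsFreelyGenerated (corep.{v₁, u₁, u} c) (fun _ : PUnit.{u + 1} => c)
      (fun _ => corepId c) := fun d y => by
  refine ⟨⟨⟨⟩, (equivShrink (c ⟶ d)).symm y⟩, ?_, ?_⟩
  · dsimp only
    exact (corep_map_corepId _).trans (Equiv.apply_symm_apply _ _)
  · rintro ⟨_, f⟩ rfl
    dsimp only
    exact congrArg (Sigma.mk _) ((congrArg _ (corep_map_corepId f)).trans
      (Equiv.symm_apply_apply _ _)).symm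

instance projective_corep [LocallySmall.{u} C] (c : C) :
    Projective ((freeFun R).obj (corep.{v₁, u₁, u} c)) :=
  (isFreelyGenerated_corep c).projective

/-- By the Yoneda lemma, it is enough to meet every isomorphism class of objects. For an essentially
small category the family can then be indexed by a small set, as the small object argument requires.
-/
lemma isSeparating_corep [LocallySmall.{u} C] {ι : Type*} (c : ι → C)
    (hc : ∀ d, ∃ i, Nonempty (c i ≅ d)) :
    ObjectProperty.IsSeparating (.ofObj
      (fun i => (freeFun R).obj (corep.{v₁, u₁, u} (c i)))) := fun M M' f g h => by
  ext d m
  obtain ⟨i, ⟨e⟩⟩ := hc d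
  let h' := isFreelyGenerated_corep.{v₁, u₁, u} (c i)
  obtain ⟨t, ht⟩ := (h'.bijective M).surjective (fun _ => M.map e.inv m)
  have ht' := congr_fun ht ⟨⟩
  dsimp only at ht'
  have := h _ ⟨i⟩ t
  have := congr_arg (fun s => s.app (c i) (ModuleCat.freeMk (corepId (c i)))) this
  dsimp only at this
  rw [NatTrans.comp_app, NatTrans.comp_app, ModuleCat.comp_apply, ModuleCat.comp_apply, ht',
    ← ModuleCat.comp_apply, ← ModuleCat.comp_apply, NatTrans.naturality, NatTrans.naturality,
    ModuleCat.comp_apply, ModuleCat.comp_apply] at this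
  exact (ModuleCat.mono_iff_injective (M'.map e.inv)).1 inferInstance this

lemma isSeparating_corep_self [LocallySmall.{u} C] :
    ObjectProperty.IsSeparating (.ofObj
      (fun c : C => (freeFun R).obj (corep.{v₁, u₁, u} c))) :=
  isSeparating_corep _ fun d => ⟨d, ⟨Iso.refl d⟩⟩

end Free

/-! ### The abelian category of functors to modules -/

section FunctorCategory

open Limits

variable (R : Type u) [Ring R] (C : Type u₁) [Category.{v₁} C] [EssentiallySmall.{u} C]

lemma isGrothendieckAbelian_smallFunctor (S : Type u) [SmallCategory S] :
    IsGrothendieckAbelian.{u} (S ⥤ ModuleCat.{u} R) where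
  ab5OfSize := ⟨fun _ _ _ => inferInstance⟩
  hasSeparator := HasSeparator.of_equivalence
    ((opOpEquivalence S).congrLeft (E := ModuleCat.{u} R))

instance isGrothendieckAbelian_functor : IsGrothendieckAbelian.{u} (C ⥤ ModuleCat.{u} R) :=
  have := isGrothendieckAbelian_smallFunctor R (SmallModel.{u} C)
  IsGrothendieckAbelian.of_equivalence ((equivSmallModel.{u} C).symm.congrLeft)

lemma exists_isKProjective_quasiIso_functor (L : CochainComplex (C ⥤ ModuleCat.{u} R) ℤ) :
    ∃ (K : CochainComplex (C ⥤ ModuleCat.{u} R) ℤ) (p : K ⟶ L), K.IsKProjective ∧ QuasiIso p :=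
  CochainComplex.exists_isKProjective_quasiIso
    (isSeparating_corep (fun s : SmallModel.{u} C => (equivSmallModel.{u} C).inverse.obj s)
      fun d => ⟨_, ⟨((equivSmallModel C).unitIso.app d).symm⟩⟩) L

lemma hasColimitsOfShape_moduleCat : HasColimitsOfShape C (ModuleCat.{u} R) :=
  have : HasColimitsOfSize.{u, u} (ModuleCat.{u} R) :=
    IsGrothendieckAbelian.hasColimits.{u} (ModuleCat.{u} R)
  hasColimitsOfShape_of_equivalence (equivSmallModel.{u} C).symm

variable {C} {C' : Type u₂} [Category.{v₂} C'] [LocallySmall.{u} C']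

instance isRightAdjoint_precomp (γ : C ⥤ C') : (precomp R γ).IsRightAdjoint :=
  have (c' : C') : HasColimitsOfShape (CostructuredArrow γ c') (ModuleCat.{u} R) :=
    hasColimitsOfShape_moduleCat R _
  have (M : C ⥤ ModuleCat.{u} R) : γ.HasPointwiseLeftKanExtension M := fun _ =>
    HasColimitsOfShape.has_colimit (C := ModuleCat.{u} R) _
  (Functor.lanAdjunction γ (ModuleCat.{u} R)).isRightAdjoint

instance isLeftAdjoint_precomp (γ : C ⥤ C') : (precomp R γ).IsLeftAdjoint :=
  have (c' : C') : HasLimitsOfShape (StructuredArrow c' γ) (ModuleCat.{u} R) :=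
    hasLimitsOfShape_of_equivalence (equivSmallModel.{u} (StructuredArrow c' γ)).symm
  (Functor.ranAdjunction γ (ModuleCat.{u} R)).isLeftAdjoint

/-- The derived left Kan extension exists along a functor from an essentially small category to a
locally small category. -/
lemma nonempty_derivedLan (γ : C ⥤ C') : Nonempty (DerivedLan R γ) :=
  have : (pull R γ).IsRightAdjoint := isRightAdjoint_mapDerivedCategory (precomp R γ)
    (exists_isKProjective_quasiIso_functor R C)
  ⟨⟨_, Adjunction.ofIsRightAdjoint (pull R γ)⟩⟩

variable {R}

lemma HasBoundedBelowCoreflections.comp_pull {𝒟 : Type u₃} [Category.{v₃} 𝒟] {Φ : 𝒟 ⥤ DFun R C'}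
    (hΦ : HasBoundedBelowCoreflections Φ) (γ : C ⥤ C') :
    HasBoundedBelowCoreflections (Φ ⋙ pull R γ) :=
  hΦ.comp_mapDerivedCategory (precomp R γ)

end FunctorCategory

section

variable {R : Type u} [Ring R] {C : Type u₁} [Category.{v₁} C]
  {C' : Type u₂} [Category.{v₂} C']

lemma HasBoundedBelowCoreflections.comp_derivedLan {𝒟 : Type u₃} [Category.{v₃} 𝒟]
    {Φ : 𝒟 ⥤ DFun R C}
    (hΦ : HasBoundedBelowCoreflections Φ) {γ : C ⥤ C'} (F : DerivedLan R γ) :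
    HasBoundedBelowCoreflections (Φ ⋙ F.functor) :=
  hΦ.comp_leftAdjoint (precomp R γ) F.adj

end

/-! ### Calculus of pullback functors -/

section Pasting

variable {𝒞 : Type u₁} [Category.{v₁} 𝒞] {𝒟 : Type u₂} [Category.{v₂} 𝒟]

lemma comp_square_square {X Y Z W T U : 𝒞} {a : X ⟶ Y} {b : Y ⟶ Z} {c : X ⟶ W} {d : W ⟶ Z}
    {e : Z ⟶ T} {f : W ⟶ U} {g : U ⟶ T} (h₁ : a ≫ b = c ≫ d) (h₂ : d ≫ e = f ≫ g) :
    a ≫ b ≫ e = (c ≫ f) ≫ g := by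
  rw [reassoc_of% h₁, h₂, Category.assoc]

lemma map_comp_inv_map_hom (F : 𝒞 ⥤ 𝒟) {X Y Z : 𝒞} (a : X ⟶ Y) (b : Z ≅ Y) {T : 𝒟}
    (c : F.obj Y ⟶ T) : F.map (a ≫ b.inv) ≫ F.map b.hom ≫ c = F.map a ≫ c := by
  rw [← Functor.map_comp_assoc, Category.assoc, Iso.inv_hom_id, Category.comp_id]

lemma comp_map_comp_square (F : 𝒞 ⥤ 𝒟) {X B B' E : 𝒟} {Y Z T : 𝒞} {p : X ⟶ F.obj Y} {q : Y ⟶ Z}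
    {s : Z ⟶ T} {b : F.obj Z ⟶ B} {b' : F.obj T ⟶ B'} {t : B ⟶ B'} {w : B' ⟶ E} {r : X ⟶ B}
    {m : B ⟶ E} (hs : F.map s ≫ b' = b ≫ t) (h₁ : p ≫ F.map q ≫ b = r) (h₂ : t ≫ w = m) :
    p ≫ F.map (q ≫ s) ≫ b' ≫ w = r ≫ m := by
  rw [← h₁, ← h₂, Functor.map_comp, Category.assoc, reassoc_of% hs]
  simp only [Category.assoc]

end Pasting

section PullCalculus

open DerivedCategory Limits

variable (R : Type u) [Ring R] {C : Type u₁} [Category.{v₁} C] {C' : Type u₂} [Category.{v₂} C']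
  {C'' : Type u₃} [Category.{v₃} C'']

/-- The pullback of a complex is computed termwise. -/
abbrev pullCx (γ : C ⥤ C') : CochainComplex (C' ⥤ ModuleCat.{u} R) ℤ ⥤
    CochainComplex (C ⥤ ModuleCat.{u} R) ℤ :=
  (precomp R γ).mapHomologicalComplex (.up ℤ)

/-- The pullback functor on the derived category is induced by the one on complexes. -/
def pullQIso (γ : C ⥤ C') (K : CochainComplex (C' ⥤ ModuleCat.{u} R) ℤ) :
    (pull R γ).obj (Q.obj K) ≅ Q.obj ((pullCx R γ).obj K) :=
  (precomp R γ).mapDerivedCategoryFactors.app K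

lemma pullQIso_naturality (γ : C ⥤ C') {K L : CochainComplex (C' ⥤ ModuleCat.{u} R) ℤ}
    (f : K ⟶ L) : (pull R γ).map (Q.map f) ≫ (pullQIso R γ L).hom =
      (pullQIso R γ K).hom ≫ Q.map ((pullCx R γ).map f) :=
  (precomp R γ).mapDerivedCategoryFactors.hom.naturality f

/-- The morphism on complexes induced by a natural transformation. -/
abbrev pullCxMap {γ γ' : C ⥤ C'} (α : γ ⟶ γ') : pullCx R γ ⟶ pullCx R γ' :=
  NatTrans.mapHomologicalComplex ((Functor.whiskeringLeft C C' (ModuleCat.{u} R)).map α) (.up ℤ)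

/-- The transformations between pullbacks come from the universal property of localization. This
lemma and its analogues compute them on complexes and then on free modules in one degree, where they
are induced by maps of functors to sets. -/
lemma pullMap_app_Q {γ γ' : C ⥤ C'} (α : γ ⟶ γ') (K : CochainComplex (C' ⥤ ModuleCat.{u} R) ℤ) :
    (pullMap R α).app (Q.obj K) ≫ (pullQIso R γ' K).hom = (pullQIso R γ K).hom ≫
      Q.map ((pullCxMap R α).app K) := by
  rw [← Iso.eq_comp_inv, Category.assoc]
  exact Localization.liftNatTrans_app _ _ _ _ _ _ _ _

lemma pullComp_hom_app_Q (γ : C ⥤ C') (δ : C' ⥤ C'')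
    (K : CochainComplex (C'' ⥤ ModuleCat.{u} R) ℤ) :
    (pullComp R γ δ).hom.app (Q.obj K) ≫ (pull R γ).map (pullQIso R δ K).hom ≫
      (pullQIso R γ ((pullCx R δ).obj K)).hom = (pullQIso R (γ ⋙ δ) K).hom := by
  have : (pullComp R γ δ).hom.app (Q.obj K) = (pullQIso R (γ ⋙ δ) K).hom ≫
      𝟙 (Q.obj ((pullCx R γ).obj ((pullCx R δ).obj K))) ≫
        (pullQIso R γ ((pullCx R δ).obj K)).inv ≫ (pull R γ).map (pullQIso R δ K).inv :=
    Localization.liftNatTrans_app _ _ _ _ _ _ _ _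
  have aux {X Y Z T : DFun R C} (a : X ≅ Y) (b : Z ≅ Y) (c : T ≅ Z) :
      (a.hom ≫ 𝟙 Y ≫ b.inv ≫ c.inv) ≫ c.hom ≫ b.hom = a.hom := by simp
  rw [this]
  exact aux (pullQIso R (γ ⋙ δ) K) (pullQIso R γ ((pullCx R δ).obj K))
    ((pull R γ).mapIso (pullQIso R δ K))

lemma natTrans_ext_Q {A : Type u₁} [Category.{v₁} A] [Abelian A] [HasDerivedCategory.{v₃} A]
    {ℰ : Type u₂} [Category.{v₂} ℰ] {Φ Ψ : DerivedCategory A ⥤ ℰ} {f g : Φ ⟶ Ψ}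
    (h : ∀ K, f.app (Q.obj K) = g.app (Q.obj K)) : f = g :=
  Localization.natTrans_ext Q (HomologicalComplex.quasiIso A (.up ℤ)) h

lemma pullMap_id (γ : C ⥤ C') : pullMap R (𝟙 γ) = 𝟙 _ :=
  natTrans_ext_Q fun K => by
    have := pullMap_app_Q R (𝟙 γ) K
    rw [pullCxMap, CategoryTheory.Functor.map_id, NatTrans.mapHomologicalComplex_id] at this
    rw [← cancel_mono (pullQIso R γ K).hom, this, NatTrans.id_app, NatTrans.id_app,
      CategoryTheory.Functor.map_id, Category.id_comp, Category.comp_id]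

lemma pullMap_comp {γ γ' γ'' : C ⥤ C'} (α : γ ⟶ γ') (β : γ' ⟶ γ'') :
    pullMap R (α ≫ β) = pullMap R α ≫ pullMap R β :=
  natTrans_ext_Q fun K => by
    have := pullMap_app_Q R (α ≫ β) K
    rw [pullCxMap, CategoryTheory.Functor.map_comp, NatTrans.mapHomologicalComplex_comp] at this
    rw [← cancel_mono (pullQIso R γ'' K).hom, this, NatTrans.comp_app, NatTrans.comp_app,
      Functor.map_comp, Category.assoc, pullMap_app_Q, ← Category.assoc, ← Category.assoc,
      pullMap_app_Q]

instance isIso_pullMap {γ γ' : C ⥤ C'} (α : γ ⟶ γ') [IsIso α] : IsIso (pullMap R α) :=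
  ⟨pullMap R (inv α), by rw [← pullMap_comp, IsIso.hom_inv_id, pullMap_id],
    by rw [← pullMap_comp, IsIso.inv_hom_id, pullMap_id]⟩

/-- Isomorphic functors have isomorphic pullback functors. -/
def pullIso {γ γ' : C ⥤ C'} (α : γ ≅ γ') : pull R γ ≅ pull R γ' := asIso (pullMap R α.hom)

/-- The free module functor on a functor to sets, placed in degree `n`. -/
abbrev freeQ (n : ℤ) : (C ⥤ Type u) ⥤ DFun R C := freeFun R ⋙ singleQ n

variable {R}

/-- The pullback of a complex concentrated in one degree. -/
abbrev pullSingle (γ : C ⥤ C') (n : ℤ) (M : C' ⥤ ModuleCat.{u} R) :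
    (pullCx R γ).obj ((HomologicalComplex.single _ (.up ℤ) n).obj M) ≅
      (HomologicalComplex.single _ (.up ℤ) n).obj (γ ⋙ M) :=
  (HomologicalComplex.singleMapHomologicalComplex (precomp R γ) (.up ℤ) n).app M

/-- The pullback of a free module functor. -/
def pullFree (γ : C ⥤ C') (n : ℤ) (V : C' ⥤ Type u) :
    (pull R γ).obj ((freeQ R n).obj V) ≅ (freeQ R n).obj (γ ⋙ V) :=
  pullQIso R γ _ ≪≫ Q.mapIso (pullSingle γ n ((freeFun R).obj V))

lemma pullFree_naturality (γ : C ⥤ C') (n : ℤ) {V W : C' ⥤ Type u} (f : V ⟶ W) :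
    (pull R γ).map ((freeQ R n).map f) ≫ (pullFree γ n W).hom =
      (pullFree γ n V).hom ≫ (freeQ R n).map (Functor.whiskerLeft γ f) :=
  (singleQIso (precomp R γ) n).hom.naturality ((freeFun R).map f)

lemma singleMap_natTrans {A : Type u₁} [Category.{v₁} A] [Abelian A]
    {B : Type u₂} [Category.{v₂} B] [Abelian B] {F F' : B ⥤ A} [F.Additive] [F'.Additive]
    (α : F ⟶ F') (n : ℤ) (M : B) :
    (NatTrans.mapHomologicalComplex α (.up ℤ)).app ((HomologicalComplex.single B (.up ℤ) n).obj M) ≫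
      (HomologicalComplex.singleMapHomologicalComplex F' (.up ℤ) n).hom.app M =
    (HomologicalComplex.singleMapHomologicalComplex F (.up ℤ) n).hom.app M ≫
      (HomologicalComplex.single A (.up ℤ) n).map (α.app M) := by
  ext i
  by_cases h : i = n
  · subst h
    rw [HomologicalComplex.comp_f, HomologicalComplex.comp_f]
    erw [HomologicalComplex.singleMapHomologicalComplex_hom_app_self,
      HomologicalComplex.singleMapHomologicalComplex_hom_app_self]
    rw [HomologicalComplex.single_map_f_self]
    change α.app _ ≫ F'.map _ ≫ _ = (F.map _ ≫ _) ≫ _ ≫ _ ≫ _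
    rw [← NatTrans.naturality_assoc, Category.assoc]
    erw [Iso.inv_hom_id_assoc]
  · exact (F.map_isZero (HomologicalComplex.isZero_single_obj_X (.up ℤ) n M i h)).eq_of_src _ _

lemma pullFree_pullMap {γ γ' : C ⥤ C'} (α : γ ⟶ γ') (n : ℤ) (V : C' ⥤ Type u) :
    (pullMap R α).app ((freeQ R n).obj V) ≫ (pullFree γ' n V).hom =
      (pullFree γ n V).hom ≫ (freeQ R n).map (Functor.whiskerRight α V) := by
  have h₁ := pullMap_app_Q R α ((HomologicalComplex.single _ (.up ℤ) n).obj ((freeFun R).obj V))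
  have h₂ := congrArg (fun t => Q.map t) (singleMap_natTrans
    ((Functor.whiskeringLeft C C' (ModuleCat.{u} R)).map α) n ((freeFun R).obj V))
  rw [Q.map_comp, Q.map_comp] at h₂
  exact comp_square_square h₁ h₂

lemma singleMap_pullComp (γ : C ⥤ C') (δ : C' ⥤ C'') (n : ℤ) (M : C'' ⥤ ModuleCat.{u} R) :
    (pullCx R γ).map (pullSingle δ n M).hom ≫ (pullSingle γ n (δ ⋙ M)).hom =
      (pullSingle (γ ⋙ δ) n M).hom := by
  refine HomologicalComplex.hom_ext _ _ fun i => ?_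
  by_cases h : i = n
  · subst h
    rw [HomologicalComplex.comp_f]
    dsimp only [pullSingle, Iso.app_hom]
    erw [HomologicalComplex.singleMapHomologicalComplex_hom_app_self,
      HomologicalComplex.singleMapHomologicalComplex_hom_app_self]
    change (precomp R γ).map (HomologicalComplex.Hom.f
      ((HomologicalComplex.singleMapHomologicalComplex (precomp R δ) (.up ℤ) i).hom.app M) i) ≫ _ = _
    rw [HomologicalComplex.singleMapHomologicalComplex_hom_app_self]
    exact map_comp_inv_map_hom (precomp R γ) _
      (HomologicalComplex.singleObjXSelf (.up ℤ) i (δ ⋙ M)) _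
  · exact ((precomp R γ ).map_isZero ((precomp R δ).map_isZero
      (HomologicalComplex.isZero_single_obj_X (.up ℤ) n M i h))).eq_of_src _ _

lemma pullFree_pullComp (γ : C ⥤ C') (δ : C' ⥤ C'') (n : ℤ) (V : C'' ⥤ Type u) :
    (pullComp R γ δ).hom.app ((freeQ R n).obj V) ≫ (pull R γ).map (pullFree δ n V).hom ≫
      (pullFree γ n (δ ⋙ V)).hom = (pullFree (γ ⋙ δ) n V).hom := by
  have h₁ := pullComp_hom_app_Q R γ δ
    ((HomologicalComplex.single _ (.up ℤ) n).obj ((freeFun R).obj V))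
  have h₂ := congrArg (fun t => Q.map t) (singleMap_pullComp γ δ n ((freeFun R).obj V))
  rw [Q.map_comp] at h₂
  exact comp_map_comp_square (pull R γ) (pullQIso_naturality R γ (pullSingle δ n _).hom) h₁ h₂

end PullCalculus

/-! ### Adjunctions between pullback functors -/

section PullAdjunction

open DerivedCategory Limits

/-- An adjunction between exact functors induces an adjunction between the functors on derived
categories. -/
def CategoryTheory.Adjunction.mapDerivedCategory {A : Type u₁} [Category.{v₁} A] [Abelian A]
    {B : Type u₂} [Category.{v₂} B] [Abelian B] [HasDerivedCategory A] [HasDerivedCategory B]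
    {L : A ⥤ B} {F : B ⥤ A} [L.Additive] [F.Additive] [PreservesFiniteLimits L]
    [PreservesFiniteColimits L] [PreservesFiniteLimits F] [PreservesFiniteColimits F]
    (adj : L ⊣ F) : L.mapDerivedCategory ⊣ F.mapDerivedCategory :=
  letI : CatCommSq (L.mapHomologicalComplex (.up ℤ)) Q Q L.mapDerivedCategory :=
    ⟨L.mapDerivedCategoryFactors.symm⟩
  letI : CatCommSq (F.mapHomologicalComplex (.up ℤ)) Q Q F.mapDerivedCategory :=
    ⟨F.mapDerivedCategoryFactors.symm⟩
  adj.mapComplex.localization Q (HomologicalComplex.quasiIso A (.up ℤ)) Q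
    (HomologicalComplex.quasiIso B (.up ℤ)) L.mapDerivedCategory F.mapDerivedCategory

variable (R : Type u) [Ring R] {C : Type u₁} [Category.{v₁} C] {C' : Type u₂} [Category.{v₂} C']

/-- The pullback functors along adjoint functors are adjoint. -/
def pullAdj {γ : C ⥤ C'} {δ : C' ⥤ C} (adj : γ ⊣ δ) : pull R δ ⊣ pull R γ :=
  (adj.whiskerLeft (ModuleCat.{u} R)).mapDerivedCategory

/-- The pullback functor along a right adjoint functor with fully faithful left adjoint is fully
faithful. -/
def pullFullyFaithful {γ : C ⥤ C'} {δ : C' ⥤ C} (adj : γ ⊣ δ) (e : γ ⋙ δ ≅ 𝟭 C) :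
    (pull R δ).FullyFaithful :=
  have := (pullAdj R adj).isIso_unit_of_iso ((pullComp R γ δ).symm ≪≫ pullIso R e ≪≫ pullId R C)
  (pullAdj R adj).fullyFaithfulLOfIsIsoUnit

end PullAdjunction

/-! ### Reflections -/

section Reflection

variable {𝒟 : Type u₁} [Category.{v₁} 𝒟] {ℰ : Type u₂} [Category.{v₂} ℰ] {Ψ : ℰ ⥤ 𝒟}

/-- The pair of `Y` and `v : X ⟶ Ψ.obj Y` is initial among all such pairs. -/
def IsReflection (Ψ : ℰ ⥤ 𝒟) {X : 𝒟} {Y : ℰ} (v : X ⟶ Ψ.obj Y) : Prop :=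
  ∀ Z : ℰ, Function.Bijective (fun g : Y ⟶ Z => v ≫ Ψ.map g)

lemma IsReflection.isIso_homEquiv_symm {Φ : 𝒟 ⥤ ℰ} (adj : Φ ⊣ Ψ) {X : 𝒟} {Y : ℰ}
    {v : X ⟶ Ψ.obj Y} (hv : IsReflection Ψ v) : IsIso ((adj.homEquiv X Y).symm v) := by
  refine isIso_of_coyoneda_map_bijective _ fun Z => ?_
  have : (fun g : Y ⟶ Z => (adj.homEquiv X Y).symm v ≫ g) =
      (adj.homEquiv X Z).symm ∘ (fun g => v ≫ Ψ.map g) := funext fun g =>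
    (Adjunction.homEquiv_naturality_right_symm _ _ _).symm
  exact this ▸ (adj.homEquiv X Z).symm.bijective.comp (hv Z)

lemma IsReflection.precomp_iso {X X' : 𝒟} {Y : ℰ} {v : X ⟶ Ψ.obj Y} (hv : IsReflection Ψ v)
    (e : X' ≅ X) : IsReflection Ψ (e.hom ≫ v) := fun Z => by
  have : (fun g : Y ⟶ Z => (e.hom ≫ v) ≫ Ψ.map g) =
      e.symm.homFromEquiv ∘ (fun g => v ≫ Ψ.map g) := funext fun g => Category.assoc _ _ _
  exact this ▸ e.symm.homFromEquiv.bijective.comp (hv Z)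

lemma IsReflection.of_comp_iso {X : 𝒟} {Y Y' : ℰ} {v : X ⟶ Ψ.obj Y} (e : Y ≅ Y')
    (h : IsReflection Ψ (v ≫ Ψ.map e.hom)) : IsReflection Ψ v := fun Z => by
  have : (fun g : Y ⟶ Z => v ≫ Ψ.map g) =
      (fun g => (v ≫ Ψ.map e.hom) ≫ Ψ.map g) ∘ e.homFromEquiv := funext fun g => by
    dsimp [Iso.homFromEquiv]
    rw [Category.assoc, ← Functor.map_comp, e.hom_inv_id_assoc]
  exact this ▸ (h Z).comp e.homFromEquiv.bijective

lemma map_comp_inv_comp {𝒟' : Type u₃} [Category.{v₃} 𝒟'] (F : 𝒟 ⥤ 𝒟') {X Y Z : 𝒟} {f : X ⟶ Y}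
    {c : Z ≅ Y} {K L M M' : 𝒟'} {s : F.obj Z ⟶ L} {b : L ≅ M} {d : F.obj Y ⟶ M'}
    {w : M' ⟶ M} {k : F.obj X ⟶ K} {t : K ⟶ M'} {t' : K ⟶ M}
    (h₁ : s ≫ b.hom = F.map c.hom ≫ d ≫ w) (h₂ : F.map f ≫ d = k ≫ t) (h₃ : t ≫ w = t') :
    F.map (f ≫ c.inv) ≫ s = k ≫ t' ≫ b.inv := by
  rw [← cancel_mono b.hom, Category.assoc, h₁, ← Functor.map_comp_assoc, Category.assoc,
    c.inv_hom_id, Category.comp_id, reassoc_of% h₂, h₃]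
  simp

lemma CategoryTheory.Adjunction.isIso_map_iff_bijective {Φ : 𝒟 ⥤ ℰ} (adj : Φ ⊣ Ψ) {X X' : 𝒟} (f : X ⟶ X') :
    IsIso (Φ.map f) ↔ ∀ Z, Function.Bijective (fun g : X' ⟶ Ψ.obj Z => f ≫ g) := by
  rw [isIso_iff_coyoneda_map_bijective]
  refine forall_congr' fun Z => ?_
  have : (fun g : Φ.obj X' ⟶ Z => Φ.map f ≫ g) =
      (adj.homEquiv X Z).symm ∘ (fun g => f ≫ g) ∘ adj.homEquiv X' Z := funext fun g => by
    dsimp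
    rw [Adjunction.homEquiv_naturality_left_symm, Equiv.symm_apply_apply]
  rw [this, Equiv.comp_bijective, Equiv.bijective_comp]

lemma IsReflection.homEquiv_unit {Φ : 𝒟 ⥤ ℰ} (adj : Φ ⊣ Ψ) {X : 𝒟} {Y : ℰ}
    {v : X ⟶ Ψ.obj Y} (hv : IsReflection Ψ v) :
    ∃ b : Φ.obj X ≅ Y, v = adj.unit.app X ≫ Ψ.map b.hom := by
  have := hv.isIso_homEquiv_symm adj
  refine ⟨asIso ((adj.homEquiv X Y).symm v), ?_⟩
  exact ((adj.homEquiv X Y).apply_symm_apply v).symm.trans (adj.homEquiv_unit _ _ _)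

end Reflection

section FreeReflection

variable {R : Type u} [Ring R] {C : Type u₁} [Category.{v₁} C] {C' : Type u₂} [Category.{v₂} C']

/-- A map between freely generated functors that matches the generators induces a reflection for
the pullback functor. -/
lemma isReflection_freeQ {γ : C ⥤ C'} {V : C ⥤ Type u} {V' : C' ⥤ Type u} {ι : Type u} {c : ι → C}
    {x : ∀ a, V.obj (c a)} (hV : IsFreelyGenerated V c x) (α : V ⟶ γ ⋙ V')
    (hV' : IsFreelyGenerated V' (fun a => γ.obj (c a)) (fun a => α.app (c a) (x a))) (n : ℤ) :
    IsReflection (pull R γ) ((freeQ R n).map α ≫ (pullFree γ n V').inv) := by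
  have := hV.projective (R := R)
  have := hV'.projective (R := R)
  refine fun Z => bijective_of_universal (precomp R γ)
    (P := (freeFun R).obj V) (P' := (freeFun R).obj V') ((freeFun R).map α) (fun M => ?_) n Z
  refine ((hV.bijective (γ ⋙ M)).of_comp_iff' _).1 ?_
  refine (congrArg Function.Bijective (funext fun g => funext fun a => ?_)).mpr (hV'.bijective M)
  dsimp
  rw [ModuleCat.free_map_apply]

end FreeReflection

/-! ### Base change -/

section BaseChange

variable {R : Type u} [Ring R] {I : Type u₁} [Category.{v₁} I] {C : Type u₂} [Category.{v₂} C]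

/-- The restriction of the projection to a slice of the product is constant. -/
def slice (I : Type u₁) [Category.{v₁} I] (S : C) :
    Prod.sectL I S ⋙ CategoryTheory.Prod.snd I C ≅ toPt I ⋙ atPt S :=
  NatIso.ofComponents fun _ => Iso.refl _

/-- The comparison of the two pullback functors along the constant functor on a slice. -/
def sliceTrans (R : Type u) [Ring R] (I : Type u₁) [Category.{v₁} I] (S : C) :
    pull R (CategoryTheory.Prod.snd I C) ⋙ pull R (Prod.sectL I S) ⟶
      pull R (atPt S) ⋙ pull R (toPt I) :=
  (pullComp R (Prod.sectL I S) (CategoryTheory.Prod.snd I C)).inv ≫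
    pullMap R (slice I S).hom ≫ (pullComp R (toPt I) (atPt S)).hom

lemma sliceTrans_app_freeQ (S : C) (n : ℤ) (V : C ⥤ Type u) :
    (sliceTrans R I S).app ((freeQ R n).obj V) ≫
      (pull R (toPt I)).map (pullFree (atPt S) n V).hom ≫
        (pullFree (toPt I) n (atPt S ⋙ V)).hom =
    (pull R (Prod.sectL I S)).map (pullFree (CategoryTheory.Prod.snd I C) n V).hom ≫
      (pullFree (Prod.sectL I S) n (CategoryTheory.Prod.snd I C ⋙ V)).hom ≫
        (freeQ R n).map (Functor.whiskerRight (slice I S).hom V) := by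
  have h₁ := pullFree_pullComp (R := R) (toPt I) (atPt S) n V
  have h₂ := pullFree_pullComp (R := R) (Prod.sectL I S) (CategoryTheory.Prod.snd I C) n V
  have h₃ := pullFree_pullMap (R := R) (slice I S).hom n V
  rw [← h₂, ← h₁] at h₃
  rw [← cancel_epi ((pullComp R (Prod.sectL I S) (CategoryTheory.Prod.snd I C)).hom.app _)]
  simp only [Category.assoc] at h₃
  refine Eq.trans ?_ h₃
  simp only [sliceTrans, NatTrans.comp_app, Category.assoc, Iso.hom_inv_id_app_assoc]

variable (P : DerivedLan R (CategoryTheory.Prod.snd I C)) (T : DerivedLan R (toPt I)) (S : C)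

/-- The restriction to a slice of the unit of the adjunction for the projection. -/
def sliceUnit : pull R (Prod.sectL I S) ⟶ (P.functor ⋙ pull R (atPt S)) ⋙ pull R (toPt I) :=
  Functor.whiskerRight P.adj.unit (pull R (Prod.sectL I S)) ≫
    Functor.whiskerLeft P.functor (sliceTrans R I S)

/-- The base change map for the derived colimit along the projection of a product. -/
def baseChange : pull R (Prod.sectL I S) ⋙ T.functor ⟶ P.functor ⋙ pull R (atPt S) :=
  Functor.whiskerRight (sliceUnit P S) T.functor ≫
    Functor.whiskerLeft (P.functor ⋙ pull R (atPt S)) T.adj.counit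

lemma baseChange_app (E : DFun R (I × C)) : (baseChange P T S).app E =
    (T.adj.homEquiv _ _).symm ((sliceUnit P S).app E) :=
  (T.adj.homEquiv_counit _ _ _).symm

lemma sliceUnit_comp {E : DFun R (I × C)} {E' : DFun R C} (b : P.functor.obj E ⟶ E') :
    (sliceUnit P S).app E ≫ (pull R (toPt I)).map ((pull R (atPt S)).map b) =
      (pull R (Prod.sectL I S)).map (P.adj.unit.app E ≫ (pull R (CategoryTheory.Prod.snd I C)).map b) ≫
        (sliceTrans R I S).app E' := by
  have := (sliceTrans R I S).naturality b
  dsimp at this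
  simp only [sliceUnit, NatTrans.comp_app, Functor.whiskerRight_app, Functor.whiskerLeft_app,
    Functor.map_comp, Category.assoc]
  rw [this]

/-- A reflection computes the Kan extension of `E` as `E'`. If its restriction to the slice is again
a reflection, then both sides of base change are identified with the value of `E'` at `S`. -/
lemma isIso_baseChange_app {E : DFun R (I × C)} {E' : DFun R C}
    {β : E ⟶ (pull R (CategoryTheory.Prod.snd I C)).obj E'}
    (hβ : IsReflection (pull R (CategoryTheory.Prod.snd I C)) β)
    (h : IsReflection (pull R (toPt I)) (Y := (pull R (atPt S)).obj E')
      ((pull R (Prod.sectL I S)).map β ≫ (sliceTrans R I S).app E')) :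
    IsIso ((baseChange P T S).app E) := by
  obtain ⟨b, rfl⟩ := hβ.homEquiv_unit P.adj
  rw [← sliceUnit_comp] at h
  have := h.isIso_homEquiv_symm T.adj
  rw [Adjunction.homEquiv_naturality_right_symm, ← baseChange_app] at this
  exact IsIso.of_isIso_comp_right _ ((pull R (atPt S)).map b.hom)

end BaseChange

section BaseChangeIso

variable {R : Type u} [Ring R] {I : Type u₁} [Category.{v₁} I] {C : Type u₂} [Category.{v₂} C]

instance essentiallySmall_prod [EssentiallySmall.{u} I] [EssentiallySmall.{u} C] :
    EssentiallySmall.{u} (I × C) :=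
  .mk' ((equivSmallModel.{u} I).prod (equivSmallModel.{u} C))

instance essentiallySmall_pt : EssentiallySmall.{u} Pt :=
  .mk' (Discrete.equivalence Equiv.punitEquivPUnit : Pt ≌ Discrete PUnit.{u + 1})

section

variable {C : Type u₁} [Category.{v₁} C] [LocallySmall.{u} C]

/-- The element of the corepresentable functor that corresponds to a morphism. -/
def corepEquiv (c d : C) : (c ⟶ d) ≃ (corep.{v₁, u₁, u} c).obj d := equivShrink (c ⟶ d)

lemma corep_map_corepEquiv {c d e : C} (f : c ⟶ d) (g : d ⟶ e) :
    (corep.{v₁, u₁, u} c).map g (corepEquiv c d f) = corepEquiv c e (f ≫ g) :=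
  congrArg (fun t => equivShrink (c ⟶ e) (t ≫ g)) (Equiv.symm_apply_apply (equivShrink (c ⟶ d)) f)

lemma isFreelyGenerated_const {I : Type u₂} [Category.{v₂} I] (i : I) (d : C) (S : C) :
    IsFreelyGenerated (atPt S ⋙ corep.{v₁, u₁, u} d)
      (ι := (corep.{v₁, u₁, u} d).obj S) (fun _ => (toPt I).obj i) (fun f => f) := fun j y => by
  have key (f : (corep.{v₁, u₁, u} d).obj S) (g : (toPt I).obj i ⟶ j) :
      (atPt S ⋙ corep.{v₁, u₁, u} d).map g f = f :=
    Functor.map_id_apply (corep.{v₁, u₁, u} d) S f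
  refine ⟨⟨y, eqToHom (Subsingleton.elim _ _)⟩, key _ _, ?_⟩
  rintro ⟨f', g'⟩ h
  obtain rfl := (key f' g').symm.trans h
  exact congrArg (Sigma.mk _) (Subsingleton.elim _ _)

end

section

variable [LocallySmall.{u} C] [LocallySmall.{u} (I × C)]

/-- The projection from the functor corepresented by an object of a product. -/
def corepSnd (i : I) (d : C) :
    corep.{max v₁ v₂, max u₁ u₂, u} (i, d) ⟶ CategoryTheory.Prod.snd I C ⋙ corep.{v₂, u₂, u} d where
  app q := TypeCat.ofHom fun p => corepEquiv d q.2 ((corepEquiv (i, d) q).symm p).2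
  naturality q q' f := by
    ext p
    obtain ⟨p, rfl⟩ := (corepEquiv (i, d) q).surjective p
    change corepEquiv d q'.2 ((corepEquiv (i, d) q').symm
      ((corep.{max v₁ v₂, max u₁ u₂, u} (i, d)).map f (corepEquiv (i, d) q p))).2 =
      (corep.{v₂, u₂, u} d).map f.2
        (corepEquiv d q.2 ((corepEquiv (i, d) q).symm (corepEquiv (i, d) q p)).2)
    rw [corep_map_corepEquiv, Equiv.symm_apply_apply, Equiv.symm_apply_apply, corep_map_corepEquiv]
    rfl

lemma corepSnd_app (i : I) (d : C) (q : I × C) (p : (i, d) ⟶ q) :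
    (corepSnd i d).app q (corepEquiv (i, d) q p) = corepEquiv d q.2 p.2 :=
  congrArg (fun t : (i, d) ⟶ q => corepEquiv d q.2 t.2) (Equiv.symm_apply_apply _ p)

/-- The left Kan extension along the projection sends the functor corepresented by `(i, d)` to the
one corepresented by `d`. -/
lemma isReflection_corepSnd (i : I) (d : C) (n : ℤ) :
    IsReflection (pull R (CategoryTheory.Prod.snd I C))
      ((freeQ R n).map (corepSnd i d) ≫ (pullFree _ n (corep.{v₂, u₂, u} d)).inv) := by
  refine isReflection_freeQ (isFreelyGenerated_corep (i, d)) _ ?_ n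
  have : (fun _ : PUnit.{u + 1} => (corepSnd i d).app (i, d) (corepId (i, d))) =
      fun _ => corepId.{v₂, u₂, u} d := funext fun _ => corepSnd_app i d (i, d) (𝟙 _)
  exact this ▸ isFreelyGenerated_corep d

/-- Restricted to the slice over `S`, the functor corepresented by `(i, d)` is a disjoint union of
copies of the functor corepresented by `i`, one for each map `d ⟶ S`. -/
lemma isFreelyGenerated_slice (i : I) (d : C) (S : C) :
    IsFreelyGenerated (Prod.sectL I S ⋙ corep.{max v₁ v₂, max u₁ u₂, u} (i, d))
      (ι := (corep.{v₂, u₂, u} d).obj S) (fun _ => i) (fun f => corepEquiv (i, d) (i, S)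
        (𝟙 i, (corepEquiv d S).symm f)) := fun j y => by
  obtain ⟨⟨g, f⟩, rfl⟩ := (corepEquiv (i, d) (j, S)).surjective y
  have key (f : (corep.{v₂, u₂, u} d).obj S) (g : i ⟶ j) :
      (Prod.sectL I S ⋙ corep.{max v₁ v₂, max u₁ u₂, u} (i, d)).map g
        (corepEquiv (i, d) (i, S) (𝟙 i, (corepEquiv d S).symm f)) =
      corepEquiv (i, d) (j, S) (g, (corepEquiv d S).symm f) := by
    refine (corep_map_corepEquiv _ _).trans (congrArg _ ?_)
    exact Prod.ext (Category.id_comp _) (Category.comp_id _)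
  refine ⟨⟨corepEquiv d S f, g⟩, (key _ _).trans ?_, ?_⟩
  · dsimp only
    rw [Equiv.symm_apply_apply]
  · rintro ⟨f', g'⟩ h
    have h := (corepEquiv (i, d) (j, S)).injective ((key f' g').symm.trans h)
    obtain ⟨rfl, rfl⟩ := Prod.ext_iff.1 h
    dsimp only
    rw [Equiv.apply_symm_apply]

/-- The restriction to a slice of the projection `corepSnd`. -/
def sliceCorepSnd (i : I) (d : C) (S : C) :
    Prod.sectL I S ⋙ corep.{max v₁ v₂, max u₁ u₂, u} (i, d) ⟶
      toPt I ⋙ atPt S ⋙ corep.{v₂, u₂, u} d :=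
  Functor.whiskerLeft (Prod.sectL I S) (corepSnd i d) ≫
    Functor.whiskerRight (slice I S).hom (corep.{v₂, u₂, u} d)

lemma sliceCorepSnd_app (i : I) (d : C) (S : C) (f : (corep.{v₂, u₂, u} d).obj S) :
    (sliceCorepSnd i d S).app i (corepEquiv (i, d) (i, S) (𝟙 i, (corepEquiv d S).symm f)) = f := by
  have h₁ : (corep.{v₂, u₂, u} d).map (𝟙 S) ((corepSnd i d).app (i, S)
      (corepEquiv (i, d) (i, S) (𝟙 i, (corepEquiv d S).symm f))) = f := by
    rw [corepSnd_app, Functor.map_id_apply]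
    exact Equiv.apply_symm_apply _ _
  exact h₁

lemma isReflection_sliceCorepSnd (i : I) (d : C) (S : C) (n : ℤ) :
    IsReflection (pull R (toPt I)) ((freeQ R n).map (sliceCorepSnd i d S) ≫
        (pullFree (toPt I) n (atPt S ⋙ corep.{v₂, u₂, u} d)).inv) := by
  refine isReflection_freeQ (isFreelyGenerated_slice i d S) (sliceCorepSnd i d S) ?_ n
  have : (fun f : (corep.{v₂, u₂, u} d).obj S => (sliceCorepSnd i d S).app i
        (corepEquiv (i, d) (i, S) (𝟙 i, (corepEquiv d S).symm f))) = fun f => f :=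
    funext fun f => sliceCorepSnd_app i d S f
  exact this ▸ isFreelyGenerated_const i d S

end

variable [EssentiallySmall.{u} I] [EssentiallySmall.{u} C]
  (P : DerivedLan R (CategoryTheory.Prod.snd I C)) (T : DerivedLan R (toPt I)) (S : C)

/-- On corepresentable functors both sides are free on `Hom(d, S)`: on the left as the derived
colimit of copies of `Hom(i, -)`, on the right as the value at `S` of `Hom(d, -)`. -/
instance isIso_baseChange : IsIso (baseChange P T S) := by
  refine HasBoundedBelowCoreflections.isIso ?_ ?_ _
    (isSeparating_corep_self.{max v₁ v₂, max u₁ u₂, u} (R := R) (C := I × C)) fun q n => ?_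
  · exact (HasBoundedBelowCoreflections.id.comp_pull (Prod.sectL I S)).comp_derivedLan T
  · exact (HasBoundedBelowCoreflections.id.comp_derivedLan P).comp_pull (atPt S)
  · refine isIso_baseChange_app P T S (isReflection_corepSnd q.1 q.2 n) ?_
    have h := (isReflection_sliceCorepSnd q.1 q.2 S n).precomp_iso
      (pullFree (R := R) (Prod.sectL I S) n (corep.{max v₁ v₂, max u₁ u₂, u} q))
    refine IsReflection.of_comp_iso (pullFree (R := R) (atPt S) n (corep.{v₂, u₂, u} q.2)) ?_
    rw [Category.assoc]
    have h₁ := sliceTrans_app_freeQ (R := R) (I := I) S n (corep.{v₂, u₂, u} q.2)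
    have h₂ := pullFree_naturality (R := R) (Prod.sectL I S) n (corepSnd q.1 q.2)
    have h₃ := ((freeQ R n).map_comp (Functor.whiskerLeft (Prod.sectL I S) (corepSnd q.1 q.2))
      (Functor.whiskerRight (slice I S).hom (corep.{v₂, u₂, u} q.2))).symm
    rw [← Category.assoc] at h₁
    have := map_comp_inv_comp (pull R (Prod.sectL I S)) h₁ h₂ h₃
    exact this ▸ h

end BaseChangeIso

/-! ### Pointwise detection of isomorphisms -/

section Pointwise

variable {R : Type u} [Ring R] {C : Type u₁} [Category.{v₁} C] [EssentiallySmall.{u} C]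

/-- Evaluation at `c` is corepresented by `Hom(c, -)`, also on the derived level. Hence values at
all objects together detect isomorphisms. -/
lemma isReflection_atPt (c : C) (n : ℤ) : ∃ (V : Pt ⥤ Type u)
    (v : (freeQ R n).obj V ⟶ (pull R (atPt c)).obj ((freeQ R n).obj (corep.{v₁, u₁, u} c))),
      IsReflection (pull R (atPt c)) v := by
  let V : Pt ⥤ Type u := corep.{0, 0, u} (⟨⟨⟩⟩ : Pt)
  have hV : IsFreelyGenerated V (ι := PUnit.{u + 1}) (fun _ => (⟨⟨⟩⟩ : Pt))
    (fun _ => corepId.{0, 0, u} (⟨⟨⟩⟩ : Pt)) :=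
    isFreelyGenerated_corep.{0, 0, u} (⟨⟨⟩⟩ : Pt)
  let α : V ⟶ atPt c ⋙ corep.{v₁, u₁, u} c :=
    { app _ := TypeCat.ofHom fun _ => corepId c
      naturality _ _ _ := by
        ext
        exact (Functor.map_id_apply (corep.{v₁, u₁, u} c) c _).symm }
  exact ⟨V, _, isReflection_freeQ hV α (isFreelyGenerated_corep c) n⟩

lemma isIso_of_isIso_pull_atPt {E E' : DFun R C} (f : E ⟶ E')
    (h : ∀ c, IsIso ((pull R (atPt c)).map f)) : IsIso f := by
  refine isIso_of_bijective_singleQ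
    (isSeparating_corep_self.{v₁, u₁, u} (R := R) (C := C)) f fun c n => ?_
  obtain ⟨V, v, hv⟩ := isReflection_atPt (R := R) c n
  refine ((hv E').of_comp_iff' _).1 ?_
  convert (asIso ((pull R (atPt c)).map f)).homToEquiv.bijective.comp (hv E) using 1
  funext g
  exact (congrArg (v ≫ ·) ((pull R (atPt c)).map_comp g f)).trans (Category.assoc _ _ _).symm

end Pointwise

/-! ### Morphisms inducing isomorphisms on derived colimits -/

section HEquiv

variable {R : Type u} [Ring R] {I : Type u₁} [Category.{v₁} I]

/-- The morphism `f` induces an isomorphism on derived colimits. -/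
def IsHEquiv {E E' : DFun R I} (f : E ⟶ E') : Prop :=
  ∀ Z : DFun R Pt, Function.Bijective (fun g : E' ⟶ (pull R (toPt I)).obj Z => f ≫ g)

lemma isHEquiv_iff (T : DerivedLan R (toPt I)) {E E' : DFun R I} (f : E ⟶ E') :
    IsHEquiv f ↔ IsIso (T.functor.map f) :=
  (T.adj.isIso_map_iff_bijective f).symm

lemma isHEquiv_of_isIso {E E' : DFun R I} (f : E ⟶ E') [IsIso f] : IsHEquiv f := fun _ =>
  (asIso f).symm.homFromEquiv.bijective

lemma IsHEquiv.comp {E E' E'' : DFun R I} {f : E ⟶ E'} {f' : E' ⟶ E''} (hf : IsHEquiv f)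
    (hf' : IsHEquiv f') : IsHEquiv (f ≫ f') := fun Z => by
  convert (hf Z).comp (hf' Z) using 1
  funext g
  exact Category.assoc _ _ _

lemma IsHEquiv.of_comp_right {E E' E'' : DFun R I} {f : E ⟶ E'} {f' : E' ⟶ E''}
    (hf : IsHEquiv f) (h : IsHEquiv (f ≫ f')) : IsHEquiv f' := fun Z => by
  refine ((hf Z).of_comp_iff' _).1 ?_
  convert h Z using 1
  funext g
  exact (Category.assoc _ _ _).symm

lemma IsHEquiv.of_comp_left {E E' E'' : DFun R I} {f : E ⟶ E'} {f' : E' ⟶ E''}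
    (hf' : IsHEquiv f') (h : IsHEquiv (f ≫ f')) : IsHEquiv f := fun Z => by
  refine (Function.Bijective.of_comp_iff _ (hf' Z)).1 ?_
  convert h Z using 1
  funext g
  exact (Category.assoc _ _ _).symm

lemma IsHEquiv.of_square {E₁ E₁' E₂ E₂' : DFun R I} {f₁ : E₁ ⟶ E₁'} {f₂ : E₂ ⟶ E₂'}
    {e : E₁ ⟶ E₂} {e' : E₁' ⟶ E₂'} (he : IsHEquiv e) (he' : IsHEquiv e')
    (h : f₁ ≫ e' = e ≫ f₂) (h₁ : IsHEquiv f₁) : IsHEquiv f₂ :=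
  he.of_comp_right (h ▸ h₁.comp he')

lemma IsHEquiv.of_square' {E₁ E₁' E₂ E₂' : DFun R I} {f₁ : E₁ ⟶ E₁'} {f₂ : E₂ ⟶ E₂'}
    {e : E₁ ⟶ E₂} {e' : E₁' ⟶ E₂'} (he : IsHEquiv e) (he' : IsHEquiv e')
    (h : f₁ ≫ e' = e ≫ f₂) (h₂ : IsHEquiv f₂) : IsHEquiv f₁ :=
  he'.of_comp_left (h ▸ he.comp h₂)

lemma bijective_comp_congr {𝒞 : Type u₁} [Category.{v₁} 𝒞] {X X' Y Y' : 𝒞} (f : X ⟶ X')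
    (e : Y ≅ Y') : Function.Bijective (fun g : X' ⟶ Y => f ≫ g) ↔
      Function.Bijective (fun g : X' ⟶ Y' => f ≫ g) := by
  have : (fun g : X' ⟶ Y' => f ≫ g) ∘ e.homToEquiv = e.homToEquiv ∘ (fun g : X' ⟶ Y => f ≫ g) :=
    funext fun g => (Category.assoc _ _ _).symm
  rw [← Equiv.bijective_comp e.homToEquiv, this, Equiv.comp_bijective]

variable {J : Type u₂} [Category.{v₂} J]

/-- Derived colimits are invariant under restriction to a final subcategory, for a right adjoint
functor. -/
lemma isHEquiv_pull_iff {γ : J ⥤ I} {δ : I ⥤ J} (adj : δ ⊣ γ) {E E' : DFun R I} (f : E ⟶ E') :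
    IsHEquiv ((pull R γ).map f) ↔ IsHEquiv f := by
  refine forall_congr' fun Z => ?_
  -- Constant objects pull back to constant objects, so the adjunction `pull R γ ⊣ pull R δ`
  -- identifies the two families of test maps.
  let e : (pull R δ).obj ((pull R (toPt J)).obj Z) ≅ (pull R (toPt I)).obj Z :=
    ((pullComp R δ (toPt J)).app Z).symm
  rw [← bijective_comp_congr f e]
  let a := (pullAdj R adj)
  have : (fun g : (pull R γ).obj E' ⟶ (pull R (toPt J)).obj Z => (pull R γ).map f ≫ g) =
      (a.homEquiv _ _).symm ∘ (fun g => f ≫ g) ∘ a.homEquiv _ _ := funext fun g => by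
    dsimp
    rw [Adjunction.homEquiv_naturality_left_symm, Equiv.symm_apply_apply]
  rw [this, Equiv.comp_bijective, Equiv.bijective_comp]

/-- A morphism over a product is invertible on derived colimits if it is so over each slice. -/
lemma isHEquiv_of_sectL [EssentiallySmall.{u} I] [EssentiallySmall.{u} J] {E E' : DFun R (I × J)}
    (f : E ⟶ E') (h : ∀ j, IsHEquiv ((pull R (Prod.sectL I j)).map f)) : IsHEquiv f := fun Z => by
  obtain ⟨P⟩ := nonempty_derivedLan R (CategoryTheory.Prod.snd I J)
  obtain ⟨T⟩ := nonempty_derivedLan R (toPt I)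
  -- Take derived colimits along `I` first: base change computes this fibrewise over `J`, where the
  -- hypothesis applies.
  have : IsIso (P.functor.map f) := isIso_of_isIso_pull_atPt _ fun j => by
    have h₁ := (isHEquiv_iff T _).1 (h j)
    have h₂ := (baseChange P T j).naturality f
    have h₃ : IsIso ((baseChange P T j).app E ≫ (P.functor ⋙ pull R (atPt j)).map f) := by
      rw [← h₂]
      exact @IsIso.comp_isIso _ _ _ _ _ _ _ h₁ inferInstance
    exact @IsIso.of_isIso_comp_left _ _ _ _ _ ((baseChange P T j).app E)
      ((P.functor ⋙ pull R (atPt j)).map f) inferInstance h₃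
  exact (bijective_comp_congr f ((pullComp R (CategoryTheory.Prod.snd I J) (toPt J)).app Z)).2
    ((P.adj.isIso_map_iff_bijective f).1 this _)

end HEquiv

/-! ### Maps of functors to sets inducing isomorphisms on homology -/

section SetEquiv

variable {I : Type u₁} [Category.{v₁} I] {J : Type u₂} [Category.{v₂} J] {𝓔 : Type u₃}
  [Category.{v₃} 𝓔]

/-- The map `α` induces an isomorphism on derived colimits of free modules. -/
def IsHomologyEquiv (R : Type u) [Ring R] {V W : I ⥤ Type u} (α : V ⟶ W) : Prop :=
  ∀ n : ℤ, IsHEquiv ((freeQ R n).map α)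

variable {R : Type u} [Ring R]

lemma isHomologyEquiv_of_isIso {V W : I ⥤ Type u} (α : V ⟶ W) [IsIso α] : IsHomologyEquiv R α :=
  fun _ => isHEquiv_of_isIso _

lemma IsHomologyEquiv.comp {U V W : I ⥤ Type u} {α : U ⟶ V} {β : V ⟶ W}
    (hα : IsHomologyEquiv R α) (hβ : IsHomologyEquiv R β) : IsHomologyEquiv R (α ≫ β) := fun n => by
  rw [Functor.map_comp]
  exact (hα n).comp (hβ n)

lemma IsHomologyEquiv.of_square {V₁ W₁ V₂ W₂ : I ⥤ Type u} {α₁ : V₁ ⟶ W₁} {α₂ : V₂ ⟶ W₂}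
    {e : V₁ ⟶ V₂} {e' : W₁ ⟶ W₂} (he : IsHomologyEquiv R e) (he' : IsHomologyEquiv R e')
    (h : α₁ ≫ e' = e ≫ α₂) (h₁ : IsHomologyEquiv R α₁) : IsHomologyEquiv R α₂ := fun n =>
  (he n).of_square (he' n) (by rw [← Functor.map_comp, h, Functor.map_comp]) (h₁ n)

lemma IsHomologyEquiv.of_square' {V₁ W₁ V₂ W₂ : I ⥤ Type u} {α₁ : V₁ ⟶ W₁} {α₂ : V₂ ⟶ W₂}
    {e : V₁ ⟶ V₂} {e' : W₁ ⟶ W₂} (he : IsHomologyEquiv R e) (he' : IsHomologyEquiv R e')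
    (h : α₁ ≫ e' = e ≫ α₂) (h₂ : IsHomologyEquiv R α₂) : IsHomologyEquiv R α₁ := fun n =>
  (he n).of_square' (he' n) (by rw [← Functor.map_comp, h, Functor.map_comp]) (h₂ n)

lemma isHEquiv_freeQ_whiskerLeft_iff (γ : J ⥤ I) {V W : I ⥤ Type u} (α : V ⟶ W) (n : ℤ) :
    IsHEquiv ((freeQ R n).map (Functor.whiskerLeft γ α)) ↔
      IsHEquiv ((pull R γ).map ((freeQ R n).map α)) :=
  ⟨.of_square' (isHEquiv_of_isIso (pullFree (R := R) γ n V).hom)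
    (isHEquiv_of_isIso (pullFree (R := R) γ n W).hom) (pullFree_naturality γ n α),
  .of_square (isHEquiv_of_isIso (pullFree (R := R) γ n V).hom)
    (isHEquiv_of_isIso (pullFree (R := R) γ n W).hom) (pullFree_naturality γ n α)⟩

lemma isHomologyEquiv_whiskerLeft_iff {γ : J ⥤ I} {δ : I ⥤ J} (adj : δ ⊣ γ) {V W : I ⥤ Type u}
    (α : V ⟶ W) : IsHomologyEquiv R (Functor.whiskerLeft γ α) ↔ IsHomologyEquiv R α :=
  forall_congr' fun n => (isHEquiv_freeQ_whiskerLeft_iff γ α n).trans (isHEquiv_pull_iff adj _)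

lemma isHomologyEquiv_of_sectL [EssentiallySmall.{u} I] [EssentiallySmall.{u} J]
    {V W : I × J ⥤ Type u} (α : V ⟶ W)
    (h : ∀ j, IsHomologyEquiv R (Functor.whiskerLeft (Prod.sectL I j) α)) :
    IsHomologyEquiv R α := fun n =>
  isHEquiv_of_sectL _ fun j => (isHEquiv_freeQ_whiskerLeft_iff _ α n).1 (h j n)

lemma isHomologyEquiv_of_sectR [EssentiallySmall.{u} I] [EssentiallySmall.{u} J]
    {V W : I × J ⥤ Type u} (α : V ⟶ W)
    (h : ∀ i, IsHomologyEquiv R (Functor.whiskerLeft (Prod.sectR i J) α)) :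
    IsHomologyEquiv R α :=
  (isHomologyEquiv_whiskerLeft_iff (Prod.braiding I J).toAdjunction α).1
    (isHomologyEquiv_of_sectL _ fun i => h i)

end SetEquiv

/-! ### Contractibility -/

section Adjunctions

variable {I : Type u₁} [Category.{v₁} I] {J : Type u₂} [Category.{v₂} J]

open Limits

/-- The inclusion of a terminal object is right adjoint to the projection to the point. -/
def toPtAdj {z : I} (hz : IsTerminal z) : toPt I ⊣ atPt z :=
  Adjunction.mkOfUnitCounit
    { unit := { app _ := hz.from _, naturality _ _ _ := hz.hom_ext _ _ }
      counit := { app _ := eqToHom (Subsingleton.elim _ _), naturality _ _ _ := Subsingleton.elim _ _ }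
      left_triangle := by
        ext
        exact Subsingleton.elim _ _
      right_triangle := by
        ext
        exact hz.hom_ext _ _ }

/-- The inclusion of a slice over a terminal object is right adjoint to the projection. -/
def sndAdj {z : I} (hz : IsTerminal z) : CategoryTheory.Prod.snd I J ⊣ Prod.sectR z J :=
  Adjunction.mkOfUnitCounit
    { unit :=
        { app q := (hz.from q.1, 𝟙 q.2)
          naturality _ _ f := Prod.ext (hz.hom_ext _ _)
            ((Category.comp_id f.2).trans (Category.id_comp f.2).symm) }
      counit :=
        { app _ := 𝟙 _
          naturality _ _ f := (Category.comp_id f).trans (Category.id_comp f).symm }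
      left_triangle := by
        ext q
        exact (Category.id_comp _).trans (Category.id_comp _)
      right_triangle := by
        refine NatTrans.ext (funext fun q => Prod.ext (hz.hom_ext _ _) ?_)
        exact (congrArg _ (Category.id_comp (𝟙 q))).trans (Category.id_comp (𝟙 q)) }

/-- The projection of a product is right adjoint to the inclusion of a slice over an initial
object. -/
def sectRAdj {z : I} (hz : IsInitial z) : Prod.sectR z J ⊣ CategoryTheory.Prod.snd I J :=
  Adjunction.mkOfUnitCounit
    { unit :=
        { app _ := 𝟙 _
          naturality _ _ f := (Category.comp_id f).trans (Category.id_comp f).symm }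
      counit :=
        { app q := (hz.to q.1, 𝟙 q.2)
          naturality _ _ f := Prod.ext (hz.hom_ext _ _)
            ((Category.comp_id f.2).trans (Category.id_comp f.2).symm) }
      left_triangle := by
        refine NatTrans.ext (funext fun q => Prod.ext (hz.hom_ext _ _) ?_)
        exact (congrArg _ (Category.id_comp (𝟙 q))).trans (Category.id_comp (𝟙 q))
      right_triangle := by
        ext q
        exact (Category.id_comp _).trans (Category.id_comp _) }

/-- The product of an adjunction and an identity functor. -/
def adjProdId {F : I ⥤ J} {G : J ⥤ I} (adj : F ⊣ G) (K : Type u₃) [Category.{v₃} K] :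
    F.prod (𝟭 K) ⊣ G.prod (𝟭 K) :=
  Adjunction.mkOfUnitCounit
    { unit :=
        { app q := (adj.unit.app q.1, 𝟙 q.2)
          naturality _ _ f := Prod.ext (adj.unit.naturality f.1)
            ((Category.comp_id f.2).trans (Category.id_comp f.2).symm) }
      counit :=
        { app q := (adj.counit.app q.1, 𝟙 q.2)
          naturality _ _ f := Prod.ext (adj.counit.naturality f.1)
            ((Category.comp_id f.2).trans (Category.id_comp f.2).symm) }
      left_triangle := by
        refine NatTrans.ext (funext fun q => Prod.ext ?_ ?_)
        · exact (congrArg _ (Category.id_comp _)).trans (adj.left_triangle_components q.1)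
        · exact (congrArg _ (Category.id_comp (𝟙 q.2))).trans (Category.id_comp (𝟙 q.2))
      right_triangle := by
        refine NatTrans.ext (funext fun q => Prod.ext ?_ ?_)
        · exact (congrArg _ (Category.id_comp _)).trans (adj.right_triangle_components q.1)
        · exact (congrArg _ (Category.id_comp (𝟙 q.2))).trans (Category.id_comp (𝟙 q.2)) }

/-- The one-element ordinal is initial in `Δ_+`. -/
def isInitialDeltaPlusZero : IsInitial DeltaPlus.zero :=
  IsInitial.ofUniqueHom
    (fun b => ⟨SimplexCategory.Hom.mk ⟨fun _ => Fin.last _, fun _ _ _ => le_rfl⟩, rfl⟩)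
    fun b f => by
      refine WideSubcategory.hom_ext _ (SimplexCategory.Hom.ext _ _ (OrderHom.ext _ _ ?_))
      funext i
      have : i = Fin.last 0 := Subsingleton.elim (α := Fin 1) _ _
      subst this
      exact f.2

/-- The monotone retraction that sends the new terminal element to the old one. -/
def closeLast (n : ℕ) : Fin (n + 2) →o Fin (n + 1) where
  toFun := Fin.lastCases (motive := fun _ => Fin (n + 1)) (Fin.last _) fun i => i
  monotone' := by
    intro a b h
    induction b using Fin.lastCases with
    | last => simpa using Fin.le_last _
    | cast j =>
      induction a using Fin.lastCases with
      | last => exact absurd h (not_le.2 (Fin.castSucc_lt_last j))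
      | cast i => simpa using h

lemma closeLast_last (n : ℕ) : closeLast n (Fin.last _) = Fin.last _ :=
  Fin.lastCases_last (motive := fun _ => Fin (n + 1))

lemma closeLast_castSucc {n : ℕ} (i : Fin (n + 1)) : closeLast n i.castSucc = i :=
  Fin.lastCases_castSucc (motive := fun _ => Fin (n + 1)) i

lemma closeLast_addLast {m n : ℕ} (f : Fin (m + 1) →o Fin (n + 1))
    (hf : f (Fin.last _) = Fin.last _) (i : Fin (m + 2)) :
    closeLast n (addLast f i) = f (closeLast m i) := by
  induction i using Fin.lastCases with
  | last => rw [addLast_last, closeLast_last, closeLast_last, hf]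
  | cast i => rw [addLast_castSucc, closeLast_castSucc, closeLast_castSucc]

lemma closeLast_addLast_castSucc {n : ℕ} (i : Fin (n + 2)) :
    closeLast (n + 1) (addLast Fin.castSuccOrderEmb.toOrderHom i) = i := by
  induction i using Fin.lastCases with
  | last => rw [addLast_last, closeLast_last]
  | cast i =>
    rw [addLast_castSucc, closeLast_castSucc]
    rfl

lemma deltaPlus_hom_ext {a b : DeltaPlus} {f g : a ⟶ b}
    (h : ∀ i, f.hom.toOrderHom i = g.hom.toOrderHom i) : f = g :=
  WideSubcategory.hom_ext _ (SimplexCategory.Hom.ext _ _ (OrderHom.ext _ _ (funext h)))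

/-- The functor `κ` is left adjoint to the inclusion of `Δ_+` into `Δ`. -/
def kappaAdj : kappa ⊣ wideSubcategoryInclusion preservesLast :=
  Adjunction.mkOfUnitCounit
    { unit :=
        { app a := SimplexCategory.Hom.mk Fin.castSuccOrderEmb.toOrderHom
          naturality a b f := SimplexCategory.Hom.ext _ _ <| OrderHom.ext _ _ <| funext fun i =>
            (addLast_castSucc f.toOrderHom i).symm }
      counit :=
        { app b := ⟨SimplexCategory.Hom.mk (closeLast b.obj.len), closeLast_last b.obj.len⟩
          naturality b b' f := deltaPlus_hom_ext fun i =>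
            closeLast_addLast f.hom.toOrderHom f.2 i }
      left_triangle := by
        refine NatTrans.ext (funext fun a => deltaPlus_hom_ext fun i => ?_)
        exact closeLast_addLast_castSucc i
      right_triangle := by
        ext b : 2
        refine SimplexCategory.Hom.ext _ _ (OrderHom.ext _ _ (funext fun i => ?_))
        exact closeLast_castSucc i }

end Adjunctions

/-! ### Equivalences that survive any functor to sets -/

section Universal

open Limits

variable {I : Type u₁} [Category.{v₁} I] {J : Type u₂} [Category.{v₂} J] {𝓔 : Type u₃}
  [Category.{v₃} 𝓔]

/-- The map `α` induces an isomorphism on derived colimits after any functor to sets. -/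
def IsUniversalEquiv (R : Type u) [Ring R] {X Y : I ⥤ 𝓔} (α : X ⟶ Y) : Prop :=
  ∀ Ψ : 𝓔 ⥤ Type u, IsHomologyEquiv R (Functor.whiskerRight α Ψ)

variable {R : Type u} [Ring R]

lemma isUniversalEquiv_of_isIso {X Y : I ⥤ 𝓔} (α : X ⟶ Y) [IsIso α] : IsUniversalEquiv R α :=
  fun _ => isHomologyEquiv_of_isIso _

lemma IsUniversalEquiv.of_square' {V₁ W₁ V₂ W₂ : I ⥤ 𝓔} {α₁ : V₁ ⟶ W₁} {α₂ : V₂ ⟶ W₂}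
    {e : V₁ ⟶ V₂} {e' : W₁ ⟶ W₂} (he : IsUniversalEquiv R e) (he' : IsUniversalEquiv R e')
    (h : α₁ ≫ e' = e ≫ α₂) (h₂ : IsUniversalEquiv R α₂) : IsUniversalEquiv R α₁ := fun Ψ =>
  (he Ψ).of_square' (he' Ψ)
    (by rw [← Functor.whiskerRight_comp, h, Functor.whiskerRight_comp]) (h₂ Ψ)

lemma isUniversalEquiv_whiskerLeft_iff {γ : J ⥤ I} {δ : I ⥤ J} (adj : δ ⊣ γ) {X Y : I ⥤ 𝓔}
    (α : X ⟶ Y) : IsUniversalEquiv R (Functor.whiskerLeft γ α) ↔ IsUniversalEquiv R α :=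
  forall_congr' fun Ψ => isHomologyEquiv_whiskerLeft_iff adj (Functor.whiskerRight α Ψ)

/-- The inclusion of a terminal object is right adjoint to the projection to the point, so derived
colimits are evaluations at that object, whatever functor to sets is applied first. -/
lemma isUniversalEquiv_of_isTerminal {z : I} (hz : IsTerminal z) {X Y : I ⥤ 𝓔}
    (α : X ⟶ Y) [IsIso (α.app z)] : IsUniversalEquiv R α :=
  (isUniversalEquiv_whiskerLeft_iff (toPtAdj hz) α).1 <|
    have : IsIso (Functor.whiskerLeft (atPt z) α) :=
      @NatIso.isIso_of_isIso_app _ _ _ _ _ _ _ fun _ => inferInstanceAs (IsIso (α.app z))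
    isUniversalEquiv_of_isIso _

/-- A map of functors extended along `κ` is a universal equivalence if it is invertible over the
one-element ordinal. -/
lemma isUniversalEquiv_kappa {X Y : DeltaPlusᵒᵖ ⥤ 𝓔} (α : X ⟶ Y)
    [IsIso (α.app (Opposite.op DeltaPlus.zero))] :
    IsUniversalEquiv R (Functor.whiskerLeft kappa.op α) :=
  (isUniversalEquiv_whiskerLeft_iff kappaAdj.op α).2
    (isUniversalEquiv_of_isTerminal (terminalOpOfInitial isInitialDeltaPlusZero) α)

/-- The projection of a family of functors to sets to the point. -/
def toPUnit {Ω : Type u} (X : I ⥤ (Ω → Type u)) :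
    X ⟶ (Functor.const I).obj (fun _ => PUnit.{u + 1}) where
  app _ _ := TypeCat.ofHom fun _ => ⟨⟩

lemma isUniversalEquiv_toPUnit_of_iso {Ω : Type u} {X Y : I ⥤ (Ω → Type u)} (e : X ≅ Y)
    (h : IsUniversalEquiv R (toPUnit Y)) : IsUniversalEquiv R (toPUnit X) :=
  .of_square' (isUniversalEquiv_of_isIso e.hom) (isUniversalEquiv_of_isIso (𝟙 _)) rfl h

lemma isUniversalEquiv_toPUnit_comp_iff {Ω : Type u} {γ : J ⥤ I} {δ : I ⥤ J} (adj : δ ⊣ γ)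
    (X : I ⥤ (Ω → Type u)) :
    IsUniversalEquiv R (toPUnit (γ ⋙ X)) ↔ IsUniversalEquiv R (toPUnit X) :=
  isUniversalEquiv_whiskerLeft_iff adj (toPUnit X)

/-- The extensions along `κ` are assembled into one extension of the whole family. Infinite families
and arbitrary functors of them are therefore handled without a Künneth argument. -/
lemma isUniversalEquiv_toPUnit_of_sContractible {Ω : Type u}
    (X : Ω → SimplexCategoryᵒᵖ ⥤ Type u) (hX : ∀ ω, SContractible (X ω)) :
    IsUniversalEquiv R (toPUnit (Functor.pi' X)) := by
  choose X' e hX' using hX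
  refine isUniversalEquiv_toPUnit_of_iso (Y := kappa.op ⋙ Functor.pi' X')
    (NatIso.pi' fun ω => (e ω).some) ?_
  have : IsIso ((toPUnit (Functor.pi' X')).app (Opposite.op DeltaPlus.zero)) := by
    have := fun ω => (hX' ω).some
    exact ⟨fun ω => TypeCat.ofHom fun _ => (this ω).default,
      funext fun ω => by ext x; exact ((this ω).uniq x).symm,
      funext fun ω => by ext x; rfl⟩
  exact isUniversalEquiv_kappa (toPUnit (Functor.pi' X'))

/-- The projection to the point is a universal equivalence for a family of contractible
bisimplicial sets. -/
lemma isUniversalEquiv_toPUnit_of_biContractible {Ω : Type u} (X : Ω → BiDelta ⥤ Type u)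
    (hX : ∀ ω, BiContractible (X ω)) : IsUniversalEquiv R (toPUnit (Functor.pi' X)) := by
  choose X' hX' using hX
  let Y : DeltaPlusᵒᵖ × SimplexCategoryᵒᵖ ⥤ (Ω → Type u) := Functor.pi' X'
  have h₁ : IsUniversalEquiv R (toPUnit (Prod.sectR (Opposite.op DeltaPlus.zero) _ ⋙ Y)) :=
    isUniversalEquiv_toPUnit_of_sContractible
      (fun ω => Prod.sectR (Opposite.op DeltaPlus.zero) _ ⋙ X' ω) fun ω => (hX' ω).2
  -- The slice over the terminal object of `Δ_+ᵒᵖ` already computes the derived colimit of the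
  -- extension.
  have h₂ : IsUniversalEquiv R (toPUnit Y) :=
    (isUniversalEquiv_toPUnit_comp_iff
      (sndAdj (terminalOpOfInitial isInitialDeltaPlusZero)) Y).1 h₁
  have h₃ : IsUniversalEquiv R (toPUnit ((kappa.op.prod (𝟭 SimplexCategoryᵒᵖ)) ⋙ Y)) :=
    (isUniversalEquiv_toPUnit_comp_iff (adjProdId kappaAdj.op SimplexCategoryᵒᵖ) Y).2 h₂
  have e' : Functor.pi' X ≅ (kappa.op.prod (𝟭 SimplexCategoryᵒᵖ)) ⋙ Y :=
    NatIso.pi' fun ω => (hX' ω).1.some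
  exact isUniversalEquiv_toPUnit_of_iso e' h₃

end Universal

/-! ### Constructions of admissible pointed `G`-sets -/

section Constructions

variable {G : Type u} [Group G]

lemma AdmPt.hom_ext {S T : AdmPt G} {f g : S ⟶ T} (h : ∀ s, f.hom.toFun s = g.hom.toFun s) :
    f = g :=
  ObjectProperty.hom_ext _ (PtGSet.hom_ext h)

/-- An invariant relation between an admissible pointed `G`-set and a finite pointed set. -/
structure InvRel (Y : AdmPt G) (A : Type u) where
  /-- the relation -/
  rel : Y.obj.carrier → A → Prop
  rel_smul : ∀ (g : G) y a, rel y a → rel (g • y) a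
  /-- the distinguished element -/
  pt : A
  rel_pt : rel Y.obj.pt pt

namespace InvRel

variable {Y : AdmPt G} {A : Type u} [Finite A]

/-- The pointed `G`-set of related pairs. -/
def toPtGSet (P : InvRel Y A) : PtGSet G where
  carrier := {p : Y.obj.carrier × A // P.rel p.1 p.2}
  action :=
    { smul := fun g p => ⟨(g • p.1.1, p.1.2), P.rel_smul g _ _ p.2⟩
      one_smul := fun p => Subtype.ext (Prod.ext (one_smul G p.1.1) rfl)
      mul_smul := fun g h p => Subtype.ext (Prod.ext (mul_smul g h p.1.1) rfl) }
  pt := ⟨(Y.obj.pt, P.pt), P.rel_pt⟩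
  smul_pt g := Subtype.ext (Prod.ext (Y.obj.smul_pt g) rfl)

lemma isAdmissible_toPtGSet (P : InvRel Y A) : PtGSet.IsAdmissible P.toPtGSet := by
  refine ⟨fun p => ?_, fun H hH => ?_⟩
  · have := Y.property.1 p.1.1
    refine Subgroup.finiteIndex_of_le (H := MulAction.stabilizer G p.1.1) fun g hg => ?_
    exact Subtype.ext (Prod.ext hg rfl)
  · refine Set.Finite.of_finite_image (f := Subtype.val) ?_ Subtype.val_injective.injOn
    refine ((Y.property.2 H hH).prod (Set.finite_univ (α := A))).subset ?_
    rintro _ ⟨p, hp, rfl⟩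
    exact ⟨fun h => congrArg (fun q => q.1.1) (hp h), trivial⟩

/-- The admissible pointed `G`-set of related pairs. -/
def toAdm (P : InvRel Y A) : AdmPt G := ⟨P.toPtGSet, P.isAdmissible_toPtGSet⟩

/-- The first projection. -/
def fst (P : InvRel Y A) : P.toAdm ⟶ Y := ObjectProperty.homMk
  { toFun := fun p => p.1.1
    map_smul := fun _ _ => rfl
    map_pt := rfl }

variable {Y' : AdmPt G} {A' : Type u} [Finite A']

/-- Maps of relations induce maps of pointed `G`-sets. -/
def map {P : InvRel Y A} {P' : InvRel Y' A'} (f : Y ⟶ Y') (h : A → A')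
    (hf : ∀ y a, P.rel y a → P'.rel (f.hom.toFun y) (h a)) (hpt : h P.pt = P'.pt) :
    P.toAdm ⟶ P'.toAdm := ObjectProperty.homMk
  { toFun := fun p => ⟨(f.hom.toFun p.1.1, h p.1.2), hf _ _ p.2⟩
    map_smul := fun g p => Subtype.ext (Prod.ext (f.hom.map_smul g p.1.1) rfl)
    map_pt := Subtype.ext (Prod.ext f.hom.map_pt hpt) }

end InvRel

/-- The pointed `G`-set with a single element. -/
def pointSet (G : Type u) [Group G] : AdmPt G where
  obj :=
    { carrier := PUnit
      action :=
        { smul := fun _ s => s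
          one_smul := fun _ => rfl
          mul_smul := fun _ _ _ => rfl }
      pt := ⟨⟩
      smul_pt _ := rfl }
  property := ⟨fun _ => Subgroup.finiteIndex_of_le (H := ⊤) fun _ _ => rfl, fun _ _ =>
    Set.toFinite (α := PUnit) _⟩

/-- The map to the one-element pointed `G`-set. -/
def toPointSet (Y : AdmPt G) : Y ⟶ pointSet G := ObjectProperty.homMk
  { toFun := fun _ => ⟨⟩
    map_smul := fun _ _ => rfl
    map_pt := rfl }

/-- The subsets of a finite ordinal that contain the terminal element. -/
def LastSets (n : ℕ) : Type u := ULift.{u} {U : Set (Fin (n + 1)) // Fin.last n ∈ U}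

lemma addLast_eq_self {n : ℕ} {f : Fin (n + 1) →o Fin (n + 1)} (h : ∀ i, f i = i) (i : Fin (n + 2)) :
    addLast f i = i := by
  induction i using Fin.lastCases with
  | last => exact addLast_last f
  | cast i => rw [addLast_castSucc, h]

lemma addLast_eq_comp {l m n : ℕ} {f : Fin (l + 1) →o Fin (m + 1)} {g : Fin (m + 1) →o Fin (n + 1)}
    {k : Fin (l + 1) →o Fin (n + 1)} (h : ∀ i, k i = g (f i)) (i : Fin (l + 2)) :
    addLast k i = addLast g (addLast f i) := by
  induction i using Fin.lastCases with
  | last => rw [addLast_last, addLast_last, addLast_last]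
  | cast i => rw [addLast_castSucc, addLast_castSucc, addLast_castSucc, h]

/-! ### The interval used as a whisker -/

namespace LastSets

instance (n : ℕ) : Finite (LastSets.{u} n) :=
  inferInstanceAs (Finite (ULift.{u} {U : Set (Fin (n + 1)) // Fin.last n ∈ U}))

/-- The whole ordinal. -/
def one (n : ℕ) : LastSets.{u} n := ⟨⟨Set.univ, trivial⟩⟩

/-- The terminal element. -/
def zero (n : ℕ) : LastSets.{u} n := ⟨⟨{Fin.last n}, rfl⟩⟩

@[ext]
lemma ext {n : ℕ} {U V : LastSets.{u} n} (h : ∀ i, i ∈ U.down.1 ↔ i ∈ V.down.1) : U = V :=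
  ULift.ext _ _ (Subtype.ext (Set.ext h))

/-- Through `κ`, the elements of degree `n` are all subsets of `[n]`, so this is the nerve of a
category with two isomorphic objects, with ends `zero` and `one`. Having one element over `[0]_+`
makes it contractible. -/
lemma eq_one_zero (U : LastSets.{u} 0) : U = one 0 := by
  ext i
  have : i = Fin.last 0 := Subsingleton.elim (α := Fin 1) _ _
  subst this
  exact ⟨fun _ => trivial, fun _ => U.down.2⟩

lemma zero_ne_one (n : ℕ) : zero.{u} (n + 1) ≠ one (n + 1) := fun h => by
  have : (0 : Fin (n + 2)) ∈ (zero.{u} (n + 1)).down.1 := h ▸ trivial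
  exact absurd this (Fin.last_pos (n := n)).ne

/-- The inverse image under a map that preserves terminal elements. -/
def comap {m n : ℕ} (f : Fin (m + 1) →o Fin (n + 1)) (hf : f (Fin.last m) = Fin.last n)
    (U : LastSets.{u} n) : LastSets.{u} m :=
  ⟨⟨f ⁻¹' U.down.1, by
    rw [Set.mem_preimage, hf]
    exact U.down.2⟩⟩

lemma comap_one {m n : ℕ} (f : Fin (m + 1) →o Fin (n + 1)) (hf : f (Fin.last m) = Fin.last n) :
    comap f hf (one.{u} n) = one m := rfl

lemma comap_id {m : ℕ} (f : Fin (m + 1) →o Fin (m + 1)) (hf : f (Fin.last m) = Fin.last m)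
    (h : ∀ i, f i = i) (U : LastSets.{u} m) : comap f hf U = U := by
  ext i
  change f i ∈ U.down.1 ↔ _
  rw [h]

lemma comap_comap {l m n : ℕ} (f : Fin (l + 1) →o Fin (m + 1)) (hf : f (Fin.last l) = Fin.last m)
    (g : Fin (m + 1) →o Fin (n + 1)) (hg : g (Fin.last m) = Fin.last n)
    (k : Fin (l + 1) →o Fin (n + 1)) (hk : k (Fin.last l) = Fin.last n)
    (h : ∀ i, k i = g (f i)) (U : LastSets.{u} n) : comap k hk U = comap f hf (comap g hg U) := by
  ext i
  change k i ∈ U.down.1 ↔ g (f i) ∈ U.down.1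
  rw [h]

/-- The end `zero` is preserved by maps in the image of `κ`, but not by all maps of `Δ_+`: the
inverse image of the last element may be larger. Only `one` is a point of the extension to `Δ_+`,
which is why wedges are taken at `one`. -/
lemma comap_addLast_zero {m n : ℕ} (f : Fin (m + 1) →o Fin (n + 1)) :
    comap (addLast f) (addLast_last f) (zero.{u} (n + 1)) = zero (m + 1) := by
  ext i
  change addLast f i = Fin.last (n + 1) ↔ i = Fin.last (m + 1)
  induction i using Fin.lastCases with
  | last => simp
  | cast i => simp [Fin.castSucc_ne_last]

end LastSets

/-- The relation that defines the wedge of an admissible pointed `G`-set and `LastSets n`. -/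
def wedgeRel (Y : AdmPt G) (n : ℕ) : InvRel Y (LastSets.{u} n) where
  rel y U := y = Y.obj.pt ∨ U = LastSets.one n
  rel_smul g y U h := by
    rcases h with rfl | h
    · exact Or.inl (Y.obj.smul_pt g)
    · exact Or.inr h
  pt := LastSets.one n
  rel_pt := Or.inl rfl

/-- The wedge of an admissible pointed `G`-set and a pointed simplicial set extended to `Δ_+`. -/
def wedge (Y : AdmPt G) : DeltaPlusᵒᵖ ⥤ AdmPt G where
  obj m := (wedgeRel Y m.unop.obj.len).toAdm
  map f := InvRel.map (𝟙 Y) (LastSets.comap f.unop.hom.toOrderHom f.unop.2)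
    (by
      rintro y U (h | rfl)
      · exact Or.inl h
      · exact Or.inr (LastSets.comap_one _ f.unop.2)) (LastSets.comap_one _ f.unop.2)
  map_id _ := rfl
  map_comp _ _ := rfl

/-- The projection of the wedge. -/
def wedgeFst (Y : AdmPt G) : wedge Y ⟶ (Functor.const _).obj Y where
  app m := (show (wedgeRel Y m.unop.obj.len).toAdm ⟶ Y from InvRel.fst _)
  naturality _ _ _ := rfl

lemma AdmPt.isIso_of_bijective {S T : AdmPt G} (f : S ⟶ T)
    (hf : Function.Bijective f.hom.toFun) : IsIso f := by
  let e := Equiv.ofBijective _ hf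
  let g : T ⟶ S := ObjectProperty.homMk
    { toFun := e.symm
      map_smul := fun a t => by
        obtain ⟨s, rfl⟩ := e.surjective t
        rw [e.symm_apply_apply]
        exact (congrArg e.symm (f.hom.map_smul a s).symm).trans (e.symm_apply_apply _)
      map_pt := (congrArg e.symm f.hom.map_pt.symm).trans (e.symm_apply_apply _) }
  exact ⟨g, AdmPt.hom_ext fun s => e.symm_apply_apply s, AdmPt.hom_ext fun s => e.apply_symm_apply s⟩

instance isIso_wedgeFst_zero (Y : AdmPt G) :
    IsIso ((wedgeFst Y).app (Opposite.op DeltaPlus.zero)) := by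
  refine AdmPt.isIso_of_bijective _ ⟨?_, ?_⟩
  · intro p q h
    exact Subtype.ext (Prod.ext h
      ((LastSets.eq_one_zero p.1.2).trans (LastSets.eq_one_zero q.1.2).symm))
  · intro y
    exact ⟨⟨(y, LastSets.one 0), Or.inr rfl⟩, rfl⟩

/-- The relation that defines the whiskered pointed `G`-set. -/
def whiskerRel (Y : AdmPt G) (n : ℕ) : InvRel Y (LastSets.{u} n) where
  rel y U := y = Y.obj.pt ∨ U = LastSets.zero n
  rel_smul g y U h := by
    rcases h with rfl | h
    · exact Or.inl (Y.obj.smul_pt g)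
    · exact Or.inr h
  pt := LastSets.one n
  rel_pt := Or.inl rfl

variable (X : BiDelta ⥤ AdmPt G)

/-- The multisimplicial pointed `G`-set obtained from `X` by attaching a whisker at the
distinguished point and moving the distinguished point to the other end of the whisker. -/
def whiskered : SimplexCategoryᵒᵖ × BiDelta ⥤ AdmPt G where
  obj q := (whiskerRel (X.obj q.2) (q.1.unop.len + 1)).toAdm
  map {q q'} f := InvRel.map (X.map f.2)
    (LastSets.comap (addLast f.1.unop.toOrderHom) (addLast_last _))
    (by
      rintro y U (rfl | rfl)
      · exact Or.inl (X.map f.2).hom.map_pt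
      · exact Or.inr (LastSets.comap_addLast_zero f.1.unop.toOrderHom)) (LastSets.comap_one _ _)
  map_id q := AdmPt.hom_ext fun p => Subtype.ext (Prod.ext
    (congrArg (fun t : X.obj q.2 ⟶ X.obj q.2 => t.hom.toFun p.1.1) (X.map_id q.2))
    (LastSets.comap_id _ (addLast_last _) (addLast_eq_self fun _ => rfl) _))
  map_comp f g := AdmPt.hom_ext fun p => Subtype.ext (Prod.ext
    (congrArg (fun t : X.obj _ ⟶ X.obj _ => t.hom.toFun p.1.1) (X.map_comp f.2 g.2))
    (LastSets.comap_comap _ (addLast_last _) _ (addLast_last _) _ (addLast_last _) (addLast_eq_comp fun _ => rfl) _))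

/-- The projection of the whiskered pointed `G`-set that collapses the whisker. -/
def whiskeredFst : whiskered X ⟶ CategoryTheory.Prod.snd _ BiDelta ⋙ X where
  app q := (show (whiskerRel (X.obj q.2) (q.1.unop.len + 1)).toAdm ⟶ X.obj q.2 from InvRel.fst _)
  naturality _ _ _ := rfl

/-- The projection of the whiskered pointed `G`-set to the whisker. -/
def whiskeredSnd :
    whiskered X ⟶ CategoryTheory.Prod.fst _ BiDelta ⋙ kappa.op ⋙ wedge (pointSet G) where
  app q := show (whiskerRel (X.obj q.2) (q.1.unop.len + 1)).toAdm ⟶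
      (wedgeRel (pointSet G) (q.1.unop.len + 1)).toAdm from InvRel.map (P := whiskerRel (X.obj q.2) (q.1.unop.len + 1))
    (P' := wedgeRel (pointSet G) (q.1.unop.len + 1)) (toPointSet _) id
    (fun _ _ _ => Or.inl rfl) rfl
  naturality _ _ _ := rfl

open Classical in
/-- The whisker attached to the wedge is a wedge. -/
def whiskerHom (Y : AdmPt G) (n : ℕ) : (whiskerRel Y n).toAdm ⟶ (wedgeRel Y n).toAdm :=
  ObjectProperty.homMk
    -- The non-distinguished points of `Y` are moved from the end `zero` to the end `one`; the
    -- whisker itself is untouched.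
    { toFun := fun p => ⟨(p.1.1, if p.1.1 = Y.obj.pt then p.1.2 else LastSets.one _), by
        by_cases h : p.1.1 = Y.obj.pt
        · exact Or.inl h
        · exact Or.inr (if_neg h)⟩
      map_smul := fun g p => Subtype.ext (Prod.ext rfl (by
        have : g • p.1.1 = Y.obj.pt ↔ p.1.1 = Y.obj.pt := by
          rw [← smul_left_cancel_iff g (x := p.1.1), Y.obj.smul_pt]
        change (if g • p.1.1 = Y.obj.pt then p.1.2 else _) = _
        rw [this]
        rfl))
      map_pt := Subtype.ext (Prod.ext rfl (if_pos rfl)) }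

lemma whiskerHom_snd (Y : AdmPt G) (n : ℕ) (p : (whiskerRel Y n).toPtGSet.carrier) :
    p.1.1 = Y.obj.pt ∧ (PtGSet.Hom.toFun (whiskerHom Y n).hom p).1.2 = p.1.2 ∨
      p.1.1 ≠ Y.obj.pt ∧ (PtGSet.Hom.toFun (whiskerHom Y n).hom p).1.2 = LastSets.one n ∧
        p.1.2 = LastSets.zero n := by
  by_cases h : p.1.1 = Y.obj.pt
  · exact Or.inl ⟨h, if_pos h⟩
  · exact Or.inr ⟨h, if_neg h, p.2.resolve_left h⟩

instance isIso_whiskerHom (Y : AdmPt G) (n : ℕ) : IsIso (whiskerHom Y n) := by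
  refine AdmPt.isIso_of_bijective _ ⟨fun p q h => ?_, fun q => ?_⟩
  · have h₁ : p.1.1 = q.1.1 := congrArg (fun t => t.1.1) h
    have h₂ : (PtGSet.Hom.toFun (whiskerHom Y n).hom p).1.2 =
      (PtGSet.Hom.toFun (whiskerHom Y n).hom q).1.2 := congrArg (fun t => t.1.2) h
    refine Subtype.ext (Prod.ext h₁ ?_)
    rcases whiskerHom_snd Y n p with ⟨hp, hp'⟩ | ⟨hp, -, hp'⟩ <;>
    rcases whiskerHom_snd Y n q with ⟨hq, hq'⟩ | ⟨hq, -, hq'⟩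
    · exact hp'.symm.trans (h₂.trans hq')
    · exact absurd (h₁.symm.trans hp) hq
    · exact absurd (h₁.trans hq) hp
    · exact hp'.trans hq'.symm
  · by_cases h : q.1.1 = Y.obj.pt
    · exact ⟨⟨(q.1.1, q.1.2), Or.inl h⟩, Subtype.ext (Prod.ext rfl (if_pos h))⟩
    · exact ⟨⟨(q.1.1, LastSets.zero n), Or.inr rfl⟩, Subtype.ext (Prod.ext rfl
        ((if_neg h).trans (q.2.resolve_left h).symm))⟩

/-- For a fixed bisimplicial degree, the whiskered pointed `G`-set extends to `Δ_+`. -/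
def whiskeredIso (n : BiDelta) :
    Prod.sectL SimplexCategoryᵒᵖ n ⋙ whiskered X ≅ kappa.op ⋙ wedge (X.obj n) :=
  NatIso.ofComponents (fun k => show (whiskerRel (X.obj n) (k.unop.len + 1)).toAdm ≅
      (wedgeRel (X.obj n) (k.unop.len + 1)).toAdm from asIso (whiskerHom _ _)) fun {k k'} f => by
    refine AdmPt.hom_ext fun (p : (whiskerRel (X.obj n) (k.unop.len + 1)).toPtGSet.carrier) => ?_
    have h₀ : (X.map (𝟙 n)).hom.toFun p.1.1 = p.1.1 :=
      congrArg (fun t : X.obj n ⟶ X.obj n => t.hom.toFun p.1.1) (X.map_id n)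
    refine Subtype.ext (Prod.ext h₀ ?_)
    -- Only the whisker degree varies here. A structure map of `X` may send other points to the
    -- distinguished one, and the isomorphism would not commute with it.
    by_cases h : p.1.1 = (X.obj n).obj.pt
    · refine (if_pos (h₀.trans h)).trans (congrArg (LastSets.comap _ (addLast_last _)) ?_)
      exact (if_pos h).symm
    · refine (if_neg fun h' => h (h₀.symm.trans h')).trans ((LastSets.comap_one _ _).symm.trans
        (congrArg (LastSets.comap _ (addLast_last _)) ?_))
      exact (if_neg h).symm

end Constructions

/-! ### Morphisms to glued pointed `G`-sets -/

section Gluing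

variable {G : Type u} [Group G]

lemma AdmPt.map_smul {S T : AdmPt G} (f : S ⟶ T) (g : G) (s : S.obj.carrier) :
    f.hom.toFun (g • s) = g • f.hom.toFun s := f.hom.map_smul g s

lemma AdmPt.comp_apply {S T U : AdmPt G} (f : S ⟶ T) (g : T ⟶ U) (s : S.obj.carrier) :
    (f ≫ g).hom.toFun s = g.hom.toFun (f.hom.toFun s) := rfl

lemma AdmPt.congr_apply {S T : AdmPt G} {f g : S ⟶ T} (h : f = g) (s : S.obj.carrier) :
    f.hom.toFun s = g.hom.toFun s := h ▸ rfl

/-- The maps `π` and `ξ` identify `V` with the set of pairs `(v', y)` such that `y` is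
distinguished or `v'` satisfies `Z`. -/
structure IsGluing {V V' Y : AdmPt G} (π : V ⟶ V') (ξ : V ⟶ Y) (Z : V'.obj.carrier → Prop) :
    Prop where
  inj : ∀ v w, π.hom.toFun v = π.hom.toFun w → ξ.hom.toFun v = ξ.hom.toFun w → v = w
  mem_iff : ∀ v' y, (∃ v, π.hom.toFun v = v' ∧ ξ.hom.toFun v = y) ↔ y = Y.obj.pt ∨ Z v'

namespace IsGluing

variable {V V' Y : AdmPt G} {π : V ⟶ V'} {ξ : V ⟶ Y} {Z : V'.obj.carrier → Prop}
  {A : AdmPt G}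

lemma hom_ext (H : IsGluing π ξ Z) {f f' : A ⟶ V} (h₁ : f ≫ π = f' ≫ π) (h₂ : f ≫ ξ = f' ≫ ξ) : f = f' :=
  AdmPt.hom_ext fun a => H.inj _ _ (AdmPt.congr_apply h₁ a) (AdmPt.congr_apply h₂ a)

lemma exists_lift (H : IsGluing π ξ Z) (g : A ⟶ V') (e : A.obj.carrier → Y.obj.carrier)
    (he : ∀ (b : G) a, e (b • a) = b • e a)
    (h : ∀ a, e a = Y.obj.pt ∨ Z (g.hom.toFun a)) (hpt : e A.obj.pt = Y.obj.pt) :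
    ∃ f : A ⟶ V, f ≫ π = g ∧ ∀ a, ξ.hom.toFun (f.hom.toFun a) = e a := by
  choose f hf hf' using fun a => (H.mem_iff (g.hom.toFun a) (e a)).2 (h a)
  refine ⟨ObjectProperty.homMk
    { toFun := f
      map_smul := fun b a => H.inj _ _ ?_ ?_
      map_pt := H.inj _ _ ?_ ?_ }, AdmPt.hom_ext hf, hf'⟩
  · rw [hf, AdmPt.map_smul, AdmPt.map_smul, hf]
  · rw [hf', AdmPt.map_smul, he, hf']
  · rw [hf]
    exact g.hom.map_pt.trans π.hom.map_pt.symm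
  · rw [hf', hpt]
    exact ξ.hom.map_pt.symm

/-- Maps from a pointed `G`-set with trivial action of `N` only depend on `N`-fixed points. -/
lemma bijective_comp (H : IsGluing π ξ Z) {N : Subgroup G} (hA : ∀ (a : A.obj.carrier), ∀ n ∈ N, n • a = a)
    {V₂ Y₂ : AdmPt G} {π₂ : V₂ ⟶ V'} {ξ₂ : V₂ ⟶ Y₂} (H₂ : IsGluing π₂ ξ₂ Z) (f : V ⟶ V₂)
    (h : Y ⟶ Y₂) (hπ : f ≫ π₂ = π) (hξ : f ≫ ξ₂ = ξ ≫ h)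
    (hinj : ∀ y y', (∀ n ∈ N, n • y = y) → (∀ n ∈ N, n • y' = y') →
      h.hom.toFun y = h.hom.toFun y' → y = y')
    (hsurj : ∀ y₂, (∀ n ∈ N, n • y₂ = y₂) → ∃ y, (∀ n ∈ N, n • y = y) ∧ h.hom.toFun y = y₂)
    [N.Normal] :
    Function.Bijective (fun g : A ⟶ V => g ≫ f) := by
  have hfix {U : AdmPt G} (g : A ⟶ U) (a) : ∀ n ∈ N, n • g.hom.toFun a = g.hom.toFun a :=
    fun n hn => by rw [← AdmPt.map_smul, hA a n hn]
  constructor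
  · intro g g' hg
    dsimp only at hg
    refine H.hom_ext ?_ (AdmPt.hom_ext fun a => ?_)
    · rw [← hπ, reassoc_of% hg]
    · refine hinj _ _ (hfix _ a) (hfix _ a) ?_
      have : g ≫ ξ ≫ h = g' ≫ ξ ≫ h := by rw [← hξ, reassoc_of% hg]
      exact AdmPt.congr_apply this a
  · intro g₂
    choose e he he' using fun a => hsurj _ (hfix (g₂ ≫ ξ₂) a)
    have h₁ (b : G) (a : A.obj.carrier) : e (b • a) = b • e a := by
      refine hinj _ _ (he _) (fun n hn => ?_) ?_
      -- Normality of `N` makes `b • e a` fixed by `N`, as needed to apply injectivity on fixed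
      -- points.
      · have : n * b = b * (b⁻¹ * n * b) := by group
        rw [smul_smul, this, mul_smul, he a _ (by
          simpa using ‹N.Normal›.conj_mem n hn b⁻¹)]
      · rw [he', AdmPt.map_smul, AdmPt.map_smul, he']
    have h₂ (a : A.obj.carrier) : e a = Y.obj.pt ∨ Z ((g₂ ≫ π₂).hom.toFun a) := by
      by_cases hz : Z ((g₂ ≫ π₂).hom.toFun a)
      · exact Or.inr hz
      · have := ((H₂.mem_iff _ _).1 ⟨g₂.hom.toFun a, rfl, rfl⟩).resolve_right hz
        refine Or.inl (hinj _ _ (he _) (fun n _ => Y.obj.smul_pt n) ?_)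
        rw [he']
        exact this.trans h.hom.map_pt.symm
    have h₃ : e A.obj.pt = Y.obj.pt := by
      refine hinj _ _ (he _) (fun n _ => Y.obj.smul_pt n) ?_
      rw [he']
      exact (g₂ ≫ ξ₂).hom.map_pt.trans h.hom.map_pt.symm
    obtain ⟨g, hg, hg'⟩ := H.exists_lift (g₂ ≫ π₂) e h₁ h₂ h₃
    refine ⟨g, H₂.hom_ext ?_ (AdmPt.hom_ext fun a => ?_)⟩
    · exact (Category.assoc _ _ _).trans ((congrArg _ hπ).trans hg)
    · have : (g ≫ f) ≫ ξ₂ = g ≫ ξ ≫ h := by rw [Category.assoc, hξ]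
      exact (AdmPt.congr_apply this a).trans ((congrArg h.hom.toFun (hg' a)).trans (he' a))

end IsGluing

/-- The orbits whose stabilizers do not contain `N`. -/
def BadOrbit (N : Subgroup G) (B : AdmPt G) : Type u :=
  {ω : MulAction.orbitRel.Quotient G B.obj.carrier // ¬ N ≤ MulAction.stabilizer G ω.out}

namespace BadOrbit

variable {N : Subgroup G} {B : AdmPt G}

/-- The chosen representative of an orbit. -/
def rep (ω : BadOrbit N B) : B.obj.carrier := ω.1.out

/-- The stabilizer of the chosen representative of an orbit. -/
def stab (ω : BadOrbit N B) : Subgroup G := MulAction.stabilizer G ω.rep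

lemma finiteIndex_stab (ω : BadOrbit N B) : ω.stab.FiniteIndex := B.property.1 ω.rep

lemma not_le_stab (ω : BadOrbit N B) : ¬ N ≤ ω.stab := ω.2

/-- Since `N` is normal, containing `N` is a property of the stabilizers of a whole orbit, so it
passes to the chosen representative. -/
lemma exists_rep [N.Normal] (b : B.obj.carrier) (hb : ¬ N ≤ MulAction.stabilizer G b) :
    ∃ (ω : BadOrbit N B) (g : G), b = g • ω.rep ∧
      (Quotient.mk (MulAction.orbitRel G B.obj.carrier) b) = ω.1 := by
  generalize hω : Quotient.mk (MulAction.orbitRel G B.obj.carrier) b = ω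
  obtain ⟨g, hg⟩ : ∃ g : G, g • b = ω.out :=
    Quotient.exact (s := MulAction.orbitRel G B.obj.carrier) ((Quotient.out_eq ω).trans hω.symm)
  refine ⟨⟨ω, fun h => hb fun n hn => ?_⟩, g⁻¹, (inv_smul_eq_iff.2 hg.symm).symm, rfl⟩
  have h' := h (‹N.Normal›.conj_mem n hn g)
  rw [MulAction.mem_stabilizer_iff, ← hg, mul_smul, mul_smul, inv_smul_smul] at h'
  exact smul_left_cancel g h'

end BadOrbit

namespace IsGluing

variable {N : Subgroup G} [N.Normal] {V V' Y : AdmPt G} {π : V ⟶ V'} {ξ : V ⟶ Y}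
  {Z : V'.obj.carrier → Prop} {B : AdmPt G}

variable (N B Z) in
/-- The data that determine a map from `B` to a glued pointed `G`-set, with values in the family of
sets `y`. -/
def HomData (y : BadOrbit N B → Type u) : Type u :=
  Σ g : B ⟶ V', ∀ ω : BadOrbit N B, Z (g.hom.toFun ω.rep) → y ω

/-- The data that correspond to a map. -/
def homData (π : V ⟶ V') (ξ : V ⟶ Y) (h : B ⟶ V) :
    HomData N Z B fun ω => (fixedSet ω.stab).obj Y :=
  ⟨h ≫ π, fun ω _ => ⟨ξ.hom.toFun (h.hom.toFun ω.rep), fun a => by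
    have : (a : G) • ω.rep = ω.rep := a.2
    change (a : G) • ξ.hom.toFun (h.hom.toFun ω.rep) = ξ.hom.toFun (h.hom.toFun ω.rep)
    rw [← AdmPt.map_smul, ← AdmPt.map_smul, this]⟩⟩

/-- By equivariance the second coordinate is determined by its values at representatives of orbits,
and where `Z` fails it is forced to be distinguished. The distinguished point never satisfies `Z`,
so only bad orbits matter. -/
lemma injective_homData (H : IsGluing π ξ Z)
    (hZ : ∀ (g : G) v, Z (g • v) → Z v) (hZpt : ¬ Z V'.obj.pt)
    (hB : ∀ b, b = B.obj.pt ∨ ¬ N ≤ MulAction.stabilizer G b) :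
    Function.Injective (homData (N := N) (Z := Z) (B := B) π ξ) := by
  intro h h' heq
  obtain ⟨h₁, h₂⟩ := Sigma.mk.inj heq
  refine H.hom_ext h₁ (AdmPt.hom_ext fun b => ?_)
  have hval (f : B ⟶ V) (b) : ξ.hom.toFun (f.hom.toFun b) = Y.obj.pt ∨
      Z (π.hom.toFun (f.hom.toFun b)) := (H.mem_iff _ _).1 ⟨f.hom.toFun b, rfl, rfl⟩
  change ξ.hom.toFun (h.hom.toFun b) = ξ.hom.toFun (h'.hom.toFun b)
  by_cases hz : Z (π.hom.toFun (h.hom.toFun b))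
  · have hb : ¬ N ≤ MulAction.stabilizer G b := (hB b).resolve_left fun hb => hZpt (by
      rw [hb] at hz
      exact (h ≫ π).hom.map_pt ▸ hz)
    obtain ⟨ω, g, rfl, -⟩ := BadOrbit.exists_rep b hb
    have hz' : Z ((h ≫ π).hom.toFun ω.rep) := hZ g _ (by
      rw [← AdmPt.map_smul]
      exact hz)
    have key : ∀ (g g' : B ⟶ V') (e : g = g')
        (y : ∀ ω : BadOrbit N B, Z (g.hom.toFun ω.rep) → (fixedSet ω.stab).obj Y)
        (y' : ∀ ω : BadOrbit N B, Z (g'.hom.toFun ω.rep) → (fixedSet ω.stab).obj Y), y ≍ y' →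
        ∀ ω (hω : Z (g.hom.toFun ω.rep)) (hω' : Z (g'.hom.toFun ω.rep)), y ω hω = y' ω hω' := by
      rintro g _ rfl y _ ⟨⟩ ω _ _
      rfl
    have := congrArg Subtype.val (key _ _ h₁ _ _ h₂ ω hz' (h₁ ▸ hz'))
    rw [AdmPt.map_smul, AdmPt.map_smul, AdmPt.map_smul, AdmPt.map_smul]
    exact congrArg (g • ·) this
  · have hz' : ¬ Z (π.hom.toFun (h'.hom.toFun b)) := by
      rwa [← AdmPt.comp_apply, ← AdmPt.congr_apply h₁ b]
    rw [(hval h b).resolve_right hz, (hval h' b).resolve_right hz']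

-- The second coordinate is extended from representatives by the action; this is well defined
-- because each prescribed value is fixed by the stabilizer of the representative.
open Classical in
lemma surjective_homData (H : IsGluing π ξ Z)
    (hZ : ∀ (g : G) v, Z (g • v) → Z v) (hZpt : ¬ Z V'.obj.pt)
    (hB : ∀ b, b = B.obj.pt ∨ ¬ N ≤ MulAction.stabilizer G b) :
    Function.Surjective (homData (N := N) (Z := Z) (B := B) π ξ) := by
  rintro ⟨g, y⟩
  have hbad (b : B.obj.carrier) (hz : Z (g.hom.toFun b)) : ¬ N ≤ MulAction.stabilizer G b :=
    (hB b).resolve_left fun hb => hZpt (by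
      rw [hb] at hz
      exact g.hom.map_pt ▸ hz)
  have hZrep {b : B.obj.carrier} {a : G} {ω : BadOrbit N B} (hb : b = a • ω.rep)
      (hz : Z (g.hom.toFun b)) : Z (g.hom.toFun ω.rep) := by
    rw [hb, AdmPt.map_smul] at hz
    exact hZ a _ hz
  choose ω a ha ha' using fun b : {b // Z (g.hom.toFun b)} =>
    BadOrbit.exists_rep (N := N) b.1 (hbad b.1 b.2)
  let e (b : B.obj.carrier) : Y.obj.carrier :=
    if hz : Z (g.hom.toFun b) then
      a ⟨b, hz⟩ • (y (ω ⟨b, hz⟩) (hZrep (ha ⟨b, hz⟩) hz)).1 else Y.obj.pt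
  -- Independence of the group element that carries the representative to a given point.
  have aux (ω₁ ω₂ : BadOrbit N B) (h : ω₁ = ω₂) (d c : G) (h₁ : Z (g.hom.toFun ω₁.rep))
      (h₂ : Z (g.hom.toFun ω₂.rep)) (hdc : d • ω₁.rep = c • ω₂.rep) :
      d • (y ω₁ h₁).1 = c • (y ω₂ h₂).1 := by
    subst h
    have hmem : c⁻¹ * d ∈ ω₁.stab := by
      rw [BadOrbit.stab, MulAction.mem_stabilizer_iff, mul_smul, hdc, inv_smul_smul]
    have : (c⁻¹ * d) • (y ω₁ h₁).1 = (y ω₁ h₁).1 := (y ω₁ h₁).2 ⟨_, hmem⟩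
    rwa [mul_smul, inv_smul_eq_iff] at this
  have he (b : B.obj.carrier) (hz : Z (g.hom.toFun b)) (c : G) (ω' : BadOrbit N B)
      (hb : b = c • ω'.rep) (hω : Quotient.mk (MulAction.orbitRel G B.obj.carrier) b = ω'.1) :
      e b = c • (y ω' (hZrep hb hz)).1 :=
    (dif_pos hz).trans (aux _ _ (Subtype.ext ((ha' ⟨b, hz⟩).symm.trans hω)) _ _ _ _
      ((ha ⟨b, hz⟩).symm.trans hb))
  have he' (b : B.obj.carrier) (hz : ¬ Z (g.hom.toFun b)) : e b = Y.obj.pt := dif_neg hz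
  have h₁ (c : G) (b : B.obj.carrier) : e (c • b) = c • e b := by
    by_cases hz : Z (g.hom.toFun b)
    · have hz' : Z (g.hom.toFun (c • b)) := hZ c⁻¹ _ (by
        rw [← AdmPt.map_smul, inv_smul_smul]
        exact hz)
      have hb := ha ⟨b, hz⟩
      have hq : Quotient.mk (MulAction.orbitRel G B.obj.carrier) (c • b) =
          Quotient.mk (MulAction.orbitRel G B.obj.carrier) b :=
        Quotient.sound (s := MulAction.orbitRel G B.obj.carrier) ⟨c, rfl⟩
      rw [he b hz _ (ω ⟨b, hz⟩) hb (ha' ⟨b, hz⟩), smul_smul]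
      exact he (c • b) hz' _ (ω ⟨b, hz⟩) (by rw [mul_smul, ← hb]) (hq.trans (ha' ⟨b, hz⟩))
    · have hz' : ¬ Z (g.hom.toFun (c • b)) := fun h => hz (hZ c _ (by
        rwa [← AdmPt.map_smul]))
      rw [he' b hz, he' _ hz', Y.obj.smul_pt]
  have h₂ (b : B.obj.carrier) : e b = Y.obj.pt ∨ Z (g.hom.toFun b) := by
    by_cases hz : Z (g.hom.toFun b)
    · exact Or.inr hz
    · exact Or.inl (he' b hz)
  obtain ⟨h, hh, hh'⟩ := H.exists_lift g e h₁ h₂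
    (he' _ (by rwa [show g.hom.toFun B.obj.pt = V'.obj.pt from g.hom.map_pt]))
  subst hh
  refine ⟨h, congrArg (Sigma.mk _) (funext fun ω' => funext fun hz => Subtype.ext ?_)⟩
  refine (hh' ω'.rep).trans ((he _ hz 1 ω' (one_smul G _).symm (Quotient.out_eq _)).trans ?_)
  rw [one_smul]

end IsGluing

end Gluing

/-! ### Homology of mapping sets into smash products -/

section Smash

open Limits

variable {G : Type u} [Group G]

lemma PtGSet.smashMk_eq_iff (S T : PtGSet G) (s s' : S.carrier) (t t' : T.carrier) :
    smashMk S T s t = smashMk S T s' t' ↔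
      (s = s' ∧ t = t') ∨ ((s = S.pt ∨ t = T.pt) ∧ (s' = S.pt ∨ t' = T.pt)) :=
  ⟨fun h => (Quotient.exact (s := smashSetoid S T) h).imp Prod.ext_iff.1 id,
    fun h => Quotient.sound (s := smashSetoid S T) (h.imp Prod.ext_iff.2 id)⟩

lemma PtGSet.smul_eq_pt_iff (S : PtGSet G) (g : G) (s : S.carrier) : g • s = S.pt ↔ s = S.pt := by
  rw [← smul_left_cancel_iff g (x := s), S.smul_pt]

lemma PtGSet.exists_smashMk (S T : PtGSet G) (v : (smash S T).carrier) :
    ∃ s t, v = smashMk S T s t := by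
  obtain ⟨⟨s, t⟩, rfl⟩ := Quotient.exists_rep v
  exact ⟨s, t, rfl⟩

/-- The smash product with a fixed factor. -/
abbrev smashLeft (S : AdmPt G) : AdmPt G ⥤ AdmPt G := Prod.sectR S (AdmPt G) ⋙ smashFunctor G

variable (S Y : AdmPt G) (m : ℕ)

/-- The map that collapses `Y` in the smash product with the whiskered pointed `G`-set. -/
def smashWhiskerFst : (smashLeft S).obj (whiskerRel Y m).toAdm ⟶
    (smashLeft S).obj (wedgeRel (pointSet G) m).toAdm :=
  (smashLeft S).map (InvRel.map (toPointSet _) id (fun _ _ _ => Or.inl rfl) rfl)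

open Classical in
/-- The map to `Y` that collapses the whisker and forgets the other factor of a smash product. -/
def smashWhiskerSnd : (smashLeft S).obj (whiskerRel Y m).toAdm ⟶ Y := ObjectProperty.homMk
  { toFun := Quotient.lift (s := PtGSet.smashSetoid S.obj (whiskerRel Y m).toPtGSet)
      (fun p => if p.1 = S.obj.pt then Y.obj.pt else p.2.1.1) (by
        have aux (p : S.obj.carrier × (whiskerRel Y m).toPtGSet.carrier)
            (h : p.1 = S.obj.pt ∨ p.2 = (whiskerRel Y m).toPtGSet.pt) :
            (if p.1 = S.obj.pt then Y.obj.pt else p.2.1.1) = Y.obj.pt := by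
          rcases h with h | h
          · exact if_pos h
          · rw [h]
            exact ite_self _
        rintro p q (rfl | ⟨h, h'⟩)
        · rfl
        · exact (aux p h).trans (aux q h').symm)
    map_smul := by
      rintro g ⟨s, p⟩
      change (if g • s = S.obj.pt then Y.obj.pt else g • p.1.1) =
        g • (if s = S.obj.pt then Y.obj.pt else p.1.1)
      have := S.obj.smul_eq_pt_iff g s
      by_cases h : s = S.obj.pt
      · exact (if_pos (this.2 h)).trans
          ((Y.obj.smul_pt g).symm.trans (congrArg (g • ·) (if_pos h).symm))
      · exact (if_neg (mt this.1 h)).trans (congrArg (g • ·) (if_neg h).symm)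
    map_pt := if_pos rfl }

/-- The elements of the smash product over the free end of the whisker. -/
def OverFreeEnd (v : ((smashLeft S).obj (wedgeRel (pointSet G) m).toAdm).obj.carrier) : Prop :=
  ∃ s ≠ S.obj.pt, v = PtGSet.smashMk S.obj (wedgeRel (pointSet G) m).toPtGSet s
    ⟨(⟨⟩, LastSets.zero m), Or.inl rfl⟩

lemma overFreeEnd_of_smul (g : G)
    (v : ((smashLeft S).obj (wedgeRel (pointSet G) m).toAdm).obj.carrier)
    (h : OverFreeEnd S m (g • v)) : OverFreeEnd S m v := by
  obtain ⟨s, hs, h⟩ := h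
  exact ⟨g⁻¹ • s, fun h' => hs ((S.obj.smul_eq_pt_iff _ _).1 h'), eq_inv_smul_iff.2 h⟩

/-- This needs the two ends to be distinct, hence an ordinal with at least two elements. The functor
`κ` produces only such ordinals. -/
lemma not_overFreeEnd_pt : ¬ OverFreeEnd S (m + 1)
    ((smashLeft S).obj (wedgeRel (pointSet G) (m + 1)).toAdm).obj.pt := by
  rintro ⟨s, hs, h⟩
  rcases (PtGSet.smashMk_eq_iff _ _ _ _ _ _).1 h with ⟨h, -⟩ | ⟨-, h | h⟩
  · exact hs h.symm
  · exact hs h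
  · exact LastSets.zero_ne_one m (congrArg (fun t => t.1.2) h)

lemma smashMk_whisker_eq_pt (s : S.obj.carrier)
    (p : (whiskerRel Y (m + 1)).toPtGSet.carrier) (h : s = S.obj.pt ∨ p.1.2 = LastSets.one (m + 1)) :
    PtGSet.smashMk S.obj (whiskerRel Y (m + 1)).toPtGSet s p =
      ((smashLeft S).obj (whiskerRel Y (m + 1)).toAdm).obj.pt := by
  refine PtGSet.smashMk_eq_pt _ _ _ _ (h.imp id fun h => Subtype.ext (Prod.ext ?_ h))
  exact p.2.resolve_right fun h' => LastSets.zero_ne_one m (h'.symm.trans h)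

lemma exists_smashMk_whisker (v : ((smashLeft S).obj (whiskerRel Y m).toAdm).obj.carrier) :
    ∃ (s : S.obj.carrier) (p : (whiskerRel Y m).toPtGSet.carrier),
      v = PtGSet.smashMk S.obj (whiskerRel Y m).toPtGSet s p :=
  PtGSet.exists_smashMk _ _ v

/-- A point `s ∧ (y, U)` with `s` non-distinguished is recovered from `s ∧ U` and `y`, and `y` can
be non-distinguished only when `U` is the end `zero` to which `Y` is attached. Moving the
distinguished point away from `Y` is what makes this hold. -/
lemma isGluing_smashWhisker : IsGluing (smashWhiskerFst S Y (m + 1)) (smashWhiskerSnd S Y (m + 1))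
    (OverFreeEnd S (m + 1)) where
  inj v w h₁ h₂ := by
    classical
    obtain ⟨s, p, rfl⟩ := exists_smashMk_whisker S Y (m + 1) v
    obtain ⟨s', p', rfl⟩ := exists_smashMk_whisker S Y (m + 1) w
    let q : (wedgeRel (pointSet G) (m + 1)).toPtGSet.carrier := ⟨(⟨⟩, p.1.2), Or.inl rfl⟩
    let q' : (wedgeRel (pointSet G) (m + 1)).toPtGSet.carrier := ⟨(⟨⟩, p'.1.2), Or.inl rfl⟩
    have h₃ : PtGSet.smashMk S.obj (wedgeRel (pointSet G) (m + 1)).toPtGSet s q =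
      PtGSet.smashMk S.obj (wedgeRel (pointSet G) (m + 1)).toPtGSet s' q' := h₁
    rcases (PtGSet.smashMk_eq_iff _ _ _ _ _ _).1 h₃ with ⟨hss, hU⟩ | ⟨h, h'⟩
    · subst hss
      by_cases hs : s = S.obj.pt
      · exact (smashMk_whisker_eq_pt S Y m s p (Or.inl hs)).trans
          (smashMk_whisker_eq_pt S Y m s p' (Or.inl hs)).symm
      · have h₃ : (if s = S.obj.pt then Y.obj.pt else p.1.1) =
          if s = S.obj.pt then Y.obj.pt else p'.1.1 := h₂
        rw [if_neg hs, if_neg hs] at h₃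
        have : p = p' := Subtype.ext (Prod.ext h₃ (congrArg (fun t => t.1.2) hU))
        rw [this]
    · refine (smashMk_whisker_eq_pt S Y m s p (h.imp id fun h => ?_)).trans
        (smashMk_whisker_eq_pt S Y m s' p' (h'.imp id fun h => ?_)).symm
      · exact congrArg (fun t => t.1.2) h
      · exact congrArg (fun t => t.1.2) h
  mem_iff v' y := by
    classical
    constructor
    · rintro ⟨v, rfl, rfl⟩
      obtain ⟨s, p, rfl⟩ := exists_smashMk_whisker S Y (m + 1) v
      by_cases hs : s = S.obj.pt
      · exact Or.inl (if_pos hs)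
      · refine p.2.imp (fun h => (if_neg hs).trans h) fun h => ⟨s, hs, ?_⟩
        exact congrArg (PtGSet.smashMk S.obj (wedgeRel (pointSet G) (m + 1)).toPtGSet s)
          (Subtype.ext (Prod.ext rfl h))
    · rintro (rfl | ⟨s, hs, rfl⟩)
      · obtain ⟨s, p, rfl⟩ := PtGSet.exists_smashMk _ _ v'
        exact ⟨PtGSet.smashMk S.obj (whiskerRel Y (m + 1)).toPtGSet s
          ⟨(Y.obj.pt, p.1.2), Or.inl rfl⟩, rfl, ite_self _⟩
      · exact ⟨PtGSet.smashMk S.obj (whiskerRel Y (m + 1)).toPtGSet s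
          ⟨(y, LastSets.zero _), Or.inr rfl⟩, rfl, if_neg hs⟩

/-- A map to the smash product with the one-element pointed set is unique. -/
lemma subsingleton_hom_smash_pointSet (T : AdmPt G) :
    Subsingleton (T ⟶ (smashLeft S).obj (pointSet G)) where
  allEq f g := AdmPt.hom_ext fun t => by
    have (v : ((smashLeft S).obj (pointSet G)).obj.carrier) :
        v = ((smashLeft S).obj (pointSet G)).obj.pt := by
      obtain ⟨s, p, rfl⟩ := PtGSet.exists_smashMk _ _ v
      exact PtGSet.smashMk_eq_pt _ _ _ _ (Or.inr rfl)
    rw [this (f.hom.toFun t), this (g.hom.toFun t)]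

instance nonempty_hom_smash_pointSet (T : AdmPt G) :
    Nonempty (T ⟶ (smashLeft S).obj (pointSet G)) :=
  ⟨ObjectProperty.homMk
    { toFun := fun _ => PtGSet.pt _
      map_smul := fun g _ => (PtGSet.smul_pt _ g).symm
      map_pt := rfl }⟩

end Smash

/-! ### Splitting a pointed `G`-set into its `N`-fixed points and the rest -/

section BadPart

variable {G : Type u} [Group G] (N : Subgroup G)

lemma le_stabilizer_smul_iff [N.Normal] {A : Type u} [MulAction G A] (g : G) (a : A) :
    N ≤ MulAction.stabilizer G (g • a) ↔ N ≤ MulAction.stabilizer G a := by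
  suffices ∀ (g : G) (a : A), N ≤ MulAction.stabilizer G a → N ≤ MulAction.stabilizer G (g • a) from
    ⟨fun h => by simpa using this g⁻¹ _ h, this g a⟩
  intro g a h n hn
  have h₁ : (g⁻¹ * n * g) • a = a := h (by simpa using ‹N.Normal›.conj_mem n hn g⁻¹)
  rw [MulAction.mem_stabilizer_iff, smul_smul]
  rw [mul_assoc, mul_smul, inv_smul_eq_iff] at h₁
  exact h₁

variable [N.Normal]

/-- The relation that defines the part of a pointed `G`-set without `N`-fixed points. -/
def badRel (T : AdmPt G) : InvRel T PUnit.{u + 1} where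
  rel t _ := t = T.obj.pt ∨ ¬ N ≤ MulAction.stabilizer G t
  rel_smul g t _ h := h.imp (T.obj.smul_eq_pt_iff g t).2 fun h h' =>
    h ((le_stabilizer_smul_iff N g t).1 h')
  pt := ⟨⟩
  rel_pt := Or.inl rfl

/-- The part of a pointed `G`-set without `N`-fixed points. -/
abbrev badPart (T : AdmPt G) : AdmPt G := (badRel N T).toAdm

lemma badPart_eq_or (T : AdmPt G) (b : (badPart N T).obj.carrier) :
    b = (badPart N T).obj.pt ∨ ¬ N ≤ MulAction.stabilizer G b :=
  b.2.imp (fun h => Subtype.ext (Prod.ext h rfl)) fun h h' => h fun _ hn =>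
    congrArg (fun t : (badRel N T).toPtGSet.carrier => t.1.1) (h' hn)

variable [N.FiniteIndex]

lemma smul_phi_lam (T : AdmPt G) (t : ((phi N ⋙ lam N).obj T).obj.carrier) (n : G) (hn : n ∈ N) :
    n • t = t := Subtype.ext (t.2 ⟨n, hn⟩)

-- As a pointed `G`-set, `T` is the wedge of `T^N` and its bad part: normality of `N` makes both
-- pieces invariant, and they meet only in the distinguished point.
open Classical in
lemma bijective_hom_pair (T U : AdmPt G) :
    Function.Bijective (fun f : T ⟶ U => ((fixedIncl N).app T ≫ f, (badRel N T).fst ≫ f)) := by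
  constructor
  · intro f f' h
    obtain ⟨h₁, h₂⟩ := Prod.ext_iff.1 h
    refine AdmPt.hom_ext fun t => ?_
    by_cases ht : N ≤ MulAction.stabilizer G t
    · exact AdmPt.congr_apply h₁ ⟨t, fun n => ht n.2⟩
    · exact AdmPt.congr_apply h₂ ⟨(t, ⟨⟩), Or.inr ht⟩
  · rintro ⟨f, f'⟩
    let F (t : T.obj.carrier) : U.obj.carrier :=
      if h : N ≤ MulAction.stabilizer G t then f.hom.toFun ⟨t, fun n => h n.2⟩
      else f'.hom.toFun ⟨(t, ⟨⟩), Or.inr h⟩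
    have h₁ (t) (h : N ≤ MulAction.stabilizer G t) : F t = f.hom.toFun ⟨t, fun n => h n.2⟩ :=
      dif_pos h
    have h₂ (t) (h : ¬ N ≤ MulAction.stabilizer G t) : F t = f'.hom.toFun ⟨(t, ⟨⟩), Or.inr h⟩ :=
      dif_neg h
    have h₀ : F T.obj.pt = U.obj.pt := (h₁ _ fun n _ => T.obj.smul_pt n).trans f.hom.map_pt
    refine ⟨ObjectProperty.homMk
      { toFun := F
        map_smul := fun g t => ?_
        map_pt := h₀ }, Prod.ext (AdmPt.hom_ext fun t => ?_) (AdmPt.hom_ext fun t => ?_)⟩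
    · by_cases ht : N ≤ MulAction.stabilizer G t
      · exact (h₁ _ ((le_stabilizer_smul_iff N g t).2 ht)).trans
          ((AdmPt.map_smul f g ⟨t, fun n => ht n.2⟩).trans (congrArg (g • ·) (h₁ _ ht).symm))
      · exact (h₂ _ (mt (le_stabilizer_smul_iff N g t).1 ht)).trans
          ((AdmPt.map_smul f' g ⟨(t, ⟨⟩), Or.inr ht⟩).trans (congrArg (g • ·) (h₂ _ ht).symm))
    · exact h₁ t.1 fun n hn => t.2 ⟨n, hn⟩
    · by_cases ht : N ≤ MulAction.stabilizer G t.1.1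
      · have hb : t.1.1 = T.obj.pt := t.2.resolve_right (not_not_intro ht)
        have hb' : t = (badPart N T).obj.pt := Subtype.ext (Prod.ext hb rfl)
        rw [hb']
        exact h₀.trans f'.hom.map_pt.symm
      · exact h₂ _ ht

end BadPart

/-! ### Restriction to fixed points is a homology equivalence -/

section Restriction

open Limits

instance essentiallySmall_simplexCategory : EssentiallySmall.{u} SimplexCategoryᵒᵖ :=
  have : Small.{u} SimplexCategoryᵒᵖ :=
    small_of_injective (β := ℕ) (f := fun a => a.unop.len) fun _ _ h =>
      Opposite.unop_injective (SimplexCategory.ext h)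
  essentiallySmall_of_small_of_locallySmall _

/-- The initial object of `(Δᵒᵖ)²`. -/
abbrev BiDelta.zero : BiDelta :=
  (Opposite.op (SimplexCategory.mk 0), Opposite.op (SimplexCategory.mk 0))

/-- The one-element ordinal is initial in `Δᵒᵖ`. -/
def isInitialOpZero : IsInitial (Opposite.op (SimplexCategory.mk 0)) :=
  initialOpOfTerminal SimplexCategory.isTerminalZero

/-- The pair of one-element ordinals is initial in `(Δᵒᵖ)²`. -/
def isInitialBiDeltaZero : IsInitial BiDelta.zero :=
  IsInitial.ofUniqueHom (fun q => (isInitialOpZero.to q.1, isInitialOpZero.to q.2))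
    fun _ _ => Prod.ext (isInitialOpZero.hom_ext _ _) (isInitialOpZero.hom_ext _ _)

lemma isIso_of_bijective_app {I : Type u₁} [Category.{v₁} I] {V W : I ⥤ Type u} (α : V ⟶ W)
    (h : ∀ i, Function.Bijective (α.app i)) : IsIso α :=
  have := fun i => (isIso_iff_bijective (α.app i)).2 (h i)
  NatIso.isIso_of_isIso_app α

lemma isHomologyEquiv_of_bijective_app {R : Type u} [Ring R] {I : Type u₁} [Category.{v₁} I]
    {V W : I ⥤ Type u} (α : V ⟶ W)
    (h : ∀ i, Function.Bijective (α.app i)) : IsHomologyEquiv R α :=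
  have := isIso_of_bijective_app α h
  isHomologyEquiv_of_isIso α

variable {G : Type u} [Group G]

/-- The functor corepresented by an admissible pointed `G`-set. -/
abbrev homFun (T : AdmPt G) : AdmPt G ⥤ Type u := coyoneda.obj (Opposite.op T)

/-- The functor of pairs of morphisms. -/
def pairHom (A B : AdmPt G) : AdmPt G × AdmPt G ⥤ Type u where
  obj q := (A ⟶ q.1) × (B ⟶ q.2)
  map f := TypeCat.ofHom fun p => (p.1 ≫ f.1, p.2 ≫ f.2)
  map_id q := by
    refine ConcreteCategory.hom_ext _ _ fun p => ?_
    exact Prod.ext (Category.comp_id p.1) (Category.comp_id p.2)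
  map_comp f g := by
    refine ConcreteCategory.hom_ext _ _ fun p => ?_
    exact Prod.ext (Category.assoc p.1 f.1 g.1).symm (Category.assoc p.2 f.2 g.2).symm

lemma IsGluing.homData_ext {N : Subgroup G} {V' : AdmPt G} {Z : V'.obj.carrier → Prop} {B : AdmPt G} {y : BadOrbit N B → Type u} {p q : HomData N Z B y}
    (h₁ : p.1 = q.1) (h₂ : ∀ ω hp hq, p.2 ω hp = q.2 ω hq) : p = q := by
  obtain ⟨g, p⟩ := p
  obtain ⟨g', q⟩ := q
  obtain rfl : g = g' := h₁
  exact congrArg (Sigma.mk g) (funext fun ω => funext fun hω => h₂ ω hω hω)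

variable (N : Subgroup G)

/-- The functor of pairs of a morphism and the data that determine a morphism to a glued pointed
`G`-set. -/
def pairHomData (A B : AdmPt G) {V' : AdmPt G} (Z : V'.obj.carrier → Prop) :
    AdmPt G × (BadOrbit N B → Type u) ⥤ Type u where
  obj q := (A ⟶ q.1) × IsGluing.HomData N Z B q.2
  map f := TypeCat.ofHom fun p => (p.1 ≫ f.1, ⟨p.2.1, fun ω hω => f.2 ω (p.2.2 ω hω)⟩)
  map_id q := by
    refine ConcreteCategory.hom_ext _ _ fun p => ?_
    exact Prod.ext (Category.comp_id p.1) rfl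
  map_comp f g := by
    refine ConcreteCategory.hom_ext _ _ fun p => ?_
    exact Prod.ext (Category.assoc p.1 f.1 g.1).symm rfl

section Adapted

variable {X : BiDelta ⥤ AdmPt G}

/-- A bisimplicial pointed `G`-set glued from a constant one and `X`. -/
structure IsGluingFamily {V' : AdmPt G} (V : BiDelta ⥤ AdmPt G)
    (π : V ⟶ (Functor.const BiDelta).obj V') (ξ : V ⟶ X) (Z : V'.obj.carrier → Prop) : Prop where
  isGluing : ∀ n, IsGluing (V' := V') (π.app n) (ξ.app n) Z
  of_smul : ∀ (g : G) v, Z (g • v) → Z v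
  not_pt : ¬ Z V'.obj.pt

variable (X) in
/-- The family of fixed point sets for the bad orbits. -/
abbrev badFixed (B : AdmPt G) : BiDelta ⥤ (BadOrbit N B → Type u) :=
  Functor.pi' fun ω => X ⋙ fixedSet ω.stab

variable {V' : AdmPt G} {V : BiDelta ⥤ AdmPt G} {π : V ⟶ (Functor.const BiDelta).obj V'}
  {ξ : V ⟶ X} {Z : V'.obj.carrier → Prop}

variable (A B : AdmPt G)

variable (π ξ Z) in
/-- The map to data for maps to the glued pointed `G`-set. -/
def toPairHomData : V.prod' V ⋙ pairHom A B ⟶ V.prod' (badFixed N X B) ⋙ pairHomData N A B Z where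
  app n := TypeCat.ofHom fun p => (p.1, IsGluing.homData (V' := V') (π.app n) (ξ.app n) p.2)
  naturality m n f := by
    refine ConcreteCategory.hom_ext _ _ fun p => ?_
    refine Prod.ext rfl (IsGluing.homData_ext (N := N) (Z := Z) (B := B) ?_ ?_)
    · exact (Category.assoc _ _ _).trans
        (congrArg (p.2 ≫ ·) ((π.naturality f).trans (Category.comp_id _)))
    · intro ω _ _
      exact Subtype.ext (AdmPt.congr_apply (ξ.naturality f) _)

variable (V Z) in
/-- The map to data for maps to the glued pointed `G`-set, for the trivial glued part. -/
def toPairHomDataConst : V.prod' ((Functor.const BiDelta).obj V') ⋙ pairHom A B ⟶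
    V.prod' ((Functor.const BiDelta).obj fun _ => PUnit.{u + 1}) ⋙ pairHomData N A B Z where
  app n := TypeCat.ofHom fun p => (p.1, ⟨p.2, fun _ _ => ⟨⟩⟩)
  naturality m n f := by
    refine ConcreteCategory.hom_ext _ _ fun p => ?_
    refine Prod.ext rfl (IsGluing.homData_ext (N := N) (Z := Z) (B := B) ?_ ?_)
    · exact Category.comp_id p.2
    · intros
      rfl

variable {N A B}

lemma bijective_toPairHomDataConst (n : BiDelta) :
    Function.Bijective ((toPairHomDataConst N V Z A B).app n) := by
  show Function.Bijective (Prod.map (id : (A ⟶ V.obj n) → _)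
    (fun g : B ⟶ V' => (⟨g, fun _ _ => ⟨⟩⟩ : IsGluing.HomData N Z B fun _ => PUnit.{u + 1})))
  exact Function.Bijective.prodMap Function.bijective_id
    ⟨fun _ _ h => congrArg Sigma.fst h, fun p => ⟨p.1, IsGluing.homData_ext rfl fun _ _ _ => rfl⟩⟩

variable [N.Normal]

lemma bijective_toPairHomData (hV : IsGluingFamily V π ξ Z)
    (hB : ∀ b, b = B.obj.pt ∨ ¬ N ≤ MulAction.stabilizer G b) (n : BiDelta) :
    Function.Bijective ((toPairHomData N π ξ Z A B).app n) := by
  show Function.Bijective (Prod.map (id : (A ⟶ V.obj n) → _)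
    (IsGluing.homData (N := N) (Z := Z) (B := B) (V' := V') (π.app n) (ξ.app n)))
  exact Function.Bijective.prodMap Function.bijective_id
    ⟨IsGluing.injective_homData (hV.isGluing n) hV.of_smul hV.not_pt hB,
      IsGluing.surjective_homData (hV.isGluing n) hV.of_smul hV.not_pt hB⟩

variable [N.FiniteIndex]

/-- Because `X^N` is isomorphic to a constant object, its transition maps are invertible, although
those of `X` need not be. -/
lemma IsAdapted.exists_inv (hX : IsAdapted N X) {m n : BiDelta} (f : m ⟶ n) :
    ∃ k, (X ⋙ phi N).map f ≫ k = 𝟙 _ ∧ k ≫ (X ⋙ phi N).map f = 𝟙 _ := by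
  let e := hX.fixed_iso.some
  have h : (X ⋙ phi N).map f ≫ e.hom.app n = e.hom.app m :=
    (e.hom.naturality f).trans (Category.comp_id _)
  have h' : e.inv.app m ≫ (X ⋙ phi N).map f = e.inv.app n :=
    (e.inv.naturality f).symm.trans (Category.id_comp _)
  refine ⟨e.hom.app n ≫ e.inv.app m, ?_, ?_⟩
  · exact (Category.assoc _ _ _).symm.trans
      ((congrArg (· ≫ e.inv.app m) h).trans (e.hom_inv_id_app m))
  · exact (Category.assoc _ _ _).trans
      ((congrArg (e.hom.app n ≫ ·) h').trans (e.hom_inv_id_app n))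

lemma FinPt.congr_apply {W : Type u} [Group W] {S T : FinPt W} {f g : S ⟶ T} (h : f = g)
    (s : S.obj.carrier) : f.hom.toFun s = g.hom.toFun s := h ▸ rfl

lemma IsAdapted.injOn_fixed (hX : IsAdapted N X) {m n : BiDelta} (f : m ⟶ n) (y y' : (X.obj m).obj.carrier)
    (hy : ∀ n ∈ N, n • y = y) (hy' : ∀ n ∈ N, n • y' = y')
    (h : (X.map f).hom.toFun y = (X.map f).hom.toFun y') : y = y' := by
  obtain ⟨k, hk, -⟩ := hX.exists_inv f
  let z : ((X ⋙ phi N).obj m).obj.carrier := ⟨y, fun n => hy n n.2⟩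
  let z' : ((X ⋙ phi N).obj m).obj.carrier := ⟨y', fun n => hy' n n.2⟩
  have : ((X ⋙ phi N).map f).hom.toFun z = ((X ⋙ phi N).map f).hom.toFun z' := Subtype.ext h
  have : z = z' := (FinPt.congr_apply hk z).symm.trans
    ((congrArg k.hom.toFun this).trans (FinPt.congr_apply hk z'))
  exact congrArg Subtype.val this

lemma IsAdapted.surjOn_fixed (hX : IsAdapted N X) {m n : BiDelta} (f : m ⟶ n) (y : (X.obj n).obj.carrier)
    (hy : ∀ n ∈ N, n • y = y) :
    ∃ z, (∀ n ∈ N, n • z = z) ∧ (X.map f).hom.toFun z = y := by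
  obtain ⟨k, -, hk⟩ := hX.exists_inv f
  let w : ((X ⋙ phi N).obj n).obj.carrier := ⟨y, fun n => hy n n.2⟩
  exact ⟨(k.hom.toFun w).1, fun n hn => (k.hom.toFun w).2 ⟨n, hn⟩,
    congrArg Subtype.val (FinPt.congr_apply hk w)⟩

variable (V) in
/-- The map from the initial value. -/
def fromZero : (Functor.const BiDelta).obj (V.obj BiDelta.zero) ⟶ V where
  app n := V.map (isInitialBiDeltaZero.to n)
  naturality m n f := by
    refine (Category.id_comp _).trans ?_
    rw [← V.map_comp, isInitialBiDeltaZero.hom_ext (isInitialBiDeltaZero.to m ≫ f)]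

/-- Maps from `A` see only `N`-fixed points. The base `V'` does not vary with the bisimplicial
degree, and the `N`-fixed points of `X` do not either, so `Hom(A, V)` is constant. -/
lemma bijective_fromZero (hX : IsAdapted N X) (hV : IsGluingFamily V π ξ Z) {A : AdmPt G}
    (hA : ∀ (a : A.obj.carrier), ∀ n ∈ N, n • a = a) (n : BiDelta) :
    Function.Bijective (fun g : A ⟶ V.obj BiDelta.zero => g ≫ (fromZero V).app n) :=
  (hV.isGluing _).bijective_comp hA (hV.isGluing n) _ (X.map (isInitialBiDeltaZero.to n))
    ((π.naturality _).trans (Category.comp_id _)) (ξ.naturality _)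
    (hX.injOn_fixed _) (hX.surjOn_fixed _)

lemma bijective_fromZero_pairHomData (hX : IsAdapted N X) (hV : IsGluingFamily V π ξ Z)
    (hA : ∀ (a : A.obj.carrier), ∀ n ∈ N, n • a = a) (Y : BiDelta ⥤ (BadOrbit N B → Type u))
    (n : BiDelta) : Function.Bijective ((Functor.whiskerRight (NatTrans.prod' (fromZero V) (𝟙 Y))
      (pairHomData N A B Z)).app n) := by
  have h : Function.Bijective (Prod.map (fun g : A ⟶ V.obj BiDelta.zero => g ≫ (fromZero V).app n)
      (id : IsGluing.HomData N Z B (Y.obj n) → _)) :=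
    (bijective_fromZero hX hV hA n).prodMap Function.bijective_id
  exact h

/-- Maps from `B` to `V` are maps to `V'` decorated with points of fixed sets `X^H` for bad
stabilizers `H`. These sets are contractible, and replacing them by points leaves the undecorated
maps to `V'`. -/
lemma isHomologyEquiv_pairHom (hX : IsAdapted N X) (hV : IsGluingFamily V π ξ Z)
    (hA : ∀ (a : A.obj.carrier), ∀ n ∈ N, n • a = a)
    (hB : ∀ b, b = B.obj.pt ∨ ¬ N ≤ MulAction.stabilizer G b) (R : Type u) [Ring R] :
    IsHomologyEquiv R (Functor.whiskerRight (NatTrans.prod' (𝟙 V) π) (pairHom A B)) := by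
  have h₁ : IsUniversalEquiv R (toPUnit (badFixed N X B)) :=
    isUniversalEquiv_toPUnit_of_biContractible _ fun ω =>
      hX.contractible _ ω.finiteIndex_stab ω.not_le_stab
  -- With the first coordinate frozen at its initial value, the data depend on the bisimplicial
  -- degree only through the family of fixed point sets, so the universal equivalence applies.
  have h₂ := h₁ (Prod.sectR (V.obj BiDelta.zero) _ ⋙ pairHomData N A B Z)
  refine (isHomologyEquiv_of_bijective_app _ (bijective_toPairHomData hV hB)).of_square'
    (isHomologyEquiv_of_bijective_app _ bijective_toPairHomDataConst)
    (α₂ := Functor.whiskerRight (NatTrans.prod' (𝟙 V) (toPUnit (badFixed N X B)))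
      (pairHomData N A B Z)) ?_ ?_
  · refine NatTrans.ext (funext fun n => ConcreteCategory.hom_ext _ _ fun p => ?_)
    exact Prod.ext rfl (IsGluing.homData_ext (N := N) (Z := Z) (B := B) rfl fun _ _ _ => rfl)
  · refine .of_square
      (isHomologyEquiv_of_bijective_app _ (bijective_fromZero_pairHomData hX hV hA _))
      (isHomologyEquiv_of_bijective_app _ (bijective_fromZero_pairHomData hX hV hA _)) ?_ h₂
    refine NatTrans.ext (funext fun n => ConcreteCategory.hom_ext _ _ fun p => ?_)
    exact Prod.ext rfl (IsGluing.homData_ext (N := N) (Z := Z) (B := B) rfl fun _ _ _ => rfl)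

end Adapted

end Restriction

/-! ### Homology of mapping sets into `S ∧ X` by way of the whisker -/

section SmashRestriction

open Limits

lemma isIso_natTrans_prod' {I : Type u₁} [Category.{v₁} I] {A : Type u₂} [Category.{v₂} A]
    {B : Type u₃} [Category.{v₃} B] {F F' : I ⥤ A} {H H' : I ⥤ B} (α : F ⟶ F') (β : H ⟶ H')
    [IsIso α] [IsIso β] : IsIso (NatTrans.prod' α β) :=
  ⟨NatTrans.prod' (inv α) (inv β),
    NatTrans.ext (funext fun i => Prod.ext (NatTrans.congr_app (IsIso.hom_inv_id α) i)
      (NatTrans.congr_app (IsIso.hom_inv_id β) i)),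
    NatTrans.ext (funext fun i => Prod.ext (NatTrans.congr_app (IsIso.inv_hom_id α) i)
      (NatTrans.congr_app (IsIso.inv_hom_id β) i))⟩

lemma isUniversalEquiv_prod' {R : Type u} [Ring R] {I : Type u₁} [Category.{v₁} I]
    {A : Type u₂} [Category.{v₂} A] {B : Type u₃} [Category.{v₃} B] {F F' : I ⥤ A} {H H' : I ⥤ B}
    (α : F ⟶ F') (β : H ⟶ H') [IsIso α] [IsIso β] : IsUniversalEquiv R (NatTrans.prod' α β) :=
  have := isIso_natTrans_prod' α β
  isUniversalEquiv_of_isIso _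

lemma isUniversalEquiv_of_sectL {R : Type u} [Ring R] {I : Type u₁} [Category.{v₁} I]
    {J : Type u₂} [Category.{v₂} J] [EssentiallySmall.{u} I] [EssentiallySmall.{u} J]
    {𝓔 : Type u₃} [Category.{v₃} 𝓔] {F H : I × J ⥤ 𝓔} (α : F ⟶ H)
    (h : ∀ j, IsUniversalEquiv R (Functor.whiskerLeft (Prod.sectL I j) α)) :
    IsUniversalEquiv R α := fun Ψ =>
  isHomologyEquiv_of_sectL _ fun j => h j Ψ

/-- A functor restricted to a slice on which it does not depend on the slice variable is
constant. -/
def sectConst {I : Type u₁} [Category.{v₁} I] {J : Type u₂} [Category.{v₂} J]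
    {𝓔 : Type u₃} [Category.{v₃} 𝓔] (i : I) (F : I ⥤ 𝓔) :
    Prod.sectR i J ⋙ CategoryTheory.Prod.fst I J ⋙ F ≅ (Functor.const J).obj (F.obj i) :=
  NatIso.ofComponents (fun _ => Iso.refl _) fun _ => by
    refine (Category.comp_id _).trans ((F.map_id i).trans (Category.comp_id _).symm)

/-- A functor restricted to a slice on which it does not depend on the slice variable is
constant. -/
def sectConst' {I : Type u₁} [Category.{v₁} I] {J : Type u₂} [Category.{v₂} J]
    {𝓔 : Type u₃} [Category.{v₃} 𝓔] (j : J) (F : J ⥤ 𝓔) :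
    Prod.sectL I j ⋙ CategoryTheory.Prod.snd I J ⋙ F ≅ (Functor.const I).obj (F.obj j) :=
  NatIso.ofComponents (fun _ => Iso.refl _) fun _ => by
    refine (Category.comp_id _).trans ((F.map_id j).trans (Category.comp_id _).symm)

variable {R : Type u} [Ring R] {G : Type u} [Group G] (X : BiDelta ⥤ AdmPt G)

/-- In each bisimplicial degree of `X` the whiskered object is a wedge with the interval and
contracts in the whisker direction alone. -/
lemma isUniversalEquiv_whiskeredFst : IsUniversalEquiv R (whiskeredFst X) := by
  refine isUniversalEquiv_of_sectL _ fun n => ?_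
  refine IsUniversalEquiv.of_square' (isUniversalEquiv_of_isIso (whiskeredIso X n).hom)
    (isUniversalEquiv_of_isIso (sectConst' n X).hom) ?_ (isUniversalEquiv_kappa (wedgeFst (X.obj n)))
  rfl

/-- The collapse of the whisker. -/
def whiskerToPoint : CategoryTheory.Prod.fst SimplexCategoryᵒᵖ BiDelta ⋙ kappa.op ⋙ wedge (pointSet G) ⟶
    (Functor.const _).obj (pointSet G) where
  app q := (wedgeFst (pointSet G)).app (kappa.op.obj q.1)
  naturality _ _ _ := rfl

/-- The whisker is collapsed in the second coordinate only. For a fixed degree of `X` both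
coordinates extend to `Δ_+ᵒᵖ`, and over `[0]_+` there is nothing left to collapse. -/
lemma isUniversalEquiv_whiskerToPoint : IsUniversalEquiv R
    (NatTrans.prod' (𝟙 (whiskered X)) (whiskerToPoint (G := G))) := by
  refine isUniversalEquiv_of_sectL _ fun n => ?_
  have : IsIso ((NatTrans.prod' (𝟙 (wedge (X.obj n))) (wedgeFst (pointSet G))).app
      (Opposite.op DeltaPlus.zero)) :=
    (isIso_prod_iff _ _).2 ⟨inferInstanceAs (IsIso (𝟙 _)), isIso_wedgeFst_zero (pointSet G)⟩
  have h := isUniversalEquiv_kappa (R := R)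
    (NatTrans.prod' (𝟙 (wedge (X.obj n))) (wedgeFst (pointSet G)))
  have h₁ : IsUniversalEquiv R
      (NatTrans.prod' (whiskeredIso X n).hom (𝟙 (kappa.op ⋙ wedge (pointSet G)))) :=
    isUniversalEquiv_prod' _ _
  have h₂ : IsUniversalEquiv R (NatTrans.prod' (whiskeredIso X n).hom
      (𝟙 ((Functor.const SimplexCategoryᵒᵖ).obj (pointSet G)))) :=
    isUniversalEquiv_prod' _ _
  refine IsUniversalEquiv.of_square' (I := SimplexCategoryᵒᵖ) (𝓔 := AdmPt G × AdmPt G)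
    (V₁ := Functor.prod' (Prod.sectL SimplexCategoryᵒᵖ n ⋙ whiskered X)
      (kappa.op ⋙ wedge (pointSet G)))
    (W₁ := Functor.prod' (Prod.sectL SimplexCategoryᵒᵖ n ⋙ whiskered X)
      ((Functor.const SimplexCategoryᵒᵖ).obj (pointSet G))) h₁ h₂ ?_ h
  exact NatTrans.ext (funext fun _ => Prod.ext
      ((Category.id_comp _).trans (Category.comp_id _).symm) rfl)

section Pairs

variable {I : Type u₁} [Category.{v₁} I]

/-- Morphisms to an admissible pointed `G`-set, as pairs of morphisms. -/
def homToPair (V : I ⥤ AdmPt G) {A B T : AdmPt G} (a : A ⟶ T) (b : B ⟶ T) :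
    V ⋙ homFun T ⟶ V.prod' V ⋙ pairHom A B where
  app i := TypeCat.ofHom fun f => (a ≫ f, b ≫ f)
  naturality i j f := by
    refine ConcreteCategory.hom_ext _ _ fun (g : T ⟶ V.obj i) => ?_
    exact Prod.ext (Category.assoc a g (V.map f)).symm (Category.assoc b g (V.map f)).symm

/-- The first component of a pair of morphisms. -/
def pairToHom (V V' : I ⥤ AdmPt G) (A B : AdmPt G) : V.prod' V' ⋙ pairHom A B ⟶ V ⋙ homFun A where
  app _ := TypeCat.ofHom fun p => p.1
  naturality _ _ _ := rfl

end Pairs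

variable (S : AdmPt G)

/-- The collapse of `X` in the smash product with the whiskered pointed `G`-set. -/
def smashWhiskered : whiskered X ⋙ smashLeft S ⟶
    CategoryTheory.Prod.fst SimplexCategoryᵒᵖ BiDelta ⋙
      kappa.op ⋙ wedge (pointSet G) ⋙ smashLeft S :=
  Functor.whiskerRight (whiskeredSnd X) (smashLeft S)

/-- The restriction of the smash product with the whiskered pointed `G`-set to a slice. -/
abbrev smashSlice (k : SimplexCategoryᵒᵖ) : BiDelta ⥤ AdmPt G :=
  Prod.sectR k BiDelta ⋙ whiskered X ⋙ smashLeft S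

/-- The collapse of `X` in the smash product with the whiskered pointed `G`-set, for a fixed
degree of the whisker. -/
def sliceFst (k : SimplexCategoryᵒᵖ) : smashSlice X S k ⟶ (Functor.const BiDelta).obj
    ((smashLeft S).obj (wedgeRel (pointSet G) (k.unop.len + 1)).toAdm) where
  app n := smashWhiskerFst S (X.obj n) (k.unop.len + 1)
  naturality m n f :=
    ((smashWhiskered X S).naturality ((𝟙 k, f) : (k, m) ⟶ (k, n))).trans
      (congrArg (smashWhiskerFst S (X.obj m) (k.unop.len + 1) ≫ ·)
        ((kappa.op ⋙ wedge (pointSet G) ⋙ smashLeft S).map_id k))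

/-- The map to `X` from the smash product with the whiskered pointed `G`-set, for a fixed
degree of the whisker. -/
def sliceSnd (k : SimplexCategoryᵒᵖ) : smashSlice X S k ⟶ X where
  app n := smashWhiskerSnd S (X.obj n) (k.unop.len + 1)
  naturality m n f := by
    classical
    refine AdmPt.hom_ext fun v => ?_
    obtain ⟨s, p, rfl⟩ := exists_smashMk_whisker S (X.obj m) (k.unop.len + 1) v
    change (if s = S.obj.pt then (X.obj n).obj.pt else (X.map f).hom.toFun p.1.1) =
      (X.map f).hom.toFun (if s = S.obj.pt then (X.obj m).obj.pt else p.1.1)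
    by_cases h : s = S.obj.pt
    · rw [if_pos h, if_pos h, (X.map f).hom.map_pt]
    · rw [if_neg h, if_neg h]

variable {X} {N : Subgroup G} [N.Normal] [N.FiniteIndex]

lemma isGluingFamily_smashSlice (k : SimplexCategoryᵒᵖ) :
    IsGluingFamily (smashSlice X S k) (sliceFst X S k) (sliceSnd X S k)
      (OverFreeEnd S (k.unop.len + 1)) where
  isGluing n := isGluing_smashWhisker S (X.obj n) k.unop.len
  of_smul := overFreeEnd_of_smul S _
  not_pt := not_overFreeEnd_pt S _

/-- The gluing description is available for each fixed whisker degree, so the derived colimit is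
taken over the bisimplicial directions first. -/
lemma isHomologyEquiv_pairHom_whiskered (hX : IsAdapted N X) {A B : AdmPt G}
    (hA : ∀ (a : A.obj.carrier), ∀ n ∈ N, n • a = a)
    (hB : ∀ b, b = B.obj.pt ∨ ¬ N ≤ MulAction.stabilizer G b) :
    IsHomologyEquiv R (Functor.whiskerRight
      (NatTrans.prod' (𝟙 (whiskered X ⋙ smashLeft S)) (smashWhiskered X S)) (pairHom A B)) := by
  refine isHomologyEquiv_of_sectR _ fun k => ?_
  have h := isHomologyEquiv_pairHom hX (isGluingFamily_smashSlice S k) hA hB R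
  have h₁ : IsUniversalEquiv R (NatTrans.prod' (𝟙 (smashSlice X S k))
      (sectConst (J := BiDelta) k (kappa.op ⋙ wedge (pointSet G) ⋙ smashLeft S)).hom) :=
    isUniversalEquiv_prod' _ _
  refine IsHomologyEquiv.of_square' (isHomologyEquiv_of_isIso (𝟙 _)) (h₁ (pairHom A B)) ?_ h
  refine NatTrans.ext (funext fun n => ConcreteCategory.hom_ext _ _ fun p => ?_)
  exact Prod.ext (Category.comp_id _) (Category.comp_id _)

/-- The map that collapses the whisker. -/
def smashWhiskerToPoint (S : AdmPt G) :
    CategoryTheory.Prod.fst SimplexCategoryᵒᵖ BiDelta ⋙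
      kappa.op ⋙ wedge (pointSet G) ⋙ smashLeft S ⟶
    (Functor.const _).obj ((smashLeft S).obj (pointSet G)) where
  app q := (smashLeft S).map (whiskerToPoint.app q)
  naturality _ _ f := ((smashLeft S).map_comp _ _).symm.trans
    (congrArg (smashLeft S).map (whiskerToPoint.naturality f) |>.trans
      ((congrArg (smashLeft S).map (Category.comp_id _)).trans (Category.comp_id _).symm))

lemma isHomologyEquiv_smashWhiskerToPoint (A B : AdmPt G) :
    IsHomologyEquiv R (Functor.whiskerRight
      (NatTrans.prod' (𝟙 (whiskered X ⋙ smashLeft S)) (smashWhiskerToPoint S)) (pairHom A B)) := by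
  have h := isUniversalEquiv_whiskerToPoint (R := R) X
    (((smashLeft S).prod (smashLeft S)) ⋙ pairHom A B)
  let L := smashLeft S
  let V := whiskered X
  let K := CategoryTheory.Prod.fst SimplexCategoryᵒᵖ BiDelta ⋙ kappa.op ⋙ wedge (pointSet G)
  let K' : SimplexCategoryᵒᵖ × BiDelta ⥤ AdmPt G := (Functor.const _).obj (pointSet G)
  let K'' : SimplexCategoryᵒᵖ × BiDelta ⥤ AdmPt G := (Functor.const _).obj (L.obj (pointSet G))
  let e : V.prod' K ⋙ L.prod L ⋙ pairHom A B ⟶ (V ⋙ L).prod' (K ⋙ L) ⋙ pairHom A B :=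
    { app _ := TypeCat.ofHom id
      naturality _ _ _ := rfl }
  let e' : V.prod' K' ⋙ L.prod L ⋙ pairHom A B ⟶ (V ⋙ L).prod' K'' ⋙ pairHom A B :=
    { app _ := TypeCat.ofHom id
      naturality q q' f := by
        refine ConcreteCategory.hom_ext _ _ fun p => ?_
        have h : L.map (K'.map f) = 𝟙 _ := L.map_id _
        exact Prod.ext rfl (congrArg (p.2 ≫ ·) h) }
  have he : IsHomologyEquiv R e := isHomologyEquiv_of_bijective_app _ fun _ => Function.bijective_id
  have he' : IsHomologyEquiv R e' :=
    isHomologyEquiv_of_bijective_app _ fun _ => Function.bijective_id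
  refine IsHomologyEquiv.of_square he he' ?_ h
  refine NatTrans.ext (funext fun q => ConcreteCategory.hom_ext _ _ fun p => ?_)
  exact Prod.ext (congrArg (p.1 ≫ ·) (L.map_id _)) rfl

/-- With `V` the whiskered smash product and `B` the bad part of `T`, restriction is the composition
of `Hom(T, V) = Hom(T^N, V) × Hom(B, V)` with the maps that replace the target of `B` by `S ∧
whisker` and then by `S ∧ pt`, where only one map remains. -/
lemma isHomologyEquiv_whiskered (hX : IsAdapted N X) (T : AdmPt G) :
    IsHomologyEquiv R (Functor.whiskerLeft (whiskered X ⋙ smashLeft S)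
      (coyoneda.map ((fixedIncl N).app T).op)) := by
  have h₁ : IsHomologyEquiv R (homToPair (whiskered X ⋙ smashLeft S)
      ((fixedIncl N).app T) (badRel N T).fst) :=
    isHomologyEquiv_of_bijective_app _ fun _ => bijective_hom_pair N T _
  have h₂ := isHomologyEquiv_pairHom_whiskered (R := R) S hX (smul_phi_lam N T) (badPart_eq_or N T)
  have h₃ := isHomologyEquiv_smashWhiskerToPoint (R := R) (X := X) S ((phi N ⋙ lam N).obj T)
    (badPart N T)
  have h₄ : IsHomologyEquiv R (pairToHom (whiskered X ⋙ smashLeft S)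
      ((Functor.const _).obj ((smashLeft S).obj (pointSet G)))
      ((phi N ⋙ lam N).obj T) (badPart N T)) := by
    refine isHomologyEquiv_of_bijective_app _ fun q => ⟨fun p p' h => ?_, fun f => ?_⟩
    · exact Prod.ext h ((subsingleton_hom_smash_pointSet S (badPart N T)).allEq _ _)
    · exact ⟨(f, Classical.choice (nonempty_hom_smash_pointSet S (badPart N T))), rfl⟩
  have h := ((h₁.comp h₂).comp h₃).comp h₄
  refine cast (congrArg (IsHomologyEquiv R) ?_) h
  refine NatTrans.ext (funext fun q => ConcreteCategory.hom_ext _ _ fun f => ?_)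
  exact (Category.comp_id (((fixedIncl N).app T ≫ f) ≫ 𝟙 _)).trans (Category.comp_id _)

/-- The whiskered object is compared with `X`, pulled back to the product with `Δᵒᵖ`. The extra
variable can then be dropped, since `Δᵒᵖ` has an initial object and the projection forgetting it is
a right adjoint. -/
lemma isHomologyEquiv_fixedIncl (hX : IsAdapted N X) (T : AdmPt G) :
    IsHomologyEquiv R (Functor.whiskerLeft (X ⋙ smashLeft S)
      (coyoneda.map ((fixedIncl N).app T).op)) := by
  have h (T : AdmPt G) := isUniversalEquiv_whiskeredFst (R := R) X (smashLeft S ⋙ homFun T)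
  refine (isHomologyEquiv_whiskerLeft_iff (sectRAdj isInitialOpZero) _).1
    (IsHomologyEquiv.of_square (h T) (h _) ?_ (isHomologyEquiv_whiskered S hX T))
  refine NatTrans.ext (funext fun q => ConcreteCategory.hom_ext _ _ fun f => ?_)
  exact Category.assoc ((fixedIncl N).app T) f _

end SmashRestriction

/-! ### Categories of pointed `G`-sets -/

section SmallCategories

variable {G : Type u} [Group G]

/-- A category of pointed `G`-sets of bounded size is essentially small. -/
lemma essentiallySmall_of_injective (P : ObjectProperty (PtGSet G)) (D : Type u)
    (h : ∀ S, P S → ∃ f : S.carrier → D, Function.Injective f) :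
    EssentiallySmall.{u} P.FullSubcategory := by
  let M := {A : Σ A : Set D, MulAction G A × A // ∀ g : G, A.2.1.smul g A.2.2 = A.2.2}
  let toPt (A : M) : PtGSet G :=
    { carrier := A.1.1
      action := A.1.2.1
      pt := A.1.2.2
      smul_pt := A.2 }
  have key (S : P.FullSubcategory) : ∃ A : M, Nonempty (S.obj ≅ toPt A) := by
    obtain ⟨f, hf⟩ := h S.obj S.property
    let e := Equiv.ofInjective f hf
    let act : MulAction G (Set.range f) := e.symm.mulAction G
    have hact (g : G) (s : S.obj.carrier) : act.smul g (e s) = e (g • s) :=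
      congrArg (fun t => e (g • t)) (e.symm_apply_apply s)
    refine ⟨⟨⟨Set.range f, act, e S.obj.pt⟩, fun g =>
      (hact g _).trans (congrArg e (S.obj.smul_pt g))⟩, ⟨?_⟩⟩
    exact
      { hom :=
          { toFun := e
            map_smul := fun g s => (hact g s).symm
            map_pt := rfl }
        inv :=
          { toFun := e.symm
            map_smul := fun g t => by
              obtain ⟨s, rfl⟩ := e.surjective t
              exact (congrArg e.symm (hact g s)).trans ((e.symm_apply_apply _).trans
                (congrArg (g • ·) (e.symm_apply_apply s).symm))
            map_pt := e.symm_apply_apply _ }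
        hom_inv_id := PtGSet.hom_ext fun s => e.symm_apply_apply s
        inv_hom_id := PtGSet.hom_ext fun s => e.apply_symm_apply s }
  have : Small.{u} (Skeleton P.FullSubcategory) := by
    choose A hA using key
    refine small_of_injective (β := M) (f := fun S => A ((fromSkeleton _).obj S)) fun S S' hS => ?_
    have e : ((fromSkeleton P.FullSubcategory).obj S).obj ≅
        ((fromSkeleton P.FullSubcategory).obj S').obj :=
      (hA _).some ≪≫ eqToIso (congrArg toPt hS) ≪≫ (hA _).some.symm
    exact skeleton_skeletal _ ⟨(fromSkeleton _).preimageIso (P.isoMk e)⟩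
  exact (essentiallySmall_iff _).2 ⟨this, inferInstance⟩

/-- A point is determined by its stabilizer `H` and its number in an enumeration of the finite set
`S^H`, so all admissible sets embed in one fixed set. -/
instance essentiallySmall_admPt : EssentiallySmall.{u} (AdmPt G) := by
  refine essentiallySmall_of_injective _ (Subgroup G × ℕ) fun S hS => ?_
  choose f hf using fun H : {H : Subgroup G // H.FiniteIndex} =>
    Set.countable_iff_exists_injOn.1 (hS.2 H.1 H.2).countable
  refine ⟨fun s => (MulAction.stabilizer G s, f ⟨_, hS.1 s⟩ s), fun s t h => ?_⟩
  obtain ⟨h₁, h₂⟩ := Prod.ext_iff.1 h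
  have h₃ : f ⟨_, hS.1 s⟩ = f ⟨_, hS.1 t⟩ := congrArg f (Subtype.ext h₁)
  refine hf ⟨_, hS.1 s⟩ (fun g => g.2) (fun g => ?_) (h₂.trans (congrFun h₃ t).symm)
  exact h₁.le g.2

instance essentiallySmall_finPt : EssentiallySmall.{u} (FinPt G) := by
  refine essentiallySmall_of_injective _ (ULift.{u} ℕ) fun S (hS : Finite S.carrier) => ?_
  obtain ⟨f, hf⟩ := exists_injective_nat S.carrier
  exact ⟨ULift.up ∘ f, ULift.up_injective.comp hf⟩

end SmallCategories

/-! ### The adjunction of `λ^N` and `φ^N`, and the fixed points of `S ∧ X` -/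

section FixedPoints

variable {G : Type u} [Group G] (N : Subgroup G) [N.Normal] [N.FiniteIndex]

/-- Inflation followed by fixed points is the identity. -/
def lamPhi : 𝟭 (FinPt (G ⧸ N)) ≅ lam N ⋙ phi N where
  hom :=
    { app S := ObjectProperty.homMk
        { toFun := fun s => ⟨s, fun n => by
            change (QuotientGroup.mk' N n) • (show S.obj.carrier from s) = s
            rw [show QuotientGroup.mk' N n = 1 from (QuotientGroup.eq_one_iff _).2 n.2, one_smul]⟩
          map_smul := fun w s => by
            induction w using QuotientGroup.induction_on with
            | H g => rfl
          map_pt := rfl } }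
  inv :=
    { app S := ObjectProperty.homMk
        { toFun := fun s => s.1
          map_smul := fun w s => by
            induction w using QuotientGroup.induction_on with
            | H g => rfl
          map_pt := rfl } }

/-- Inflation is left adjoint to fixed points. -/
def lamAdj : lam N ⊣ phi N :=
  Adjunction.mkOfUnitCounit
    { unit := (lamPhi N).hom
      counit := fixedIncl N }

variable {N}

/-- A map from an admissible pointed `G`-set factors through an injective map if its values lie in
the image. -/
lemma AdmPt.bijective_comp_of_injective {A S S' : AdmPt G} (j : S ⟶ S')
    (hj : Function.Injective j.hom.toFun)
    (h : ∀ (f : A ⟶ S') a, ∃ s, j.hom.toFun s = f.hom.toFun a) :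
    Function.Bijective (fun f : A ⟶ S => f ≫ j) := by
  refine ⟨fun f f' hf => AdmPt.hom_ext fun a => hj (AdmPt.congr_apply hf a), fun f => ?_⟩
  choose g hg using h f
  refine ⟨ObjectProperty.homMk
    { toFun := g
      map_smul := fun c a => hj ?_
      map_pt := hj ?_ }, AdmPt.hom_ext hg⟩
  · rw [hg, AdmPt.map_smul, AdmPt.map_smul, hg]
  · exact (hg _).trans (f.hom.map_pt.trans j.hom.map_pt.symm)

lemma bijective_comp_fixedIncl {A : AdmPt G} (hA : ∀ (a : A.obj.carrier), ∀ n ∈ N, n • a = a)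
    (S : AdmPt G) : Function.Bijective
      (fun f : A ⟶ (phi N ⋙ lam N).obj S => f ≫ (fixedIncl N).app S) := by
  refine AdmPt.bijective_comp_of_injective _ Subtype.val_injective fun f a => ?_
  refine ⟨⟨f.hom.toFun a, fun n => ?_⟩, rfl⟩
  exact (AdmPt.map_smul f n a).symm.trans (congrArg f.hom.toFun (hA a n n.2))

variable {X : BiDelta ⥤ AdmPt G} (hX : IsAdapted N X)

lemma IsAdapted.eq_pt_or_elt (n : BiDelta) (x : (X.obj n).obj.carrier)
    (hx : ∀ g ∈ N, g • x = x) : x = (X.obj n).obj.pt ∨ x = hX.elt n := by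
  let e := hX.fixed_iso.some
  let y : ((X ⋙ phi N).obj n).obj.carrier := ⟨x, fun g => hx g g.2⟩
  have hy : (e.inv.app n).hom.toFun ((e.hom.app n).hom.toFun y) = y :=
    FinPt.congr_apply (e.hom_inv_id_app n) y
  have hy' : ((e.inv.app n).hom.toFun ((e.hom.app n).hom.toFun y)).1 = x := congrArg Subtype.val hy
  generalize (e.hom.app n).hom.toFun y = z at hy'
  cases z with
  | none => exact Or.inl (hy'.symm.trans (congrArg Subtype.val (e.inv.app n).hom.map_pt))
  | some z => exact Or.inr hy'.symm

lemma IsAdapted.elt_ne_pt (n : BiDelta) : hX.elt n ≠ (X.obj n).obj.pt := fun h => by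
  let e := hX.fixed_iso.some
  have h₁ : (e.inv.app n).hom.toFun (some ⟨⟩) = (e.inv.app n).hom.toFun none :=
    Subtype.ext (h.trans (congrArg Subtype.val (e.inv.app n).hom.map_pt).symm)
  have h₂ := congrArg (e.hom.app n).hom.toFun h₁
  have h₃ (z) : (e.hom.app n).hom.toFun ((e.inv.app n).hom.toFun z) = z :=
    FinPt.congr_apply (e.inv_hom_id_app n) z
  exact Option.some_ne_none _ ((h₃ _).symm.trans (h₂.trans (h₃ _)))

/-- A non-distinguished point `s ∧ x` is fixed by `N` only if both `s` and `x` are, and then `x` is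
the unique non-distinguished element of `X^N`. So `S` and `S ∧ X(n)` have the same `N`-fixed points,
where maps from `A` take their values. -/
lemma bijective_comp_toSmash {A : AdmPt G} (hA : ∀ (a : A.obj.carrier), ∀ n ∈ N, n • a = a)
    (q : BiDelta × AdmPt G) : Function.Bijective
      (fun f : A ⟶ (projFunctor G).obj q => f ≫ hX.toSmash.app q) := by
  obtain ⟨n, S⟩ := q
  refine AdmPt.bijective_comp_of_injective _ (fun s s' h => ?_) fun f a => ?_
  · rcases (PtGSet.smashMk_eq_iff _ _ _ _ _ _).1 h with ⟨h, -⟩ | ⟨h, h'⟩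
    · exact h
    · exact (h.resolve_right (hX.elt_ne_pt n)).trans (h'.resolve_right (hX.elt_ne_pt n)).symm
  · obtain ⟨s, x, hsx⟩ := PtGSet.exists_smashMk S.obj (X.obj n).obj (f.hom.toFun a)
    by_cases hpt : s = S.obj.pt ∨ x = (X.obj n).obj.pt
    · exact ⟨S.obj.pt, (PtGSet.smashMk_eq_pt _ _ _ _ (Or.inl rfl)).trans
        ((PtGSet.smashMk_eq_pt _ _ _ _ hpt).symm.trans hsx.symm)⟩
    · refine ⟨s, ?_⟩
      have hx : x = hX.elt n := by
        refine (hX.eq_pt_or_elt n x fun g hg => ?_).resolve_left fun h => hpt (Or.inr h)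
        have h₁ : PtGSet.smashMk S.obj (X.obj n).obj (g • s) (g • x) =
            PtGSet.smashMk S.obj (X.obj n).obj s x := by
          rw [← PtGSet.smul_smashMk]
          exact (congrArg (g • ·) hsx.symm).trans ((AdmPt.map_smul f g a).symm.trans
            ((congrArg f.hom.toFun (hA a g hg)).trans hsx))
        rcases (PtGSet.smashMk_eq_iff _ _ _ _ _ _).1 h₁ with ⟨-, h⟩ | ⟨-, h⟩
        · exact h
        · exact absurd h hpt
      exact (congrArg (PtGSet.smashMk S.obj (X.obj n).obj s) hx.symm).trans hsx.symm

end FixedPoints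

/-! ### The averaging functor and geometric fixed points -/

section Corepresentable

variable {R : Type u} [Ring R] {C : Type u₁} [Category.{u} C]

lemma isFreelyGenerated_coyoneda (c : C) :
    IsFreelyGenerated (coyoneda.obj (Opposite.op c)) (fun _ : PUnit.{u + 1} => c)
      (fun _ => 𝟙 c) := fun d y => by
  refine ⟨⟨⟨⟩, y⟩, Category.id_comp y, ?_⟩
  rintro ⟨_, f⟩ h
  exact congrArg (Sigma.mk _) ((Category.id_comp f).symm.trans h)

/-- The two models of the functor corepresented by an object are isomorphic. -/
def coyonedaIsoCorep (c : C) : coyoneda.obj (Opposite.op c) ≅ corep.{u, u₁, u} c :=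
  NatIso.ofComponents (fun d => (corepEquiv.{u, u₁, u} c d).toIso) fun {d d'} f => by
    refine ConcreteCategory.hom_ext _ _ fun (g : c ⟶ d) => ?_
    exact (corep_map_corepEquiv.{u, u₁, u} g f).symm

lemma isSeparating_coyoneda : ObjectProperty.IsSeparating (.ofObj
    (fun c : C => (freeFun R).obj (coyoneda.obj (Opposite.op c)))) := fun M M' f g h => by
  refine isSeparating_corep_self.{u, u₁, u} (R := R) (C := C) f g ?_
  rintro _ ⟨c⟩ t
  refine (cancel_epi ((freeFun R).map (coyonedaIsoCorep c).hom)).1 ?_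
  rw [← Category.assoc, ← Category.assoc]
  exact h _ ⟨c⟩ _

instance projective_coyoneda (c : C) :
    Projective ((freeFun R).obj (coyoneda.obj (Opposite.op c))) :=
  (isFreelyGenerated_coyoneda c).projective

lemma isIso_pullMap_app_freeQ {C' : Type u₂} [Category.{v₂} C'] {I : Type u₃} [Category.{v₃} I]
    {γ γ' : I ⥤ C'} (α : γ ⟶ γ') (n : ℤ) (V : C' ⥤ Type u)
    (h : ∀ i, Function.Bijective (V.map (α.app i))) :
    IsIso ((pullMap R α).app ((freeQ R n).obj V)) := by
  have := isIso_of_bijective_app (Functor.whiskerRight α V) h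
  have h' := (Iso.eq_comp_inv (pullFree (R := R) γ' n V)).2 (pullFree_pullMap (R := R) α n V)
  rw [h']
  infer_instance

end Corepresentable

/-! ### Averaging on corepresentable functors and the comparison maps -/

section Averaging

variable {R : Type u} [Ring R] {G : Type u} [Group G] {N : Subgroup G} [N.Normal] [N.FiniteIndex]
  {X : BiDelta ⥤ AdmPt G} (P : DerivedLan R (projFunctor G)) (T : DerivedLan R (toPt BiDelta))

lemma map_comp_four {𝒞 : Type u₁} [Category.{v₁} 𝒞] {𝒟 : Type u₂} [Category.{v₂} 𝒟] (F : 𝒞 ⥤ 𝒟)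
    {A B C D E : 𝒞} {Z : 𝒟} (a : A ⟶ B) (b : B ⟶ C) (c : C ⟶ D) (d : D ⟶ E) (e : F.obj E ⟶ Z) :
    F.map (a ≫ b ≫ c ≫ d) ≫ e = F.map (a ≫ b) ≫ F.map (c ≫ d) ≫ e := by
  simp only [Functor.map_comp, Category.assoc]

lemma averagingValue_eq (S : AdmPt G) : averagingValue X P T S =
    Functor.whiskerRight (pullMap R (sliceMul X S).hom ≫
      (pullComp R (Prod.sectL BiDelta S) (mulFunctor X)).hom) T.functor ≫
    Functor.whiskerLeft (pull R (mulFunctor X)) (baseChange P T S) := by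
  refine NatTrans.ext (funext fun E => ?_)
  exact map_comp_four T.functor ((pullMap R (sliceMul X S).hom).app E)
    ((pullComp R (Prod.sectL BiDelta S) (mulFunctor X)).hom.app E)
    ((pull R (Prod.sectL BiDelta S)).map ((toAveraging X P).app E))
    ((sliceTrans R BiDelta S).app ((averaging X P).obj E))
    (T.adj.counit.app ((pull R (atPt S)).obj ((averaging X P).obj E)))

instance isIso_averagingValue (S : AdmPt G) : IsIso (averagingValue X P T S) := by
  rw [averagingValue_eq]
  have h₁ : IsIso (Functor.whiskerLeft (pull R (mulFunctor X)) (baseChange P T S)) := inferInstance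
  have h₂ : IsIso (Functor.whiskerRight (pullMap R (sliceMul X S).hom ≫
      (pullComp R (Prod.sectL BiDelta S) (mulFunctor X)).hom) T.functor) := inferInstance
  exact @IsIso.comp_isIso _ _ _ _ _ _ _ h₂ h₁

instance isIso_bigPhiValue (S : FinPt (G ⧸ N)) : IsIso (bigPhiValue N X P T S) := by
  have h₁ := isIso_averagingValue (X := X) P T ((lam N).obj S)
  have h₂ : IsIso (Functor.whiskerLeft (averaging X P)
      (pullMap R (atPtLam N S).hom ≫ (pullComp R (atPt S) (lam N)).hom)) := inferInstance
  exact @IsIso.comp_isIso _ _ _ _ _ _ _ h₁ h₂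

/-- By base change the value of `Av_X` at `S` is the homology of `S ∧ X`, and values at all `S`
detect isomorphisms. -/
lemma isIso_averaging_map {E E' : DFun R (AdmPt G)} (f : E ⟶ E')
    (h : ∀ S, IsHEquiv ((pull R (smashWith S X)).map f)) : IsIso ((averaging X P).map f) := by
  let T := (nonempty_derivedLan R (toPt BiDelta)).some
  refine isIso_of_isIso_pull_atPt _ fun S => ?_
  have := (isHEquiv_iff T _).1 (h S)
  exact (NatIso.isIso_map_iff (asIso (averagingValue X P T S)) f).1 this

/-- The morphism of free modules on corepresentable functors induced by the embedding of the fixed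
points. -/
def restrictFixed (R : Type u) [Ring R] (N : Subgroup G) [N.Normal] [N.FiniteIndex] (n : ℤ)
    (S : AdmPt G) :
    (freeQ R n).obj (homFun S) ⟶ (freeQ R n).obj (homFun ((phi N ⋙ lam N).obj S)) :=
  (freeQ R n).map (coyoneda.map ((fixedIncl N).app S).op)

lemma isIso_averaging_restrictFixed (hX : IsAdapted N X) (n : ℤ) (S : AdmPt G) :
    IsIso ((averaging X P).map (restrictFixed R N n S)) :=
  isIso_averaging_map P _ fun S' => (isHEquiv_freeQ_whiskerLeft_iff _ _ n).1
    (isHomologyEquiv_fixedIncl S' hX S n)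

/-- When `N` acts trivially on `A`, the map `p^* h_A ⟶ m_X^* h_A` is invertible. The initial object
of `(Δᵒᵖ)²` gives `p` a left adjoint section, so `p^*` is fully faithful and the unit of `L p_! ⊣
p^*` is invertible on objects pulled back along `p`. -/
lemma isIso_idToAveraging_app (hX : IsAdapted N X) {A : AdmPt G}
    (hA : ∀ (a : A.obj.carrier), ∀ n ∈ N, n • a = a) (n : ℤ) :
    IsIso ((idToAveraging P hX).app ((freeQ R n).obj (homFun A))) := by
  let E := (freeQ R n).obj (homFun A)
  have h₁ : IsIso ((pullMap R hX.toSmash).app E) :=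
    isIso_pullMap_app_freeQ _ _ _ (bijective_comp_toSmash hX hA)
  let ff : (pull R (projFunctor G)).FullyFaithful :=
    pullFullyFaithful R (sectRAdj isInitialBiDeltaZero) (sectProj G)
  have := ff.full
  have := ff.faithful
  have h₂ : IsIso ((toAveraging X P).app E) :=
    P.adj.isIso_unit_app_of_iso (asIso ((pullMap R hX.toSmash).app E)).symm
  have h₃ : IsIso ((pull R (sect G)).map ((pullMap R hX.toSmash).app E ≫
      (toAveraging X P).app E)) := inferInstance
  have h₄ : IsIso ((pullComp R (sect G) (projFunctor G)).inv ≫ pullMap R (sectProj G).hom ≫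
        (pullId R (AdmPt G)).hom) := inferInstance
  have h₅ : IsIso (((pullComp R (sect G) (projFunctor G)).inv ≫ pullMap R (sectProj G).hom ≫
        (pullId R (AdmPt G)).hom).app ((averaging X P).obj E)) := inferInstance
  have h₆ : IsIso ((pullMap R (sectProj G).inv).app E) := inferInstance
  have h₇ : IsIso ((pullComp R (sect G) (projFunctor G)).hom.app E) := inferInstance
  have h₈ : IsIso ((pullId R (AdmPt G)).inv.app E) := inferInstance
  exact @IsIso.comp_isIso _ _ _ _ _ _ _ h₈ (@IsIso.comp_isIso _ _ _ _ _ _ _ h₆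
    (@IsIso.comp_isIso _ _ _ _ _ _ _ h₇ (@IsIso.comp_isIso _ _ _ _ _ _ _ h₃ h₅)))

/-- The comparison of a complex with the restriction of its values to fixed points. -/
def pullFixed (R : Type u) [Ring R] (N : Subgroup G) [N.Normal] [N.FiniteIndex] :
    pull R (lam N) ⋙ pull R (phi N) ⟶ 𝟭 (DFun R (AdmPt G)) :=
  (pullComp R (phi N) (lam N)).inv ≫ pullMap R (fixedIncl N) ≫ (pullId R (AdmPt G)).hom

lemma isIso_pullFixed_app {A : AdmPt G} (hA : ∀ (a : A.obj.carrier), ∀ n ∈ N, n • a = a) (n : ℤ) :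
    IsIso ((pullFixed R N).app ((freeQ R n).obj (homFun A))) := by
  have h := isIso_pullMap_app_freeQ (R := R) (fixedIncl N) n (homFun A) (bijective_comp_fixedIncl hA)
  exact inferInstanceAs (IsIso (_ ≫ _ ≫ _))

/-- On `h_S`, the object `Av_X(h_S) ≅ Av_X(h_{S^N}) ≅ h_{S^N}` is unchanged by restriction to fixed
points, because maps out of `S^N` land in fixed points. -/
lemma isIso_pullPhiToAveraging (hX : IsAdapted N X) : IsIso (pullPhiToAveraging N X P) := by
  refine HasBoundedBelowCoreflections.isIso ?_ ?_ _ (isSeparating_coyoneda (R := R)) fun S n => ?_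
  · exact (((HasBoundedBelowCoreflections.id.comp_pull (mulFunctor X)).comp_derivedLan P).comp_pull
      (lam N)).comp_pull (phi N)
  · exact (HasBoundedBelowCoreflections.id.comp_pull (mulFunctor X)).comp_derivedLan P
  · have h₁ := isIso_averaging_restrictFixed (R := R) P hX n S
    have h₂ := isIso_idToAveraging_app (R := R) P hX (smul_phi_lam N S) n
    have h₃ := isIso_pullFixed_app (R := R) (smul_phi_lam N S) n
    let e := asIso ((averaging X P).map (restrictFixed R N n S)) ≪≫
      (asIso ((idToAveraging P hX).app ((freeQ R n).obj (homFun ((phi N ⋙ lam N).obj S))))).symm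
    exact (NatTrans.isIso_app_iff_of_iso (pullFixed R N) e).2 h₃

/-- The Kan extension sends `h_S` to `h_{φ S}`, where `φ` stands for `φ^N`. By the adjunction with
`λ^N`, `h_{S^N}` is the pullback of the same `h_{φ S}`, and the counit of the Kan extension is
invertible since `φ^{N*}` is fully faithful. -/
lemma isIso_derivedLan_restrictFixed (F : DerivedLan R (phi N)) (n : ℤ) (S : AdmPt G) :
    IsIso (F.functor.map (restrictFixed R N n S)) := by
  let V := coyoneda.obj (Opposite.op ((phi N).obj S))
  let α : homFun S ⟶ phi N ⋙ V :=
    { app S' := TypeCat.ofHom fun f => (phi N).map f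
      naturality _ _ f := ConcreteCategory.hom_ext _ _ fun g => (phi N).map_comp g f }
  let β : homFun ((phi N ⋙ lam N).obj S) ⟶ phi N ⋙ V :=
    { app S' := TypeCat.ofHom ((lamAdj N).homEquiv ((phi N).obj S) S')
      naturality _ _ f := ConcreteCategory.hom_ext _ _ fun g =>
        (lamAdj N).homEquiv_naturality_right g f }
  have hβ : IsIso β := isIso_of_bijective_app _ fun S' => ((lamAdj N).homEquiv _ S').bijective
  have hα : IsReflection (pull R (phi N)) ((freeQ R n).map α ≫ (pullFree (phi N) n V).inv) := by
    refine isReflection_freeQ (isFreelyGenerated_coyoneda S) α ?_ n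
    have := isFreelyGenerated_coyoneda ((phi N).obj S)
    rw [← (phi N).map_id] at this
    exact this
  have hαβ : coyoneda.map ((fixedIncl N).app S).op ≫ β = α := by
    refine NatTrans.ext (funext fun S' => ConcreteCategory.hom_ext _ _ fun f => ?_)
    rfl
  let ff : (pull R (phi N)).FullyFaithful := pullFullyFaithful R (lamAdj N) (lamPhi N).symm
  have := ff.full
  have := ff.faithful
  have h₁ := hα.isIso_homEquiv_symm F.adj
  rw [F.adj.homEquiv_counit] at h₁
  have h₂ : IsIso (F.functor.map ((freeQ R n).map α ≫ (pullFree (phi N) n V).inv)) :=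
    IsIso.of_isIso_comp_right _ (F.adj.counit.app _)
  have key : (freeQ R n).map α ≫ (pullFree (phi N) n V).inv =
      restrictFixed R N n S ≫ (freeQ R n).map β ≫ (pullFree (phi N) n V).inv := by
    rw [← hαβ, Functor.map_comp]
    exact Category.assoc _ _ _
  rw [key, F.functor.map_comp] at h₂
  exact IsIso.of_isIso_comp_right _ (F.functor.map
    ((freeQ R n).map β ≫ (pullFree (phi N) n V).inv))

/-- On generators, naturality along `h_S ⟶ h_{S^N}` reduces the claim to `h_{S^N}`: that map is
inverted by `Av_X` as well as by the Kan extension along `φ^N`. -/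
lemma isIso_whiskerRight_idToAveraging (hX : IsAdapted N X) (F : DerivedLan R (phi N)) :
    IsIso (Functor.whiskerRight (idToAveraging P hX) F.functor) := by
  refine HasBoundedBelowCoreflections.isIso ?_ ?_ _ (isSeparating_coyoneda (R := R)) fun S n => ?_
  · exact HasBoundedBelowCoreflections.id.comp_derivedLan F
  · exact ((HasBoundedBelowCoreflections.id.comp_pull (mulFunctor X)).comp_derivedLan
      P).comp_derivedLan F
  · have h₁ := isIso_averaging_restrictFixed (R := R) P hX n S
    have h₂ := isIso_idToAveraging_app (R := R) P hX (smul_phi_lam N S) n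
    have h₃ := isIso_derivedLan_restrictFixed F n S
    have h := (idToAveraging P hX).naturality (restrictFixed R N n S)
    have h₄ : IsIso (F.functor.map ((idToAveraging P hX).app ((freeQ R n).obj (homFun S)) ≫
        (averaging X P).map (restrictFixed R N n S))) := by
      rw [← h]
      exact (F.functor.map_comp _ _) ▸ @IsIso.comp_isIso _ _ _ _ _ _ _ h₃
        (inferInstanceAs (IsIso (F.functor.map ((idToAveraging P hX).app
          ((freeQ R n).obj (homFun ((phi N ⋙ lam N).obj S)))))))
    rw [F.functor.map_comp] at h₄
    exact @IsIso.of_isIso_comp_right _ _ _ _ _ _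
      (F.functor.map ((averaging X P).map (restrictFixed R N n S))) inferInstance h₄

lemma isIso_comparison (hX : IsAdapted N X) (hc : IsIso (pullPhiToAveraging N X P))
    (F : DerivedLan R (phi N)) : IsIso (comparison P hX hc F) := by
  let ff : (pull R (phi N)).FullyFaithful := pullFullyFaithful R (lamAdj N) (lamPhi N).symm
  have := ff.full
  have := ff.faithful
  have h₁ := isIso_whiskerRight_idToAveraging P hX F
  have h₂ : IsIso (Functor.whiskerRight (inv (pullPhiToAveraging N X P)) F.functor) := inferInstance
  have h₃ : IsIso (Functor.whiskerLeft (bigPhi N X P) F.adj.counit) := inferInstance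
  rw [comparison, Functor.whiskerRight_comp]
  exact @IsIso.comp_isIso _ _ _ _ _ _ _ (@IsIso.comp_isIso _ _ _ _ _ _ _ h₁ h₂) h₃

end Averaging

end

theorem mainTheorem10 {R : Type u} [Ring R] {G : Type u} [Group G]
    (N : Subgroup G) [N.Normal] [N.FiniteIndex] (X : BiDelta ⥤ AdmPt G) (hX : IsAdapted N X) :
    (Nonempty (DerivedLan R (projFunctor G)) ∧ Nonempty (DerivedLan R (phi N)) ∧
      Nonempty (DerivedLan R (toPt BiDelta))) ∧
    ∀ (P : DerivedLan R (projFunctor G)) (F : DerivedLan R (phi N))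
      (T : DerivedLan R (toPt BiDelta)),
      (∃ hc : IsIso (pullPhiToAveraging N X P), IsIso (comparison P hX hc F)) ∧
      ∀ S : FinPt (G ⧸ N), IsIso (bigPhiValue N X P T S) := by
  refine ⟨⟨nonempty_derivedLan R _, nonempty_derivedLan R _, nonempty_derivedLan R _⟩,
    fun P F T => ⟨?_, fun S => isIso_bigPhiValue P T S⟩⟩
  have hc := isIso_pullPhiToAveraging P hX
  exact ⟨hc, isIso_comparison P hX hc F⟩
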